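/- Let $0<p<1$, $0\le\alpha\le(1-p)/p$ and $v>0$, and let $\sigma=\sigma_{p,\alpha,v}$ be the trapezoidal variance profile on $[0,1]^2$: $\sigma(x,y)=v$ if $x<p$ and $y\ge p+\alpha x$, or if $x\ge p$ and $0\le y\le\min\{(x-p)/\alpha,\,p\}$ (with $(x-p)/\alpha:=+\infty$ if $\alpha=0$), and $\sigma(x,y)=0$ otherwise. Put $\kappa=1/(1-\alpha)$ (with $\kappa=\infty$ if $\alpha=1$) and $\gamma=(2p-1)/p$. *Lambert–Tsallis function.* Let $\exp_\kappa(z)=(1+z/\kappa)^\kappa$ (principal branch), $\exp_\infty(z)=e^z$, and $f_{\kappa,\gamma}(z)=\frac{z}{1+\gamma z}\exp_\kappa(z)$, considered for $1+z/\kappa\notin(-\infty,0]$ if $\kappa\ne1,\infty$ and for all $z$ if $\kappa\in\{1,\infty\}$, away from the pole $z=-1/\gamma$. Let $\mathcal S\subset\mathbb R$ be the set of real numbers that are not values of $f_{\kappa,\gamma}$ at real points of this domain. $W_{\kappa,\gamma}$ denotes the holomorphic function on $\mathbb C\setminus\overline{\mathcal S}$ with $W_{\kappa,\gamma}(0)=0$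 and $f_{\kappa,\gamma}(W_{\kappa,\gamma}(u))=u$ for $u$ near $0$. *Stieltjes transform associated to $\sigma$.* A probability measure $\mu_\sigma$ on $\mathbb R$ is associated to $\sigma$ if for each $z$ with $\operatorname{Im}z>1$ there is a unique (up to null sets) $\mathbb C^+$-valued $L^1$-solution $\eta_z$ on $[0,1]$ of $$\eta_z(x)=-\Bigl(z+\int_0^1\sigma(x,y)\,\eta_z(y)\,dy\Bigr)^{-1}\quad\text{for almost all }x\in[0,1],$$ and $\int_{\mathbb R}\frac{\mu_\sigma(dt)}{t-z}=\int_0^1\eta_z(x)\,dx$. Its Stieltjes transform is $S_\sigma(z)=\int_{\mathbb R}\frac{\mu_\sigma(dt)}{t-z}$, $z\in\mathbb C^+$; it is determined by $\sigma$, being holomorphic on $\mathbb C^+$. **Theorem.** $W_{\kappa,\gamma}$ and an associated measure $\mu_\sigma$ exist, and for every $z\in\mathbb C^+$ one has $-vp/z^2\in\mathbb C\setminus\overline{\mathcal S}$, $W_{\kappa,\gamma}(-vp/z^2)\ne0$ and $$S_\sigma(z)=-\frac{2p}{z\,W_{\kappa,\gamma}\!\left(-\frac{vp}{z^2}\right)}+\frac{1-2p}{z}-\frac{2z}{v}.$$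 -/

import Mathlib

open MeasureTheory Set Filter Topology

noncomputable section

namespace LambertTsallis

/-- The Tsallis exponential `exp_κ(z) = (1 + z/κ)^κ` (principal branch of the power),
with `exp_∞(z) = e^z`. The parameter `κ` is a nonzero real number or `∞`. -/
def tsallisExp : OnePoint ℝ → ℂ → ℂ
  | OnePoint.infty, z => Complex.exp z
  | OnePoint.some κ, z => (1 + z / (κ : ℂ)) ^ (κ : ℂ)

/-- The set where `exp_κ` is used: all of `ℂ` for `κ = ∞` and for `κ = 1` (where
`exp_1(z) = 1 + z` needs no branch of the power), and otherwise the set of all `z` with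
`1 + z/κ ∉ (-∞, 0]`. -/
def expDomain : OnePoint ℝ → Set ℂ
  | OnePoint.infty => univ
  | OnePoint.some κ => {z | κ = 1 ∨ 1 + z / (κ : ℂ) ∈ Complex.slitPlane}

/-- The generalized Tsallis function `f_{κ,γ}(z) = z / (1 + γ z) * exp_κ(z)`. -/
def genTsallis (κ : OnePoint ℝ) (γ : ℝ) (z : ℂ) : ℂ :=
  z / (1 + (γ : ℂ) * z) * tsallisExp κ z

/-- The set `𝒮 = ℝ ∖ f_{κ,γ}(ℝ)` of real numbers which are not values of `f_{κ,γ}` at a real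
point of its domain (the pole `-1/γ` being excluded). -/
def omittedReals (κ : OnePoint ℝ) (γ : ℝ) : Set ℝ :=
  {u | ¬ ∃ x : ℝ, (x : ℂ) ∈ expDomain κ ∧ 1 + γ * x ≠ 0 ∧ genTsallis κ γ (x : ℂ) = (u : ℂ)}

/-- The domain `ℂ ∖ closure 𝒮` of the main branch. -/
def mainDomain (κ : OnePoint ℝ) (γ : ℝ) : Set ℂ :=
  ((fun u : ℝ => (u : ℂ)) '' closure (omittedReals κ γ))ᶜ

/-- `W` is the Lambert--Tsallis function `W_{κ,γ}`: it is holomorphic on `ℂ ∖ closure 𝒮` and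
near `0` it is the local inverse of `f_{κ,γ}` with value `0` at `0`. -/
structure IsLambertTsallis (κ : OnePoint ℝ) (γ : ℝ) (W : ℂ → ℂ) : Prop where
  holomorphic : DifferentiableOn ℂ W (mainDomain κ γ)
  map_zero : W 0 = 0
  local_inverse : ∀ᶠ u in 𝓝 (0 : ℂ), genTsallis κ γ (W u) = u

end LambertTsallis

namespace VarianceProfile

/-- The Stieltjes transform `S_μ(z) = ∫ μ(dt) / (t - z)`. -/
def stieltjes (μ : Measure ℝ) (z : ℂ) : ℂ := ∫ t : ℝ, 1 / ((t : ℂ) - z) ∂μ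

/-- `η` is a `ℂ⁺`-valued `L¹`-solution on `[0,1]` of
`η(x) = -(z + ∫₀¹ σ(x,y) η(y) dy)⁻¹` for almost all `x`. -/
structure IsSolution (σ : ℝ → ℝ → ℝ) (z : ℂ) (η : ℝ → ℂ) : Prop where
  im_pos : ∀ x ∈ Icc (0 : ℝ) 1, 0 < (η x).im
  integrable : IntegrableOn η (Icc 0 1)
  eqn : ∀ᵐ x ∂(volume.restrict (Icc (0 : ℝ) 1)),
    η x = -(z + ∫ y in Icc (0 : ℝ) 1, (σ x y : ℂ) * η y)⁻¹

/-- `μ` is the probability measure `μ_σ` associated to the variance profile `σ`: for `Im z > 1`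
the functional equation has a solution `η_z`, unique up to null sets, and the Stieltjes transform
of `μ` at `z` is `∫₀¹ η_z(x) dx`. (The Stieltjes transform being holomorphic on `ℂ⁺`, this
determines it on all of `ℂ⁺`.) -/
structure IsAssociatedMeasure (σ : ℝ → ℝ → ℝ) (μ : Measure ℝ) : Prop where
  isProbability : IsProbabilityMeasure μ
  stieltjes_eq : ∀ z : ℂ, 1 < z.im → ∃ η : ℝ → ℂ, IsSolution σ z η ∧
    (∀ η' : ℝ → ℂ, IsSolution σ z η' → η' =ᵐ[volume.restrict (Icc (0 : ℝ) 1)] η) ∧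
    stieltjes μ z = ∫ x in Icc (0 : ℝ) 1, η x

/-- The trapezoidal variance profile with parameters `p`, `α` and value `v`. The condition
`p + α y ≤ x` is `y ≤ (x - p)/α`, with the bound read as `+∞` when `α = 0`. -/
def trapezoid (p α v : ℝ) (x y : ℝ) : ℝ :=
  open Classical in
  if (x < p ∧ p + α * x ≤ y) ∨ (p ≤ x ∧ 0 ≤ y ∧ y ≤ p ∧ p + α * y ≤ x) then v else 0

/-- `κ = 1/(1-α)`, which is `∞` for `α = 1`. -/
def angleParam (α : ℝ) : OnePoint ℝ :=
  open Classical in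
  if α = 1 then OnePoint.infty else OnePoint.some (1 / (1 - α))

/-- `γ = (2p-1)/p`. -/
def shapeParam (p : ℝ) : ℝ := (2 * p - 1) / p

end VarianceProfile

end

/-!
Write `a = 1 - α = 1/κ`, `F(x) = z + v ∫₀ˣ η` and `G(x) = z + v ∫ η` over `[p + α x, 1]`, for
`0 ≤ x ≤ p`. For the trapezoidal profile the functional equation says `η(x) = -1/G(x)` for `x < p`
and `η(x) = -1/F(c(x))` for `x ≥ p`, where `σ(x, ·)` is supported on `[0, c(x)]` (`cutoff`). Hence
`F' = -v/G` and `G' = α v/F`, so that `(F G)' = -a v`: the product `F G` is affine, and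
`F(x) = z exp_κ(x w / p)` for a complex number `w`. The boundary condition at `x = p` is exactly
`f_{κ,γ}(w) = -v p / z²`, and the equation at `x = 0` and `x = 1` gives `∫ η` in terms of `w`. The
predicate `IsParam` collects what `w` has to satisfy (the boundary condition, and `F(x) ∈ ℂ⁺`);
`IsParam.isSolution` and `IsParam.integral_paramSolution` turn such a `w` into a solution with the
stated integral.

* A solution of the functional equation is unique for every `z ∈ ℂ⁺` (`IsSolution.ae_eq`), by a
  contraction argument in the hyperbolic metric. So `w` is determined by `z` (`IsParam.unique`).
* A `w` exists for all `z ∈ ℂ⁺` (`exists_isParam`): the set of such `z` is open because the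
  derivative of `f_{κ,γ}` does not vanish at a parameter (`IsParam.exists_nhds`), and closed in
  `ℂ⁺` by the a priori bounds `Im z ≤ Im F, Im G` and `|F|, |G| ≤ |z| + v / Im z`
  (`exists_isParam_of_mem_closure`).
* The map `z ↦ u = -v p / z²` is a bijection from `ℂ⁺` to the slit plane; through it `w` becomes a
  holomorphic function of `u` (`slitBranch`), which commutes with complex conjugation.
* `slitBranch` extends across the real points `u ≤ 0` of `ℂ ∖ closure 𝒮`: these are values of `f_{κ,γ}` at
  real points where its derivative is positive (`exists_regular_genTsallis_eq`), and there the
  local inverse of `f_{κ,γ}` agrees with `slitBranch` (`mainBranch_eventuallyEq`). The extension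
  `mainBranch` is the Lambert–Tsallis function. Any other one agrees with it near `0`, hence on the
  slit plane.
* `∫ η_z` is holomorphic in `z`, has nonnegative imaginary part and is close to `-1/z` far from the
  real line, so it is the Stieltjes transform of a probability measure, by Nevanlinna's theorem
  (`exists_stieltjes_eq`). That theorem is proved from Poisson's formula and Prokhorov's theorem.
-/

namespace VarianceProfile

/-! ### Uniqueness of the solution of the functional equation -/

variable {σ : ℝ → ℝ → ℝ} {v : ℝ} {z : ℂ} {η η' : ℝ → ℂ}

theorem integrableOn_kernel_mul {𝕜 : Type*} [RCLike 𝕜] {f : ℝ → 𝕜} (hσ0 : ∀ x y, 0 ≤ σ x y)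
    (hσv : ∀ x y, σ x y ≤ v) (hσm : ∀ x, Measurable (σ x))
    (hf : IntegrableOn f (Icc 0 1)) (x : ℝ) :
    IntegrableOn (fun y => ((σ x y : ℝ) : 𝕜) * f y) (Icc 0 1) := by
  refine Integrable.bdd_mul (c := v) hf ?_ (ae_of_all _ fun y => ?_)
  · exact (RCLike.measurable_ofReal.comp (hσm x)).aestronglyMeasurable
  · rw [RCLike.norm_ofReal, abs_of_nonneg (hσ0 x y)]
    exact hσv x y

theorem kernelIntegral_im (hσ0 : ∀ x y, 0 ≤ σ x y) (hσv : ∀ x y, σ x y ≤ v)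
    (hσm : ∀ x, Measurable (σ x)) (hη : IntegrableOn η (Icc 0 1)) (x : ℝ) :
    (∫ y in Icc (0 : ℝ) 1, (σ x y : ℂ) * η y).im = ∫ y in Icc (0 : ℝ) 1, σ x y * (η y).im := by
  have h : IntegrableOn (fun y => (σ x y : ℂ) * η y) (Icc 0 1) :=
    integrableOn_kernel_mul (𝕜 := ℂ) hσ0 hσv hσm hη x
  have := integral_im h
  simp only [RCLike.im_to_complex] at this
  rw [← this]
  refine integral_congr_ae (ae_of_all _ fun y => ?_)
  simp

theorem kernelIntegral_im_nonneg (hσ0 : ∀ x y, 0 ≤ σ x y) (hσv : ∀ x y, σ x y ≤ v)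
    (hσm : ∀ x, Measurable (σ x)) (h : IsSolution σ z η) (x : ℝ) :
    0 ≤ (∫ y in Icc (0 : ℝ) 1, (σ x y : ℂ) * η y).im := by
  rw [kernelIntegral_im hσ0 hσv hσm h.integrable]
  exact setIntegral_nonneg measurableSet_Icc fun y hy => mul_nonneg (hσ0 x y) (h.im_pos y hy).le

theorem norm_kernelIntegral_le (hσ0 : ∀ x y, 0 ≤ σ x y) (hσv : ∀ x y, σ x y ≤ v)
    (hη : IntegrableOn η (Icc 0 1)) (x : ℝ) :
    ‖∫ y in Icc (0 : ℝ) 1, (σ x y : ℂ) * η y‖ ≤ v * ∫ y in Icc (0 : ℝ) 1, ‖η y‖ := by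
  rw [← integral_const_mul]
  refine norm_integral_le_of_norm_le (hη.norm.const_mul v) (ae_of_all _ fun y => ?_)
  rw [norm_mul, Complex.norm_real, Real.norm_of_nonneg (hσ0 x y)]
  exact mul_le_mul_of_nonneg_right (hσv x y) (norm_nonneg _)

/-- `√(AB) ≤ (tA + B/t)/2`, the inequality of means in a form linear in `A` and `B`, so that it can be
integrated. Equality holds for `t = √(B/A)`. -/
theorem sqrt_mul_le_weighted {A B t : ℝ} (hA : 0 ≤ A) (hB : 0 ≤ B) (ht : 0 < t) :
    √(A * B) ≤ (t * A + t⁻¹ * B) / 2 := by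
  apply Real.sqrt_le_iff.2 ⟨by positivity, ?_⟩
  have : A * B = (t * A) * (t⁻¹ * B) := by field_simp
  rw [this]
  nlinarith [sq_nonneg (t * A - t⁻¹ * B)]

/-- One step of the contraction behind uniqueness. The difference of two solutions is measured by
`|b - b'| / √(Im b · Im b')` with `b = z + ∫ σ η`, a quantity invariant under `b ↦ -1/b`; so it can
only decrease under averaging with `σ`, and the summand `z` makes it decrease by the factor `q`. -/
theorem kernelIntegral_sub_le_step (hσ0 : ∀ x y, 0 ≤ σ x y) (hσv : ∀ x y, σ x y ≤ v)
    (hσm : ∀ x, Measurable (σ x)) (hz : 0 < z.im) (h : IsSolution σ z η)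
    (h' : IsSolution σ z η') {b b' : ℝ → ℂ}
    (hb : ∀ x, b x = z + ∫ y in Icc (0 : ℝ) 1, (σ x y : ℂ) * η y)
    (hb' : ∀ x, b' x = z + ∫ y in Icc (0 : ℝ) 1, (σ x y : ℂ) * η' y)
    {q M : ℝ} (hM : 0 ≤ M) (hq : ∀ x, (b x).im - z.im ≤ q * (b x).im)
    (hq' : ∀ x, (b' x).im - z.im ≤ q * (b' x).im)
    (hle : ∀ x, ‖b x - b' x‖ ≤ M * √((b x).im * (b' x).im)) (x : ℝ) :
    ‖b x - b' x‖ ≤ q * M * √((b x).im * (b' x).im) := by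
  have him : ∀ x, z.im ≤ (b x).im := fun x => by
    rw [hb, Complex.add_im]; linarith [kernelIntegral_im_nonneg hσ0 hσv hσm h x]
  have him' : ∀ x, z.im ≤ (b' x).im := fun x => by
    rw [hb', Complex.add_im]; linarith [kernelIntegral_im_nonneg hσ0 hσv hσm h' x]
  have hB : 0 < (b x).im := hz.trans_le (him x)
  have hB' : 0 < (b' x).im := hz.trans_le (him' x)
  -- with this `t`, the weighted mean of `Im b(x)` and `Im b'(x)` is their geometric mean
  set t : ℝ := √((b' x).im / (b x).im) with ht
  have htpos : 0 < t := Real.sqrt_pos.2 (div_pos hB' hB)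
  have hI : IntegrableOn (fun y => (σ x y : ℂ) * η y) (Icc 0 1) :=
    integrableOn_kernel_mul (𝕜 := ℂ) hσ0 hσv hσm h.integrable x
  have hI' : IntegrableOn (fun y => (σ x y : ℂ) * η' y) (Icc 0 1) :=
    integrableOn_kernel_mul (𝕜 := ℂ) hσ0 hσv hσm h'.integrable x
  have hJ := integrableOn_kernel_mul (𝕜 := ℝ) hσ0 hσv hσm h.integrable.im x
  have hJ' := integrableOn_kernel_mul (𝕜 := ℝ) hσ0 hσv hσm h'.integrable.im x
  simp only [RCLike.im_to_complex, RCLike.ofReal_real_eq_id, id_eq] at hJ hJ'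
  have hdiff : b x - b' x = ∫ y in Icc (0 : ℝ) 1, (σ x y : ℂ) * (η y - η' y) := by
    rw [hb, hb']
    simp only [mul_sub]
    rw [integral_sub hI hI']
    ring
  have key : ∀ᵐ y ∂(volume.restrict (Icc (0 : ℝ) 1)), ‖(σ x y : ℂ) * (η y - η' y)‖ ≤
      M / 2 * (t * (σ x y * (η y).im) + t⁻¹ * (σ x y * (η' y).im)) := by
    filter_upwards [h.eqn, h'.eqn] with y hy hy'
    rw [← hb] at hy
    rw [← hb'] at hy'
    -- the hypothesis on `b` and `b'` is passed on to `η = -1/b` and `η' = -1/b'`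
    have hBy : 0 < (b y).im := hz.trans_le (him y)
    have hBy' : 0 < (b' y).im := hz.trans_le (him' y)
    have hne : b y ≠ 0 := fun h0 => by simp [h0] at hBy
    have hne' : b' y ≠ 0 := fun h0 => by simp [h0] at hBy'
    have e1 : η y - η' y = (b y - b' y) / (b y * b' y) := by
      rw [hy, hy']; field_simp; ring
    have e2 : (η y).im = (b y).im / ‖b y‖ ^ 2 := by
      rw [hy, Complex.neg_im, Complex.inv_im, Complex.normSq_eq_norm_sq]; ring
    have e3 : (η' y).im = (b' y).im / ‖b' y‖ ^ 2 := by
      rw [hy', Complex.neg_im, Complex.inv_im, Complex.normSq_eq_norm_sq]; ring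
    have n1 : 0 < ‖b y‖ := norm_pos_iff.2 hne
    have n2 : 0 < ‖b' y‖ := norm_pos_iff.2 hne'
    have e4 : ‖η y - η' y‖ ≤ M * √((η y).im * (η' y).im) := by
      have : √((η y).im * (η' y).im) = √((b y).im * (b' y).im) / (‖b y‖ * ‖b' y‖) := by
        rw [e2, e3, div_mul_div_comm, ← mul_pow, Real.sqrt_div' _ (by positivity),
          Real.sqrt_sq (by positivity)]
      rw [this, e1, norm_div, norm_mul, ← mul_div_assoc]
      exact div_le_div_of_nonneg_right (hle y) (by positivity)
    have p1 : 0 ≤ (η y).im := by rw [e2]; positivity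
    have p2 : 0 ≤ (η' y).im := by rw [e3]; positivity
    have e5 := sqrt_mul_le_weighted p1 p2 htpos
    rw [norm_mul, Complex.norm_real, Real.norm_of_nonneg (hσ0 x y)]
    calc σ x y * ‖η y - η' y‖ ≤ σ x y * (M * ((t * (η y).im + t⁻¹ * (η' y).im) / 2)) :=
          mul_le_mul_of_nonneg_left (e4.trans (mul_le_mul_of_nonneg_left e5 hM)) (hσ0 x y)
      _ = _ := by ring
  have hbound := norm_integral_le_of_norm_le
    (((hJ.const_mul t).add (hJ'.const_mul t⁻¹)).const_mul (M / 2)) key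
  simp only [Pi.add_apply] at hbound
  rw [← hdiff, integral_const_mul, integral_add (hJ.const_mul t) (hJ'.const_mul t⁻¹),
    integral_const_mul, integral_const_mul, ← kernelIntegral_im hσ0 hσv hσm h.integrable,
    ← kernelIntegral_im hσ0 hσv hσm h'.integrable] at hbound
  have f1 : (∫ y in Icc (0 : ℝ) 1, (σ x y : ℂ) * η y).im = (b x).im - z.im := by
    rw [hb, Complex.add_im]; ring
  have f2 : (∫ y in Icc (0 : ℝ) 1, (σ x y : ℂ) * η' y).im = (b' x).im - z.im := by
    rw [hb', Complex.add_im]; ring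
  rw [f1, f2] at hbound
  have g1 : t * (b x).im = √((b x).im * (b' x).im) := by
    rw [ht, Real.sqrt_div hB'.le, Real.sqrt_mul hB.le]
    have := Real.mul_self_sqrt hB.le
    have h0 := (Real.sqrt_pos.2 hB).ne'
    field_simp
    nlinarith [this]
  have g2 : t⁻¹ * (b' x).im = √((b x).im * (b' x).im) := by
    rw [ht, Real.sqrt_div hB'.le, Real.sqrt_mul hB.le]
    have := Real.mul_self_sqrt hB'.le
    have h0 := (Real.sqrt_pos.2 hB').ne'
    field_simp
    nlinarith [this]
  refine hbound.trans ?_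
  calc M / 2 * (t * ((b x).im - z.im) + t⁻¹ * ((b' x).im - z.im))
      ≤ M / 2 * (t * (q * (b x).im) + t⁻¹ * (q * (b' x).im)) := by
        gcongr
        · exact hq x
        · exact hq' x
    _ = M / 2 * (q * (t * (b x).im) + q * (t⁻¹ * (b' x).im)) := by ring
    _ = _ := by rw [g1, g2]; ring

/-- The functional equation with a bounded nonnegative profile has at most one solution up to
null sets, at every point of the upper half-plane: iterating the contraction step with the factor
`q = 1 - Im z / sup Im b < 1` gives `b = b'`. -/
theorem IsSolution.ae_eq (hσ0 : ∀ x y, 0 ≤ σ x y) (hσv : ∀ x y, σ x y ≤ v)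
    (hσm : ∀ x, Measurable (σ x)) (hz : 0 < z.im) (h : IsSolution σ z η)
    (h' : IsSolution σ z η') : η' =ᵐ[volume.restrict (Icc (0 : ℝ) 1)] η := by
  set b : ℝ → ℂ := fun x => z + ∫ y in Icc (0 : ℝ) 1, (σ x y : ℂ) * η y with hb
  set b' : ℝ → ℂ := fun x => z + ∫ y in Icc (0 : ℝ) 1, (σ x y : ℂ) * η' y with hb'
  have hv : 0 ≤ v := (hσ0 0 0).trans (hσv 0 0)
  have him : ∀ x, z.im ≤ (b x).im := fun x => by
    simp only [hb, Complex.add_im]; linarith [kernelIntegral_im_nonneg hσ0 hσv hσm h x]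
  have him' : ∀ x, z.im ≤ (b' x).im := fun x => by
    simp only [hb', Complex.add_im]; linarith [kernelIntegral_im_nonneg hσ0 hσv hσm h' x]
  set N := ∫ y in Icc (0 : ℝ) 1, ‖η y‖ with hN
  set N' := ∫ y in Icc (0 : ℝ) 1, ‖η' y‖ with hN'
  have hN0 : 0 ≤ N := integral_nonneg fun _ => norm_nonneg _
  have hN0' : 0 ≤ N' := integral_nonneg fun _ => norm_nonneg _
  set B := ‖z‖ + v * N + v * N' with hB
  have hzn : z.im ≤ ‖z‖ := (le_abs_self _).trans (Complex.abs_im_le_norm z)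
  have hBz : z.im ≤ B := by have := mul_nonneg hv hN0; have := mul_nonneg hv hN0'; linarith
  have hBpos : 0 < B := hz.trans_le hBz
  have hbB : ∀ x, (b x).im ≤ B := fun x => by
    have h1 := (le_abs_self _).trans (Complex.abs_im_le_norm (b x))
    have h2 := norm_add_le z (∫ y in Icc (0 : ℝ) 1, (σ x y : ℂ) * η y)
    have h3 := norm_kernelIntegral_le hσ0 hσv h.integrable x
    have := mul_nonneg hv hN0'
    simp only [hb] at h1 ⊢
    linarith
  have hbB' : ∀ x, (b' x).im ≤ B := fun x => by
    have h1 := (le_abs_self _).trans (Complex.abs_im_le_norm (b' x))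
    have h2 := norm_add_le z (∫ y in Icc (0 : ℝ) 1, (σ x y : ℂ) * η' y)
    have h3 := norm_kernelIntegral_le hσ0 hσv h'.integrable x
    have := mul_nonneg hv hN0
    simp only [hb'] at h1 ⊢
    linarith
  set q := 1 - z.im / B with hq
  have hq0 : 0 ≤ q := by rw [hq, sub_nonneg, div_le_one hBpos]; exact hBz
  have hq1 : q < 1 := by have := div_pos hz hBpos; linarith
  have hqle : ∀ c : ℝ, c ≤ B → c - z.im ≤ q * c := fun c hc => by
    have : z.im / B * c ≤ z.im := by
      rw [div_mul_eq_mul_div, div_le_iff₀ hBpos]; exact mul_le_mul_of_nonneg_left hc hz.le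
    rw [hq]; linarith
  set M := (v * N + v * N') / z.im with hM
  have hM0 : 0 ≤ M := by positivity
  have hstart : ∀ x, ‖b x - b' x‖ ≤ M * √((b x).im * (b' x).im) := fun x => by
    have h3 := norm_kernelIntegral_le hσ0 hσv h.integrable x
    have h3' := norm_kernelIntegral_le hσ0 hσv h'.integrable x
    have h4 : ‖b x - b' x‖ ≤ v * N + v * N' := by
      simp only [hb, hb', add_sub_add_left_eq_sub]
      exact (norm_sub_le _ _).trans (add_le_add h3 h3')
    have h5 : z.im ≤ √((b x).im * (b' x).im) :=
      Real.le_sqrt_of_sq_le (by rw [sq]; exact mul_le_mul (him x) (him' x) hz.le (hz.le.trans (him x)))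
    calc _ ≤ v * N + v * N' := h4
      _ = M * z.im := by rw [hM]; field_simp
      _ ≤ _ := mul_le_mul_of_nonneg_left h5 hM0
  have hiter : ∀ n : ℕ, ∀ x, ‖b x - b' x‖ ≤ q ^ n * M * √((b x).im * (b' x).im) := by
    intro n
    induction n with
    | zero => simpa using hstart
    | succ n ih =>
      intro x
      have := kernelIntegral_sub_le_step hσ0 hσv hσm hz h h' (b := b) (b' := b')
        (fun _ => rfl) (fun _ => rfl) (by positivity) (fun x => hqle _ (hbB x))
        (fun x => hqle _ (hbB' x)) ih x
      rw [pow_succ']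
      simpa only [mul_assoc] using this
  have heq : ∀ x, b x = b' x := fun x => by
    have hlim : Tendsto (fun n : ℕ => q ^ n * M * √((b x).im * (b' x).im)) atTop (𝓝 0) := by
      have := ((tendsto_pow_atTop_nhds_zero_of_lt_one hq0 hq1).mul_const M).mul_const
        (√((b x).im * (b' x).im))
      simpa using this
    have := ge_of_tendsto' hlim (fun n => hiter n x)
    exact sub_eq_zero.1 (norm_le_zero_iff.1 this)
  filter_upwards [h.eqn, h'.eqn] with y hy hy'
  rw [hy, hy']
  have := heq y
  simp only [hb, hb'] at this
  rw [this]

end VarianceProfile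

namespace VarianceProfile

open ComplexConjugate Complex ProbabilityTheory

/-! ### Poisson's formula in the upper half-plane -/

theorem isOpen_im_gt (c : ℝ) : IsOpen {ζ : ℂ | c < ζ.im} := isOpen_lt continuous_const continuous_im

/-- The function `(F ζ - F z) / ((ζ - z) (ζ - conj z))`, holomorphic on a neighbourhood of the
closed upper half-plane and of size `|ζ|⁻²`, has integral zero along the real line. -/
theorem integral_sub_div_eq_zero {F : ℂ → ℂ} {δ M : ℝ} (hδ : 0 < δ)
    (hF : DifferentiableOn ℂ F {ζ | -δ < ζ.im}) (hM : ∀ ζ : ℂ, 0 ≤ ζ.im → ‖F ζ‖ ≤ M)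
    {z : ℂ} (hz : 0 < z.im)
    (hint : Integrable fun t : ℝ => (F t - F z) / ((t - z) * (t - conj z))) :
    ∫ t : ℝ, (F t - F z) / ((t - z) * (t - conj z)) = 0 := by
  have hM0 : 0 ≤ M := (norm_nonneg _).trans (hM z hz.le)
  set h : ℂ → ℂ := fun ζ => dslope F z ζ / (ζ - conj z) with hh
  have hdiff : DifferentiableOn ℂ h {ζ | -(min δ z.im) < ζ.im} := by
    have hsub : {ζ : ℂ | -(min δ z.im) < ζ.im} ⊆ {ζ | -δ < ζ.im} := fun ζ hζ => by
      have := min_le_left δ z.im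
      simp only [mem_ofPred_eq] at hζ ⊢
      linarith
    refine DifferentiableOn.div ?_ (by fun_prop) fun ζ hζ h0 => ?_
    · refine (differentiableOn_dslope ((isOpen_im_gt _).mem_nhds ?_)).2 (hF.mono hsub)
      have := lt_min hδ hz
      simp only [mem_ofPred_eq]
      linarith
    · have h1 := congrArg im h0
      have := min_le_right δ z.im
      simp only [sub_im, conj_im, zero_im, mem_ofPred_eq] at h1 hζ
      linarith
  have hne : ∀ ζ : ℂ, ζ ≠ z → h ζ = (F ζ - F z) / ((ζ - z) * (ζ - conj z)) := fun ζ hζ => by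
    simp only [hh, dslope_of_ne _ hζ, slope_def_field]
    rw [div_div]
  have hreal : ∀ t : ℝ, h t = (F t - F z) / ((t - z) * (t - conj z)) := fun t =>
    hne _ fun h0 => by have := congrArg im h0; simp at this; linarith
  have hbound : ∀ T : ℝ, 0 < T → 2 * ‖z‖ ≤ T → ∀ ζ : ℂ, 0 ≤ ζ.im → T ≤ ‖ζ‖ →
      ‖h ζ‖ ≤ 8 * M / T ^ 2 := by
    intro T hT hzT ζ hζ hTζ
    have e1 : T / 2 ≤ ‖ζ - z‖ := by linarith [norm_sub_norm_le ζ z]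
    have e2 : T / 2 ≤ ‖ζ - conj z‖ := by
      have := norm_sub_norm_le ζ (conj z)
      rw [Complex.norm_conj] at this
      linarith
    have hζz : ζ ≠ z := fun h0 => by rw [h0, sub_self, norm_zero] at e1; linarith
    have e3 : T / 2 * (T / 2) ≤ ‖ζ - z‖ * ‖ζ - conj z‖ :=
      mul_le_mul e1 e2 (by positivity) (norm_nonneg _)
    have e4 : ‖F ζ - F z‖ ≤ 2 * M := (norm_sub_le _ _).trans (by linarith [hM ζ hζ, hM z hz.le])
    rw [hne ζ hζz, norm_div, norm_mul]
    calc _ ≤ 2 * M / (T / 2 * (T / 2)) :=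
          div_le_div₀ (by positivity) e4 (by positivity) e3
      _ = _ := by field_simp; ring
  -- on the rectangle `[-T, T] × [0, T]` the three sides off the real line contribute `O(1/T)`
  have hrect : ∀ T : ℝ, 0 < T → 2 * ‖z‖ ≤ T → ‖∫ t in -T..T, h t‖ ≤ 32 * M / T := by
    intro T hT hzT
    have hR := integral_boundary_rect_eq_zero_of_differentiableOn h (-(T : ℂ)) (T + T * I)
      (hdiff.mono fun ζ hζ => by
        have h2 := hζ.2
        simp only [neg_im, ofReal_im, neg_zero, add_im, mul_im, ofReal_re, I_im, mul_one, I_re,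
          mul_zero, add_zero, zero_add, mem_preimage] at h2
        rw [uIcc_of_le hT.le] at h2
        have := lt_min hδ hz
        have := h2.1
        simp only [mem_ofPred_eq]
        linarith)
    simp only [neg_re, ofReal_re, neg_im, ofReal_im, neg_zero, add_re, mul_re, I_re, mul_zero, I_im,
      mul_one, sub_zero, add_zero, add_im, mul_im, zero_add, ofReal_zero, zero_mul, smul_eq_mul,
      ofReal_neg] at hR
    have b1 : ‖∫ x in -T..T, h (x + T * I)‖ ≤ 8 * M / T ^ 2 * |T - -T| := by
      refine intervalIntegral.norm_integral_le_of_norm_le_const fun x _ => ?_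
      refine hbound T hT hzT _ (by simp [hT.le]) ?_
      refine le_trans ?_ (Complex.abs_im_le_norm _)
      simp [abs_of_pos hT]
    have b2 : ‖∫ y in (0 : ℝ)..T, h (T + y * I)‖ ≤ 8 * M / T ^ 2 * |T - 0| := by
      refine intervalIntegral.norm_integral_le_of_norm_le_const fun x hx => ?_
      rw [uIoc_of_le hT.le] at hx
      refine hbound T hT hzT _ (by simp [hx.1.le]) ?_
      refine le_trans ?_ (Complex.abs_re_le_norm _)
      simp [abs_of_pos hT]
    have b3 : ‖∫ y in (0 : ℝ)..T, h (-T + y * I)‖ ≤ 8 * M / T ^ 2 * |T - 0| := by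
      refine intervalIntegral.norm_integral_le_of_norm_le_const fun x hx => ?_
      rw [uIoc_of_le hT.le] at hx
      refine hbound T hT hzT _ (by simp [hx.1.le]) ?_
      refine le_trans ?_ (Complex.abs_re_le_norm _)
      simp [abs_of_pos hT]
    have e : ∫ t in -T..T, h t = (∫ x in -T..T, h (x + T * I)) -
        I * (∫ y in (0 : ℝ)..T, h (T + y * I)) + I * ∫ y in (0 : ℝ)..T, h (-T + y * I) := by
      linear_combination hR
    rw [e]
    refine (norm_add_le _ _).trans ?_
    have b4 := norm_sub_le (∫ x in -T..T, h (x + T * I)) (I * (∫ y in (0 : ℝ)..T, h (T + y * I)))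
    rw [norm_mul, norm_I, one_mul] at b4 ⊢
    have a1 : |T - -T| = 2 * T := by rw [abs_of_pos] <;> linarith
    have a2 : |T - 0| = T := by rw [abs_of_pos] <;> linarith
    rw [a1] at b1
    rw [a2] at b2 b3
    have : 32 * M / T = 8 * M / T ^ 2 * (2 * T) + 8 * M / T ^ 2 * T + 8 * M / T ^ 2 * T := by
      field_simp; ring
    linarith
  have hlim : Tendsto (fun T : ℝ => ∫ t in -T..T, h t) atTop
      (𝓝 (∫ t : ℝ, (F t - F z) / ((t - z) * (t - conj z)))) := by
    simp_rw [hreal]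
    exact intervalIntegral_tendsto_integral hint tendsto_neg_atTop_atBot tendsto_id
  refine tendsto_nhds_unique hlim (squeeze_zero_norm' ?_ (tendsto_const_nhds.div_atTop tendsto_id :
    Tendsto (fun T : ℝ => 32 * M / T) atTop (𝓝 0)))
  filter_upwards [eventually_gt_atTop 0, eventually_ge_atTop (2 * ‖z‖)] with T h1 h2
    using hrect T h1 h2

theorem sub_mul_sub_conj (t : ℝ) (z : ℂ) :
    ((t : ℂ) - z) * (t - conj z) = (((t - z.re) ^ 2 + z.im ^ 2 : ℝ) : ℂ) := by
  apply Complex.ext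
  · simp [sq]
  · simp [sq]; ring

/-- Up to the factor `π`, the Poisson kernel is the density of a Cauchy distribution. -/
theorem integrable_poissonKernel {z : ℂ} (hz : 0 < z.im) :
    Integrable fun t : ℝ => z.im / ((t - z.re) ^ 2 + z.im ^ 2) := by
  have := (integrable_cauchyPDFReal z.re (γ := ⟨z.im, hz.le⟩)).const_mul Real.pi
  refine this.congr (ae_of_all _ fun t => ?_)
  change Real.pi * (Real.pi⁻¹ * z.im * ((t - z.re) ^ 2 + z.im ^ 2)⁻¹) = _
  rw [mul_assoc, mul_inv_cancel_left₀ Real.pi_ne_zero]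
  exact (div_eq_mul_inv _ _).symm

theorem integral_poissonKernel {z : ℂ} (hz : 0 < z.im) :
    ∫ t : ℝ, z.im / ((t - z.re) ^ 2 + z.im ^ 2) = Real.pi := by
  have := integral_cauchyPDFReal_eq_one z.re (γ := ⟨z.im, hz.le⟩)
    (fun h => hz.ne' (congrArg NNReal.toReal h))
  have h2 := congrArg (Real.pi * ·) this
  simp only [mul_one] at h2
  rw [← h2, ← integral_const_mul]
  refine integral_congr_ae (ae_of_all _ fun t => ?_)
  change _ = Real.pi * (Real.pi⁻¹ * z.im * ((t - z.re) ^ 2 + z.im ^ 2)⁻¹)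
  rw [mul_assoc, mul_inv_cancel_left₀ Real.pi_ne_zero]
  exact div_eq_mul_inv _ _

/-- Poisson's formula in the upper half-plane for the imaginary part of a bounded function which is
holomorphic across the real line. -/
theorem integral_poissonKernel_mul_im {F : ℂ → ℂ} {δ M : ℝ} (hδ : 0 < δ)
    (hF : DifferentiableOn ℂ F {ζ | -δ < ζ.im}) (hM : ∀ ζ : ℂ, 0 ≤ ζ.im → ‖F ζ‖ ≤ M)
    {z : ℂ} (hz : 0 < z.im) :
    Integrable (fun t : ℝ => z.im / ((t - z.re) ^ 2 + z.im ^ 2) * (F t).im) ∧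
    ∫ t : ℝ, z.im / ((t - z.re) ^ 2 + z.im ^ 2) * (F t).im = Real.pi * (F z).im := by
  have hcont : Continuous fun t : ℝ => F t := by
    rw [continuous_iff_continuousAt]
    intro t
    have h1 : ContinuousAt F (t : ℂ) :=
      (hF.differentiableAt ((isOpen_im_gt _).mem_nhds (by simpa using hδ))).continuousAt
    exact ContinuousAt.comp (f := fun t : ℝ => (t : ℂ)) h1 continuous_ofReal.continuousAt
  have hk := integrable_poissonKernel hz
  have hkC : Integrable fun t : ℝ => ((z.im / ((t - z.re) ^ 2 + z.im ^ 2) : ℝ) : ℂ) := hk.ofReal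
  have hi1 : Integrable fun t : ℝ =>
      ((z.im / ((t - z.re) ^ 2 + z.im ^ 2) : ℝ) : ℂ) * (F t - F z) := by
    refine hkC.mul_bdd (c := 2 * M) (hcont.sub continuous_const).aestronglyMeasurable
      (ae_of_all _ fun t => (norm_sub_le _ _).trans ?_)
    linarith [hM t (by simp), hM z hz.le]
  have hzne : (z.im : ℂ) ≠ 0 := ofReal_ne_zero.2 hz.ne'
  have heq : ∀ t : ℝ, (F t - F z) / ((t - z) * (t - conj z)) =
      (z.im : ℂ)⁻¹ * (((z.im / ((t - z.re) ^ 2 + z.im ^ 2) : ℝ) : ℂ) * (F t - F z)) := fun t => by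
    rw [sub_mul_sub_conj, ofReal_div]
    have : (((t - z.re) ^ 2 + z.im ^ 2 : ℝ) : ℂ) ≠ 0 := ofReal_ne_zero.2 (by positivity)
    field_simp
  -- the Poisson kernel is `Im z / |t - z|²`, a constant multiple of `1 / ((t - z) (t - conj z))`
  have h0 := integral_sub_div_eq_zero hδ hF hM hz (by simp_rw [heq]; exact hi1.const_mul _)
  simp_rw [heq] at h0
  rw [integral_const_mul, mul_eq_zero] at h0
  replace h0 := h0.resolve_left (inv_ne_zero hzne)
  have h1 := integral_im hi1
  rw [h0] at h1
  simp only [RCLike.im_to_complex, im_ofReal_mul, sub_im, zero_im] at h1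
  have hi2 : Integrable (fun t : ℝ => z.im / ((t - z.re) ^ 2 + z.im ^ 2) * (F t).im) := by
    refine hk.mul_bdd (c := M) (continuous_im.comp hcont).aestronglyMeasurable
      (ae_of_all _ fun t => ?_)
    exact (Complex.abs_im_le_norm _).trans (hM t (by simp))
  refine ⟨hi2, ?_⟩
  simp only [mul_sub] at h1
  rw [integral_sub hi2 (hk.mul_const _), integral_mul_const, integral_poissonKernel hz] at h1
  linarith

end VarianceProfile

namespace VarianceProfile

open ComplexConjugate Complex ProbabilityTheory

/-! ### Stieltjes transforms and Nevanlinna's representation -/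

theorem im_one_div_ofReal_sub (t : ℝ) (z : ℂ) :
    (1 / ((t : ℂ) - z)).im = z.im / ((t - z.re) ^ 2 + z.im ^ 2) := by
  rw [one_div, inv_im]
  simp only [sub_im, ofReal_im, zero_sub, neg_neg, normSq_apply, sub_re, ofReal_re]
  congr 1
  ring

theorem norm_one_div_ofReal_sub_le (t : ℝ) {z : ℂ} (hz : 0 < z.im) :
    ‖1 / ((t : ℂ) - z)‖ ≤ 1 / z.im := by
  rw [norm_div, norm_one]
  refine one_div_le_one_div_of_le hz ?_
  have := Complex.abs_im_le_norm ((t : ℂ) - z)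
  simp only [sub_im, ofReal_im, zero_sub, abs_neg] at this
  exact (le_abs_self _).trans this

theorem ofReal_sub_ne_zero (t : ℝ) {z : ℂ} (hz : 0 < z.im) : (t : ℂ) - z ≠ 0 := fun h => by
  have := congrArg im h
  simp at this
  linarith

theorem continuous_one_div_ofReal_sub {z : ℂ} (hz : 0 < z.im) :
    Continuous fun t : ℝ => 1 / ((t : ℂ) - z) :=
  continuous_const.div (by fun_prop) fun t => ofReal_sub_ne_zero t hz

theorem integrable_one_div_ofReal_sub (μ : Measure ℝ) [IsFiniteMeasure μ] {z : ℂ} (hz : 0 < z.im) :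
    Integrable (fun t : ℝ => 1 / ((t : ℂ) - z)) μ :=
  Integrable.of_bound (continuous_one_div_ofReal_sub hz).aestronglyMeasurable (1 / z.im)
    (ae_of_all _ fun t => norm_one_div_ofReal_sub_le t hz)

theorem norm_stieltjes_le (μ : Measure ℝ) [IsProbabilityMeasure μ] {z : ℂ} (hz : 0 < z.im) :
    ‖stieltjes μ z‖ ≤ 1 / z.im := by
  have := norm_integral_le_of_norm_le_const (μ := μ)
    (ae_of_all _ fun t => norm_one_div_ofReal_sub_le t hz)
  simpa [stieltjes] using this

theorem stieltjes_im (μ : Measure ℝ) [IsFiniteMeasure μ] {z : ℂ} (hz : 0 < z.im) :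
    (stieltjes μ z).im = ∫ t : ℝ, z.im / ((t - z.re) ^ 2 + z.im ^ 2) ∂μ := by
  have h := integral_im (integrable_one_div_ofReal_sub μ hz)
  simp only [RCLike.im_to_complex, im_one_div_ofReal_sub] at h
  exact h.symm

theorem differentiableOn_stieltjes (μ : Measure ℝ) [IsFiniteMeasure μ] :
    DifferentiableOn ℂ (stieltjes μ) {z | 0 < z.im} := by
  have h : DifferentiableOn ℂ (resolventTransform μ) {z : ℂ | 0 < z.im} := by
    refine (analyticOn_resolventTransform (𝕜 := ℝ) (μ := μ)).differentiableOn.mono ?_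
    rintro z hz ⟨t, -, rfl⟩
    simp at hz
  refine h.congr fun z _ => ?_
  rw [resolventTransform_apply]
  refine integral_congr_ae (ae_of_all _ fun t => ?_)
  simp only [resolvent, coe_algebraMap, Ring.inverse_eq_inv', one_div]

/-- A real-valued holomorphic function on the upper half-plane is constant, by the open mapping
theorem. -/
theorem eq_const_of_im_eq_zero {D : ℂ → ℂ} (hD : DifferentiableOn ℂ D {z | 0 < z.im})
    (h : ∀ z : ℂ, 0 < z.im → (D z).im = 0) : ∃ c, ∀ z : ℂ, 0 < z.im → D z = c := by
  have ho : IsOpen {z : ℂ | 0 < z.im} := isOpen_im_gt 0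
  have hc : IsPreconnected {z : ℂ | 0 < z.im} := (convex_halfSpace_im_gt 0).isPreconnected
  refine ((hD.analyticOnNhd ho).is_constant_or_isOpen hc).resolve_right fun hopen => ?_
  have hI : I ∈ {z : ℂ | 0 < z.im} := by simp
  have := (hopen _ subset_rfl ho).mem_nhds (mem_image_of_mem D hI)
  rw [Metric.mem_nhds_iff] at this
  obtain ⟨ε, hε, hball⟩ := this
  have hmem : D I + (ε / 2 : ℝ) * I ∈ Metric.ball (D I) ε := by
    rw [Metric.mem_ball, dist_eq_norm, add_sub_cancel_left, norm_mul, norm_I, mul_one,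
      Complex.norm_real, Real.norm_of_nonneg (by linarith)]
    linarith
  obtain ⟨w, hw, hDw⟩ := hball hmem
  have h1 := congrArg im hDw
  rw [h w hw] at h1
  simp [h I hI] at h1
  linarith

/-- The measure with density `π⁻¹ Im S(t + iε)`. For `ε → 0` it approximates the measure whose
Stieltjes transform is `S`. Negative values of `Im S` are cut off; they do not occur below. -/
noncomputable def boundaryMeasure (S : ℂ → ℂ) (ε : ℝ) : Measure ℝ :=
  volume.withDensity fun t : ℝ => ENNReal.ofReal (Real.pi⁻¹ * (S (t + ε * I)).im)

section Herglotz

variable {S : ℂ → ℂ} {K ε : ℝ}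

theorem norm_le_of_norm_mul_add_one_le (hK : 0 ≤ K)
    (hd : ∀ z : ℂ, 0 < z.im → ‖z * S z + 1‖ ≤ K / z.im ^ 2) (hε : 0 < ε) {z : ℂ}
    (hz : ε ≤ z.im) : ‖S z‖ ≤ (1 + K / ε ^ 2) / ε := by
  have hz0 := hε.trans_le hz
  have h1 : ε ≤ ‖z‖ := hz.trans ((le_abs_self _).trans (Complex.abs_im_le_norm z))
  have h2 : ‖z * S z‖ ≤ 1 + K / ε ^ 2 := by
    have h3 : K / z.im ^ 2 ≤ K / ε ^ 2 := by gcongr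
    have h4 := norm_sub_le (z * S z + 1) 1
    rw [add_sub_cancel_right, norm_one] at h4
    linarith [hd z hz0]
  rw [norm_mul] at h2
  rw [le_div_iff₀ hε]
  calc ‖S z‖ * ε ≤ ‖S z‖ * ‖z‖ := by gcongr
    _ = ‖z‖ * ‖S z‖ := mul_comm _ _
    _ ≤ _ := h2

theorem continuous_im_shift (hS : DifferentiableOn ℂ S {z | 0 < z.im}) (hε : 0 < ε) :
    Continuous fun t : ℝ => (S (t + ε * I)).im := by
  refine continuous_im.comp (continuous_iff_continuousAt.2 fun t => ?_)
  have h1 : ContinuousAt S (t + ε * I) :=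
    (hS.differentiableAt ((isOpen_im_gt _).mem_nhds (by simpa using hε))).continuousAt
  exact ContinuousAt.comp (f := fun t : ℝ => (t : ℂ) + ε * I) h1 (by fun_prop)

theorem integral_boundaryMeasure (hS : DifferentiableOn ℂ S {z | 0 < z.im})
    (him : ∀ z : ℂ, 0 < z.im → 0 ≤ (S z).im) (hε : 0 < ε) (g : ℝ → ℝ) :
    ∫ t, g t ∂(boundaryMeasure S ε) = ∫ t : ℝ, Real.pi⁻¹ * (g t * (S (t + ε * I)).im) := by
  rw [boundaryMeasure, integral_withDensity_eq_integral_toReal_smul]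
  · refine integral_congr_ae (ae_of_all _ fun t => ?_)
    have : 0 ≤ (S (t + ε * I)).im := him _ (by simpa using hε)
    simp only [smul_eq_mul]
    rw [ENNReal.toReal_ofReal (by positivity)]
    ring
  · exact ((continuous_im_shift hS hε).measurable.const_mul _).ennreal_ofReal
  · simp

/-- The Poisson integral of `boundaryMeasure S ε` is `Im S(z + iε)`. -/
theorem integral_poissonKernel_boundaryMeasure (hS : DifferentiableOn ℂ S {z | 0 < z.im})
    (him : ∀ z : ℂ, 0 < z.im → 0 ≤ (S z).im) (hK : 0 ≤ K)
    (hd : ∀ z : ℂ, 0 < z.im → ‖z * S z + 1‖ ≤ K / z.im ^ 2) (hε : 0 < ε) {z : ℂ}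
    (hz : 0 < z.im) :
    Integrable (fun t : ℝ => z.im / ((t - z.re) ^ 2 + z.im ^ 2) * (S (t + ε * I)).im) ∧
    ∫ t : ℝ, z.im / ((t - z.re) ^ 2 + z.im ^ 2) ∂(boundaryMeasure S ε) = (S (z + ε * I)).im := by
  have h := integral_poissonKernel_mul_im (F := fun ζ => S (ζ + ε * I)) hε
    (hS.comp (by fun_prop) fun ζ hζ => by
      simp only [mem_ofPred_eq] at hζ
      simp only [mem_ofPred_eq, add_im, mul_im, ofReal_re, I_im, mul_one, ofReal_im, I_re, mul_zero,
        add_zero]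
      linarith)
    (M := (1 + K / ε ^ 2) / ε) (fun ζ hζ =>
      norm_le_of_norm_mul_add_one_le hK hd hε (by simpa using hζ)) hz
  refine ⟨h.1, ?_⟩
  rw [integral_boundaryMeasure hS him hε, integral_const_mul, h.2,
    inv_mul_cancel_left₀ Real.pi_ne_zero]

/-- `y · Im S(i(y + ε))` is close to `1` for large `y`, uniformly in `ε ≤ 1`. -/
theorem abs_mul_im_sub_one_le (hK : 0 ≤ K)
    (hd : ∀ z : ℂ, 0 < z.im → ‖z * S z + 1‖ ≤ K / z.im ^ 2) (hε : 0 < ε) (hε1 : ε ≤ 1) {y : ℝ}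
    (hy : 1 ≤ y) : |y * (S (y * I + ε * I)).im - 1| ≤ (2 * K + 1) / y := by
  have hy0 : 0 < y := by linarith
  set z : ℂ := y * I + ε * I with hz
  have hzim : z.im = y + ε := by simp [hz]
  have hz' : z = ((y + ε : ℝ) : ℂ) * I := by rw [hz]; push_cast; ring
  have h1 := hd z (by rw [hzim]; positivity)
  rw [hzim] at h1
  have h2 : (z * S z + 1).re = 1 - (y + ε) * (S z).im := by
    rw [hz']
    simp [mul_assoc]
    ring
  have h3 : |1 - (y + ε) * (S z).im| ≤ K / y ^ 2 := by
    rw [← h2]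
    refine (Complex.abs_re_le_norm _).trans (h1.trans ?_)
    gcongr
    linarith
  have h4 : K / y ^ 2 ≤ K / y := by
    gcongr
    nlinarith
  have h5 : K / y ≤ K := div_le_self hK hy
  have h6 : |(y + ε) * (S z).im| ≤ 1 + K := by
    have := abs_sub_abs_le_abs_sub ((y + ε) * (S z).im) 1
    rw [abs_one, abs_sub_comm] at this
    linarith
  have h7 : |ε * (S z).im| ≤ (1 + K) / y := by
    rw [le_div_iff₀ hy0]
    rw [abs_mul, abs_of_pos (by positivity : 0 < y + ε)] at h6
    rw [abs_mul, abs_of_pos hε]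
    have := abs_nonneg (S z).im
    nlinarith [mul_le_mul_of_nonneg_right hε1 (mul_nonneg hy0.le this), mul_nonneg hε.le this]
  have h8 : y * (S z).im - 1 = -(1 - (y + ε) * (S z).im) - ε * (S z).im := by ring
  rw [h8]
  refine (abs_sub _ _).trans ?_
  rw [abs_neg]
  have : (2 * K + 1) / y = K / y + (1 + K) / y := by ring
  linarith

theorem poissonKernel_imaginary_axis (y t : ℝ) :
    (y * I : ℂ).im / ((t - (y * I : ℂ).re) ^ 2 + (y * I : ℂ).im ^ 2) = y / (t ^ 2 + y ^ 2) := by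
  simp

/-- The total mass is the limit of `y · Im S(i(y + ε))` as `y → ∞`, by monotone convergence of
`y² / (t² + y²)` to `1`. -/
theorem isProbabilityMeasure_boundaryMeasure (hS : DifferentiableOn ℂ S {z | 0 < z.im})
    (him : ∀ z : ℂ, 0 < z.im → 0 ≤ (S z).im) (hK : 0 ≤ K)
    (hd : ∀ z : ℂ, 0 < z.im → ‖z * S z + 1‖ ≤ K / z.im ^ 2) (hε : 0 < ε) (hε1 : ε ≤ 1) :
    IsProbabilityMeasure (boundaryMeasure S ε) := by
  have hpos : ∀ t : ℝ, 0 ≤ (S (t + ε * I)).im := fun t => him _ (by simpa using hε)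
  have hm := (continuous_im_shift hS hε).measurable
  set y : ℕ → ℝ := fun n => n + 1 with hy
  have hy0 : ∀ n, 0 < y n := fun n => by positivity
  have hy1 : ∀ n, 1 ≤ y n := fun n => by simp [hy]
  have hyt : Tendsto y atTop atTop :=
    tendsto_atTop_add_const_right _ _ tendsto_natCast_atTop_atTop
  set f : ℕ → ℝ → ℝ := fun n t =>
    Real.pi⁻¹ * (y n * (y n / (t ^ 2 + y n ^ 2)) * (S (t + ε * I)).im) with hf
  have hint : ∀ n, ∫⁻ t, ENNReal.ofReal (f n t) =
      ENNReal.ofReal (y n * (S (y n * I + ε * I)).im) := fun n => by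
    have h := integral_poissonKernel_boundaryMeasure hS him hK hd hε (z := y n * I)
      (by simpa using hy0 n)
    simp only [poissonKernel_imaginary_axis] at h
    have h1 : Integrable (f n) := by
      refine ((h.1.const_mul (y n)).const_mul Real.pi⁻¹).congr (ae_of_all _ fun t => ?_)
      simp only [hf]
      ring
    rw [← ofReal_integral_eq_lintegral_ofReal h1 (ae_of_all _ fun t => ?_), ← h.2,
      integral_boundaryMeasure hS him hε, ← integral_const_mul]
    · congr 1
      refine integral_congr_ae (ae_of_all _ fun t => ?_)
      simp only [hf]
      ring
    · have := hpos t
      have := (hy0 n).le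
      simp only [hf, Pi.zero_apply]
      positivity
  have hmul : ∀ n t, y n * (y n / (t ^ 2 + y n ^ 2)) = 1 - t ^ 2 / (t ^ 2 + y n ^ 2) := fun n t => by
    have : t ^ 2 + y n ^ 2 ≠ 0 := by have := hy0 n; positivity
    field_simp
    ring
  have hmono : ∀ t, Monotone fun n => ENNReal.ofReal (f n t) := fun t m n hmn => by
    refine ENNReal.ofReal_le_ofReal ?_
    have : y m ≤ y n := by simpa [hy] using hmn
    have := hy0 m
    have := hpos t
    simp only [hf, hmul]
    gcongr
  have htend : ∀ t, Tendsto (fun n => ENNReal.ofReal (f n t)) atTop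
      (𝓝 (ENNReal.ofReal (Real.pi⁻¹ * (S (t + ε * I)).im))) := fun t => by
    refine ENNReal.tendsto_ofReal ?_
    have h1 : Tendsto (fun n => t ^ 2 / (t ^ 2 + y n ^ 2)) atTop (𝓝 0) :=
      tendsto_const_nhds.div_atTop (tendsto_atTop_add_const_left _ _
        ((tendsto_pow_atTop two_ne_zero).comp hyt))
    have h2 := (((tendsto_const_nhds (x := (1 : ℝ))).sub h1).mul_const
      (S (t + ε * I)).im).const_mul Real.pi⁻¹
    simpa only [hf, hmul, sub_zero, one_mul] using h2
  have hlim := lintegral_tendsto_of_tendsto_of_monotone (μ := volume)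
    (fun n => by
      refine Measurable.aemeasurable ?_
      simp only [hf]
      fun_prop) (ae_of_all _ hmono) (ae_of_all _ htend)
  simp_rw [hint] at hlim
  have hlim2 : Tendsto (fun n => ENNReal.ofReal (y n * (S (y n * I + ε * I)).im)) atTop
      (𝓝 (ENNReal.ofReal 1)) := by
    refine ENNReal.tendsto_ofReal (tendsto_iff_norm_sub_tendsto_zero.2 ?_)
    refine squeeze_zero (fun _ => norm_nonneg _)
      (fun n => abs_mul_im_sub_one_le hK hd hε hε1 (hy1 n)) ?_
    exact tendsto_const_nhds.div_atTop hyt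
  refine ⟨?_⟩
  rw [boundaryMeasure, withDensity_apply _ MeasurableSet.univ, Measure.restrict_univ]
  simpa using tendsto_nhds_unique hlim hlim2

/-- Tightness, uniformly in `ε ≤ 1`: the mass outside `[-y, y]` is at most the integral of
`2 (1 - y² / (t² + y²))`, which is twice the defect of `y · Im S(i(y + ε))` from `1`. -/
theorem boundaryMeasure_norm_gt_le (hS : DifferentiableOn ℂ S {z | 0 < z.im})
    (him : ∀ z : ℂ, 0 < z.im → 0 ≤ (S z).im) (hK : 0 ≤ K)
    (hd : ∀ z : ℂ, 0 < z.im → ‖z * S z + 1‖ ≤ K / z.im ^ 2) (hε : 0 < ε) (hε1 : ε ≤ 1) {y : ℝ}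
    (hy : 1 ≤ y) :
    boundaryMeasure S ε (Icc (-y) y)ᶜ ≤ ENNReal.ofReal (2 * ((2 * K + 1) / y)) := by
  have hprob := isProbabilityMeasure_boundaryMeasure hS him hK hd hε hε1
  have hy0 : 0 < y := by linarith
  have h := (integral_poissonKernel_boundaryMeasure hS him hK hd hε (z := y * I)
      (by simpa using hy0)).2
  simp only [poissonKernel_imaginary_axis] at h
  have hcont : Continuous fun t : ℝ => y * (y / (t ^ 2 + y ^ 2)) := by
    refine continuous_const.mul (continuous_const.div (by fun_prop) fun t => ?_)
    positivity
  have hle1 : ∀ t : ℝ, y * (y / (t ^ 2 + y ^ 2)) ≤ 1 := fun t => by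
    rw [← mul_div_assoc, div_le_one (by positivity)]
    nlinarith [sq_nonneg t]
  have hi : Integrable (fun t : ℝ => y * (y / (t ^ 2 + y ^ 2))) (boundaryMeasure S ε) := by
    refine Integrable.of_bound hcont.aestronglyMeasurable 1 (ae_of_all _ fun t => ?_)
    rw [Real.norm_of_nonneg (by positivity)]
    exact hle1 t
  have hi2 : Integrable (fun t : ℝ => 2 * (1 - y * (y / (t ^ 2 + y ^ 2)))) (boundaryMeasure S ε) :=
    ((integrable_const _).sub hi).const_mul 2
  have hval : ∫ t, 2 * (1 - y * (y / (t ^ 2 + y ^ 2))) ∂(boundaryMeasure S ε) ≤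
      2 * ((2 * K + 1) / y) := by
    rw [integral_const_mul, integral_sub (integrable_const _) hi, integral_const_mul, h]
    have := abs_mul_im_sub_one_le hK hd hε hε1 hy
    have := neg_abs_le (y * (S (y * I + ε * I)).im - 1)
    simp
    linarith
  have hms : MeasurableSet (Icc (-y) y)ᶜ := measurableSet_Icc.compl
  have h2 : (boundaryMeasure S ε).real (Icc (-y) y)ᶜ ≤
      ∫ t, 2 * (1 - y * (y / (t ^ 2 + y ^ 2))) ∂(boundaryMeasure S ε) := by
    rw [← integral_indicator_one hms]
    refine integral_mono ((integrable_const (1 : ℝ)).indicator hms) hi2 fun t => ?_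
    by_cases ht : t ∈ (Icc (-y) y)ᶜ
    · rw [indicator_of_mem ht, Pi.one_apply, ← mul_div_assoc]
      have : y ^ 2 ≤ t ^ 2 := by
        rw [sq_le_sq, abs_of_pos hy0]
        by_contra hlt
        exact ht (abs_le.1 (not_le.1 hlt).le)
      have : y * y / (t ^ 2 + y ^ 2) ≤ 1 / 2 := by
        rw [div_le_div_iff₀ (by positivity) (by norm_num)]
        nlinarith
      linarith
    · rw [indicator_of_notMem ht]
      linarith [hle1 t]
  rw [← ENNReal.ofReal_toReal (measure_ne_top (boundaryMeasure S ε) _)]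
  exact ENNReal.ofReal_le_ofReal (h2.trans hval)

/-- **Nevanlinna's representation**, for functions asymptotic to `-1/z`: a holomorphic function on
the upper half-plane with nonnegative imaginary part and `z S(z) → -1`, at the rate `(Im z)⁻²`, is
the Stieltjes transform of a probability measure, namely of a limit point of the tight family
`boundaryMeasure S ε`, `ε → 0`. -/
theorem exists_stieltjes_eq (hS : DifferentiableOn ℂ S {z | 0 < z.im})
    (him : ∀ z : ℂ, 0 < z.im → 0 ≤ (S z).im) (hK : 0 ≤ K)
    (hd : ∀ z : ℂ, 0 < z.im → ‖z * S z + 1‖ ≤ K / z.im ^ 2) :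
    ∃ μ : Measure ℝ, IsProbabilityMeasure μ ∧ ∀ z : ℂ, 0 < z.im → stieltjes μ z = S z := by
  set e : ℕ → ℝ := fun n => 1 / ((n : ℝ) + 1) with he
  have he0 : ∀ n, 0 < e n := fun n => by positivity
  have he1 : ∀ n, e n ≤ 1 := fun n => by
    rw [he]
    exact (div_le_one (by positivity)).2 (by simp)
  have hel : Tendsto e atTop (𝓝 0) := tendsto_one_div_add_atTop_nhds_zero_nat
  have hprob := fun n => isProbabilityMeasure_boundaryMeasure hS him hK hd (he0 n) (he1 n)
  set P : ℕ → ProbabilityMeasure ℝ := fun n => ⟨boundaryMeasure S (e n), hprob n⟩ with hP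
  have htight : IsTightMeasureSet {((μ : ProbabilityMeasure ℝ) : Measure ℝ) | μ ∈ range P} := by
    rw [isTightMeasureSet_iff_exists_isCompact_measure_compl_le]
    intro δ hδ
    have hl : Tendsto (fun y : ℝ => ENNReal.ofReal (2 * ((2 * K + 1) / y))) atTop (𝓝 0) := by
      have := ENNReal.tendsto_ofReal (((tendsto_const_nhds (x := 2 * K + 1)).div_atTop
        (tendsto_id (α := ℝ))).const_mul 2)
      simpa using this
    obtain ⟨y, hy1, hy⟩ := ((eventually_ge_atTop (1 : ℝ)).and (hl.eventually_le_const hδ)).exists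
    refine ⟨Icc (-y) y, isCompact_Icc, ?_⟩
    rintro _ ⟨_, ⟨n, rfl⟩, rfl⟩
    exact (boundaryMeasure_norm_gt_le hS him hK hd (he0 n) (he1 n) hy1).trans hy
  obtain ⟨μ, -, hμ⟩ := (isCompact_closure_of_isTightMeasureSet htight).ultrafilter_le_nhds
    ((hyperfilter ℕ).map P) (by
      rw [Ultrafilter.coe_map, le_principal_iff, mem_map]
      exact univ_mem' fun n => subset_closure (mem_range_self n))
  rw [Ultrafilter.coe_map] at hμ
  have hμ' : Tendsto P (hyperfilter ℕ) (𝓝 μ) := hμ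
  rw [ProbabilityMeasure.tendsto_iff_forall_integral_tendsto] at hμ'
  have himeq : ∀ z : ℂ, 0 < z.im → (stieltjes (μ : Measure ℝ) z).im = (S z).im := by
    intro z hz
    have hcont : Continuous fun t : ℝ => z.im / ((t - z.re) ^ 2 + z.im ^ 2) :=
      continuous_const.div (by fun_prop) fun t => by positivity
    have h1 := hμ' (BoundedContinuousFunction.ofNormedAddCommGroup
      (fun t : ℝ => z.im / ((t - z.re) ^ 2 + z.im ^ 2)) hcont (1 / z.im) fun t => by
        rw [← im_one_div_ofReal_sub]
        exact (Complex.abs_im_le_norm _).trans (norm_one_div_ofReal_sub_le t hz))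
    simp only [BoundedContinuousFunction.coe_ofNormedAddCommGroup] at h1
    rw [← stieltjes_im _ hz] at h1
    have h2 : Tendsto (fun n => (S (z + e n * I)).im) atTop (𝓝 (S z).im) := by
      have hc : ContinuousAt S z :=
        (hS.differentiableAt ((isOpen_im_gt 0).mem_nhds hz)).continuousAt
      have h3 : Tendsto (fun n => z + e n * I) atTop (𝓝 z) := by
        have : Tendsto (fun n => ((e n : ℝ) : ℂ)) atTop (𝓝 ((0 : ℝ) : ℂ)) :=
          (continuous_ofReal.tendsto 0).comp hel
        simpa using (this.mul_const I).const_add z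
      exact (continuous_im.tendsto _).comp (hc.tendsto.comp h3)
    refine tendsto_nhds_unique (h1.congr fun n => ?_) (h2.mono_left Nat.hyperfilter_le_atTop)
    exact (integral_poissonKernel_boundaryMeasure hS him hK hd (he0 n) hz).2
  -- the two functions have the same imaginary part, and both vanish at infinity
  obtain ⟨c, hc⟩ := eq_const_of_im_eq_zero
    (D := fun z => stieltjes (μ : Measure ℝ) z - S z)
    ((differentiableOn_stieltjes _).sub hS) fun z hz => by rw [sub_im, himeq z hz, sub_self]
  refine ⟨μ, inferInstance, fun z hz => sub_eq_zero.1 ?_⟩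
  rw [hc z hz]
  have hb : ∀ y : ℝ, 1 ≤ y → ‖c‖ ≤ (2 + K) / y := fun y hy => by
    have hy0 : 0 < y := by linarith
    have him' : (y * I : ℂ).im = y := by simp
    rw [← hc (y * I) (by rw [him']; exact hy0)]
    refine (norm_sub_le _ _).trans ?_
    have h1 := norm_stieltjes_le (μ : Measure ℝ) (z := y * I) (by rw [him']; exact hy0)
    have h2 := norm_le_of_norm_mul_add_one_le hK hd hy0 (z := y * I) him'.ge
    rw [him'] at h1
    have h3 : K / y ^ 2 ≤ K := div_le_self hK (by nlinarith)
    calc _ ≤ 1 / y + (1 + K / y ^ 2) / y := add_le_add h1 h2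
      _ ≤ 1 / y + (1 + K) / y := by gcongr
      _ = _ := by ring
  have hl : Tendsto (fun y : ℝ => (2 + K) / y) atTop (𝓝 0) :=
    tendsto_const_nhds.div_atTop tendsto_id
  have := ge_of_tendsto hl ((eventually_ge_atTop 1).mono hb)
  exact norm_le_zero_iff.1 this

end Herglotz

end VarianceProfile

namespace LambertTsallis

open ComplexConjugate Complex

/-! ### The logarithm of the Tsallis exponential -/

/-- The logarithm of the Tsallis exponential with `κ = 1/a`: the principal branch of
`a⁻¹ log (1 + a w)`, read as `w` for `a = 0`. -/
noncomputable def logTsallis (a : ℝ) (w : ℂ) : ℂ := if a = 0 then w else log (1 + a * w) / a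

variable {a : ℝ} {w : ℂ}

@[simp]
theorem logTsallis_zero (a : ℝ) : logTsallis a 0 = 0 := by
  unfold logTsallis
  split_ifs <;> simp

theorem hasDerivAt_logTsallis (h : 1 + a * w ∈ slitPlane) :
    HasDerivAt (logTsallis a) (1 / (1 + a * w)) w := by
  by_cases ha : a = 0
  · subst ha
    have : logTsallis 0 = fun w => w := by
      funext w
      simp [logTsallis]
    rw [this]
    simpa using hasDerivAt_id' w
  · have : logTsallis a = fun w => log (1 + a * w) / a := by
      funext w
      simp [logTsallis, ha]
    rw [this]
    have ha' : (a : ℂ) ≠ 0 := ofReal_ne_zero.2 ha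
    have h0 := slitPlane_ne_zero h
    convert! ((((hasDerivAt_id w).const_mul (a : ℂ)).const_add 1).clog h).div_const (a : ℂ) using 1
    simp only [id_eq]
    field_simp

/-- The domain of the Tsallis logarithm is star-shaped about `0`. -/
theorem one_add_smul_mem_slitPlane (h : 1 + a * w ∈ slitPlane) {s : ℝ} (hs : s ∈ Icc (0 : ℝ) 1) :
    1 + a * (s * w) ∈ slitPlane := by
  have := starConvex_one_slitPlane.add_smul_sub_mem h hs.1 hs.2
  rw [add_sub_cancel_left, real_smul] at this
  rwa [mul_left_comm]

theorem exp_mul_logTsallis (h : 1 + a * w ≠ 0) : exp (a * logTsallis a w) = 1 + a * w := by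
  unfold logTsallis
  split_ifs with ha
  · simp [ha]
  · have ha' : (a : ℂ) ≠ 0 := ofReal_ne_zero.2 ha
    rw [mul_div_cancel₀ _ ha', exp_log h]

/-- A bound on `exp_κ` also bounds `1 + a w` away from `0` or `∞`, according to the sign of `a`. -/
theorem norm_one_add_mul (h : 1 + a * w ≠ 0) : ‖1 + a * w‖ = ‖exp (logTsallis a w)‖ ^ a := by
  rw [← exp_mul_logTsallis h, norm_exp, norm_exp, ← Real.exp_mul, re_ofReal_mul, mul_comm]

theorem logTsallis_conj (h : 1 + a * w ∈ slitPlane) :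
    logTsallis a (conj w) = conj (logTsallis a w) := by
  unfold logTsallis
  split_ifs with ha
  · rfl
  · have : 1 + (a : ℂ) * conj w = conj (1 + a * w) := by simp
    rw [this, log_conj _ (slitPlane_arg_ne_pi h), map_div₀, conj_ofReal]

end LambertTsallis

namespace VarianceProfile

open ComplexConjugate Complex LambertTsallis

/-! ### The explicit solution of the functional equation -/

/-- `w` parametrizes the solution of the functional equation of the trapezoid at `z`. The
function `x ↦ z exp_κ(x w / p)`, `0 ≤ x ≤ p`, is then `z + ∫₀ˣ v η`; the equation says
`-v p / z² = f_{κ,γ}(w)`, `κ = 1/a`, with denominators cleared. -/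
structure IsParam (p a v : ℝ) (z w : ℂ) : Prop where
  ne_zero : w ≠ 0
  mem : 1 + a * w ∈ slitPlane
  eqn : z ^ 2 * exp (logTsallis a w) * w = -v * (p + (2 * p - 1) * w)
  im_pos : ∀ s ∈ Icc (0 : ℝ) 1, 0 < (z * exp (logTsallis a (s * w))).im

/-- The function `z + v ∫₀ˣ η` on `[0, p]`, for the solution `η` with parameter `w`. -/
noncomputable def lowerSum (p a : ℝ) (z w : ℂ) (x : ℝ) : ℂ :=
  z * exp (logTsallis a ((x / p : ℝ) * w))

/-- The function `z + v ∫ η` over `[p + α x, 1]`, as a function of `x` in `[0, p]`, for the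
solution `η` with parameter `w`. Its product with `lowerSum` is affine in `x`. -/
noncomputable def upperSum (p a v : ℝ) (z w : ℂ) (x : ℝ) : ℂ :=
  -(v * p) / w * (1 + a * ((x / p : ℝ) * w)) / lowerSum p a z w x

/-- The upper end `min (p, (x - p) / α)` of the support of `σ(x, ·)` for `x ≥ p`, where
`(x - p) / 0 = ∞`. -/
noncomputable def cutoff (p α x : ℝ) : ℝ := if α = 0 then p else min p ((x - p) / α)

/-- The solution of the functional equation with parameter `w`: at `x` it is `-1` over the sum
`z + ∫ σ(x, y) η(y) dy`, which is `upperSum` for `x < p` and `lowerSum` for `x ≥ p`. -/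
noncomputable def paramSolution (p α v : ℝ) (z w : ℂ) (x : ℝ) : ℂ :=
  if x < p then -(upperSum p (1 - α) v z w x)⁻¹ else -(lowerSum p (1 - α) z w (cutoff p α x))⁻¹

section Param

variable {p a v α : ℝ} {z w : ℂ}

theorem IsParam.z_im_pos (h : IsParam p a v z w) : 0 < z.im := by
  simpa using h.im_pos 0 (by simp)

theorem div_mem_Icc (hp : 0 < p) {x : ℝ} (hx : x ∈ Icc 0 p) : x / p ∈ Icc (0 : ℝ) 1 :=
  ⟨div_nonneg hx.1 hp.le, (div_le_one hp).2 hx.2⟩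

theorem IsParam.lowerSum_im_pos (h : IsParam p a v z w) (hp : 0 < p) {x : ℝ} (hx : x ∈ Icc 0 p) :
    0 < (lowerSum p a z w x).im := h.im_pos _ (div_mem_Icc hp hx)

theorem ne_zero_of_im_pos {c : ℂ} (h : 0 < c.im) : c ≠ 0 := fun h0 => by simp [h0] at h

theorem IsParam.lowerSum_ne_zero (h : IsParam p a v z w) (hp : 0 < p) {x : ℝ}
    (hx : x ∈ Icc 0 p) : lowerSum p a z w x ≠ 0 := ne_zero_of_im_pos (h.lowerSum_im_pos hp hx)

theorem lowerSum_zero : lowerSum p a z w 0 = z := by simp [lowerSum]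

theorem lowerSum_self (hp : 0 < p) : lowerSum p a z w p = z * exp (logTsallis a w) := by
  simp [lowerSum, div_self hp.ne']

theorem upperSum_zero : upperSum p a v z w 0 = -(v * p) / w / z := by
  simp [upperSum, lowerSum_zero]

theorem IsParam.hasDerivAt_lowerSum (h : IsParam p a v z w) (hp : 0 < p) {x : ℝ}
    (hx : x ∈ Icc 0 p) :
    HasDerivAt (lowerSum p a z w)
      (lowerSum p a z w x * (w / p / (1 + a * ((x / p : ℝ) * w)))) x := by
  have hmem := one_add_smul_mem_slitPlane h.mem (div_mem_Icc hp hx)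
  have h1 : HasDerivAt (fun x : ℝ => ((x / p : ℝ) : ℂ) * w) (w / p) x := by
    have := (((hasDerivAt_id x).div_const p).ofReal_comp).mul_const w
    simp only [id_eq] at this
    convert! this using 1
    push_cast
    ring
  have h2 := ((hasDerivAt_logTsallis hmem).comp x h1).cexp.const_mul z
  refine h2.congr_deriv ?_
  simp only [lowerSum, Function.comp]
  ring

theorem IsParam.hasDerivAt_upperSum (h : IsParam p a v z w) (hp : 0 < p) {x : ℝ}
    (hx : x ∈ Icc 0 p) :
    HasDerivAt (upperSum p a v z w) ((1 - a) * v / lowerSum p a z w x) x := by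
  have hmem := one_add_smul_mem_slitPlane h.mem (div_mem_Icc hp hx)
  have hne := slitPlane_ne_zero hmem
  have h1 : HasDerivAt (fun x : ℝ => -(v * p) / w * (1 + a * (((x / p : ℝ) : ℂ) * w)))
      (-(v * p) / w * (a * (w / p))) x := by
    have := ((((((hasDerivAt_id x).div_const p).ofReal_comp).mul_const w).const_mul
      (a : ℂ)).const_add 1).const_mul (-(v * p) / w)
    simp only [id_eq] at this
    convert! this using 1
    push_cast
    ring
  have h2 := h1.div (h.hasDerivAt_lowerSum hp hx) (h.lowerSum_ne_zero hp hx)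
  refine h2.congr_deriv ?_
  have h3 := h.lowerSum_ne_zero hp hx
  have h4 := h.ne_zero
  have h5 : (p : ℂ) ≠ 0 := ofReal_ne_zero.2 hp.ne'
  generalize hF : lowerSum p a z w x = F at h3 ⊢
  generalize hT : 1 + (a : ℂ) * ((x / p : ℝ) * w) = T at hne ⊢
  field_simp
  ring

/-- The boundary condition at `x = p`; this is where the equation for `w` enters. Above `p + α p`
the sections of the profile are constant, so that `η = -1/F(p)` on an interval of length
`1 - p - α p`. -/
theorem IsParam.upperSum_self (h : IsParam p a v z w) (hp : 0 < p) :
    upperSum p a v z w p = z - v * (1 - p - (1 - a) * p) / lowerSum p a z w p := by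
  have h3 := h.lowerSum_ne_zero hp (right_mem_Icc.2 hp.le)
  have h4 := h.ne_zero
  have h5 := h.eqn
  have h6 : z ^ 2 * exp (logTsallis a w) * w = z * lowerSum p a z w p * w := by
    rw [lowerSum_self hp]; ring
  rw [h6] at h5
  simp only [upperSum, div_self hp.ne', ofReal_one, one_mul]
  generalize lowerSum p a z w p = F at h3 h5
  field_simp
  linear_combination -h5

theorem IsParam.continuousOn_lowerSum (h : IsParam p a v z w) (hp : 0 < p) :
    ContinuousOn (lowerSum p a z w) (Icc 0 p) :=
  fun _ hx => (h.hasDerivAt_lowerSum hp hx).continuousAt.continuousWithinAt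

theorem IsParam.continuousOn_upperSum (h : IsParam p a v z w) (hp : 0 < p) :
    ContinuousOn (upperSum p a v z w) (Icc 0 p) :=
  fun _ hx => (h.hasDerivAt_upperSum hp hx).continuousAt.continuousWithinAt

theorem neg_inv_im_pos {c : ℂ} (h : 0 < c.im) : 0 < (-c⁻¹).im := by
  have : 0 < normSq c := normSq_pos.2 (ne_zero_of_im_pos h)
  rw [neg_im, inv_im, neg_div, neg_neg]
  positivity

theorem cutoff_mem_Icc (hp : 0 < p) (hα : 0 ≤ α) {x : ℝ} (hx : p ≤ x) :
    cutoff p α x ∈ Icc 0 p := by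
  unfold cutoff
  split_ifs with h
  · exact ⟨hp.le, le_rfl⟩
  · exact ⟨le_min hp.le (div_nonneg (by linarith) hα), min_le_left _ _⟩

theorem continuous_cutoff : Continuous (cutoff p α) := by
  unfold cutoff
  split_ifs <;> fun_prop

/-- The integrated form of `G' = α v / F`, after the substitution `y = p + α x`; for `α = 0` both sides
vanish because `G` is constant. -/
theorem IsParam.intervalIntegral_lower (h : IsParam p (1 - α) v z w) (hp : 0 < p) (hv : 0 < v)
    (hα : 0 ≤ α) {x : ℝ} (hx : x ∈ Icc 0 p) :
    ∫ y in (p + α * x)..(p + α * p), -(lowerSum p (1 - α) z w (cutoff p α y))⁻¹ =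
      (upperSum p (1 - α) v z w x - upperSum p (1 - α) v z w p) / v := by
  have hvC : (v : ℂ) ≠ 0 := ofReal_ne_zero.2 hv.ne'
  have hle : ∀ y ∈ Icc x p, y ∈ Icc 0 p := fun y hy => ⟨hx.1.trans hy.1, hy.2⟩
  rcases hα.eq_or_lt with rfl | hα0
  · have hc : upperSum p (1 - 0) v z w p = upperSum p (1 - 0) v z w x := by
      refine constant_of_has_deriv_right_zero ((h.continuousOn_upperSum hp).mono
        (Icc_subset_Icc hx.1 le_rfl)) (fun y hy => ?_) p (right_mem_Icc.2 hx.2)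
      have := (h.hasDerivAt_upperSum hp (hle y (Ico_subset_Icc_self hy))).hasDerivWithinAt
        (s := Ici y)
      simpa using this
    rw [hc]
    simp
  · have hcut : ∀ y ∈ Icc (p + α * x) (p + α * p), cutoff p α y = (y - p) / α := fun y hy => by
      rw [cutoff, if_neg hα0.ne']
      exact min_eq_right ((div_le_iff₀ hα0).2 (by linarith [hy.2]))
    have hmem : ∀ y ∈ Icc (p + α * x) (p + α * p), (y - p) / α ∈ Icc 0 p := fun y hy =>
      hle _ ⟨(le_div_iff₀ hα0).2 (by linarith [hy.1]), (div_le_iff₀ hα0).2 (by linarith [hy.2])⟩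
    have hab : p + α * x ≤ p + α * p := by linarith [mul_le_mul_of_nonneg_left hx.2 hα]
    have hd : ∀ y ∈ uIcc (p + α * x) (p + α * p),
        HasDerivAt (fun y => -(upperSum p (1 - α) v z w ((y - p) / α)) / v)
          (-(lowerSum p (1 - α) z w ((y - p) / α))⁻¹) y := fun y hy => by
      rw [uIcc_of_le hab] at hy
      have h1 : HasDerivAt (fun y : ℝ => (y - p) / α) (1 / α) y :=
        ((hasDerivAt_id y).sub_const p).div_const α
      have h2 := ((h.hasDerivAt_upperSum hp (hmem y hy)).scomp y h1).neg.div_const (v : ℂ)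
      refine h2.congr_deriv ?_
      have := h.lowerSum_ne_zero hp (hmem y hy)
      have hαC : (α : ℂ) ≠ 0 := ofReal_ne_zero.2 hα0.ne'
      rw [real_smul]
      push_cast
      field_simp
      ring
    have hint : ∫ y in (p + α * x)..(p + α * p), -(lowerSum p (1 - α) z w (cutoff p α y))⁻¹ =
        ∫ y in (p + α * x)..(p + α * p), -(lowerSum p (1 - α) z w ((y - p) / α))⁻¹ := by
      refine intervalIntegral.integral_congr fun y hy => ?_
      rw [uIcc_of_le hab] at hy
      simp only [hcut y hy]
    rw [hint, intervalIntegral.integral_eq_sub_of_hasDerivAt hd]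
    · have e1 : (p + α * p - p) / α = p := by field_simp; ring
      have e2 : (p + α * x - p) / α = x := by field_simp; ring
      rw [e1, e2]
      ring
    · refine ContinuousOn.intervalIntegrable fun y hy => ?_
      rw [uIcc_of_le hab] at hy
      have := (h.hasDerivAt_lowerSum hp (hmem y hy)).continuousAt
      have h3 : ContinuousAt (fun y : ℝ => lowerSum p (1 - α) z w ((y - p) / α)) y :=
        ContinuousAt.comp (f := fun y : ℝ => (y - p) / α) this (by fun_prop)
      exact (h3.inv₀ (h.lowerSum_ne_zero hp (hmem y hy))).neg.continuousWithinAt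

theorem IsParam.continuousOn_upper_branch (h : IsParam p (1 - α) v z w) (hp : 0 < p)
    (hα : 0 ≤ α) :
    ContinuousOn (fun y => -(lowerSum p (1 - α) z w (cutoff p α y))⁻¹) (Ici p) := by
  refine (ContinuousOn.inv₀ ?_ fun y hy => h.lowerSum_ne_zero hp (cutoff_mem_Icc hp hα hy)).neg
  exact (h.continuousOn_lowerSum hp).comp continuous_cutoff.continuousOn
    fun y hy => cutoff_mem_Icc hp hα hy

theorem IsParam.upperSum_eq (h : IsParam p (1 - α) v z w) (hp : 0 < p) (hv : 0 < v)
    (hα : 0 ≤ α) (hpα : p + α * p ≤ 1) {x : ℝ} (hx : x ∈ Icc 0 p) :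
    upperSum p (1 - α) v z w x =
      z + v * ∫ y in (p + α * x)..1, -(lowerSum p (1 - α) z w (cutoff p α y))⁻¹ := by
  have hvC : (v : ℂ) ≠ 0 := ofReal_ne_zero.2 hv.ne'
  have hx' : p ≤ p + α * x := by linarith [mul_nonneg hα hx.1]
  have hp' : p ≤ p + α * p := by linarith [mul_nonneg hα hp.le]
  have hint : ∀ b c : ℝ, p ≤ b → p ≤ c → IntervalIntegrable
      (fun y => -(lowerSum p (1 - α) z w (cutoff p α y))⁻¹) volume b c := fun b c hb hc =>
    ((h.continuousOn_upper_branch hp hα).mono fun y hy =>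
      (le_min hb hc).trans hy.1).intervalIntegrable
  have hconst : ∫ y in (p + α * p)..1, -(lowerSum p (1 - α) z w (cutoff p α y))⁻¹ =
      (1 - p - α * p) * -(lowerSum p (1 - α) z w p)⁻¹ := by
    have : ∫ y in (p + α * p)..1, -(lowerSum p (1 - α) z w (cutoff p α y))⁻¹ =
        ∫ y in (p + α * p)..1, -(lowerSum p (1 - α) z w p)⁻¹ := by
      refine intervalIntegral.integral_congr fun y hy => ?_
      rw [uIcc_of_le hpα] at hy
      have : cutoff p α y = p := by
        unfold cutoff
        split_ifs with h0
        · rfl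
        · exact min_eq_left ((le_div_iff₀ (lt_of_le_of_ne hα (Ne.symm h0))).2 (by linarith [hy.1]))
      simp only [this]
    rw [this, intervalIntegral.integral_const, real_smul]
    push_cast
    ring
  rw [← intervalIntegral.integral_add_adjacent_intervals (hint _ _ hx' hp')
    (hint _ _ hp' (hp'.trans hpα)), h.intervalIntegral_lower hp hv hα hx, hconst,
    mul_add, mul_div_cancel₀ _ hvC, h.upperSum_self hp]
  push_cast
  ring

theorem IsParam.im_le_upperSum (h : IsParam p (1 - α) v z w) (hp : 0 < p) (hv : 0 < v)
    (hα : 0 ≤ α) (hpα : p + α * p ≤ 1) {x : ℝ} (hx : x ∈ Icc 0 p) :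
    z.im ≤ (upperSum p (1 - α) v z w x).im := by
  have hx' : p ≤ p + α * x := by linarith [mul_nonneg hα hx.1]
  have hx1 : p + α * x ≤ 1 := by linarith [mul_le_mul_of_nonneg_left hx.2 hα]
  rw [h.upperSum_eq hp hv hα hpα hx, add_im, im_ofReal_mul]
  have hi : IntervalIntegrable
      (fun y => -(lowerSum p (1 - α) z w (cutoff p α y))⁻¹) volume (p + α * x) 1 :=
    ((h.continuousOn_upper_branch hp hα).mono fun y hy => by
      rw [uIcc_of_le hx1] at hy
      exact hx'.trans hy.1).intervalIntegrable
  have h1 := intervalIntegral.intervalIntegral_im hi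
  simp only [RCLike.im_to_complex] at h1
  have h2 : 0 ≤ ∫ y in (p + α * x)..1, (-(lowerSum p (1 - α) z w (cutoff p α y))⁻¹).im :=
    intervalIntegral.integral_nonneg hx1 fun y hy =>
      (neg_inv_im_pos (h.lowerSum_im_pos hp (cutoff_mem_Icc hp hα (hx'.trans hy.1)))).le
  rw [← h1]
  linarith [mul_nonneg hv.le h2]

/-- The integrated form of `F' = -v / G`. -/
theorem IsParam.lowerSum_eq (h : IsParam p (1 - α) v z w) (hp : 0 < p) (hv : 0 < v)
    (hα : 0 ≤ α) (hpα : p + α * p ≤ 1) {x : ℝ} (hx : x ∈ Icc 0 p) :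
    lowerSum p (1 - α) z w x = z + v * ∫ y in (0 : ℝ)..x, -(upperSum p (1 - α) v z w y)⁻¹ := by
  have hvC : (v : ℂ) ≠ 0 := ofReal_ne_zero.2 hv.ne'
  have hmem : ∀ y ∈ uIcc 0 x, y ∈ Icc 0 p := fun y hy => by
    rw [uIcc_of_le hx.1] at hy
    exact ⟨hy.1, hy.2.trans hx.2⟩
  have hne : ∀ y ∈ Icc 0 p, upperSum p (1 - α) v z w y ≠ 0 := fun y hy =>
    ne_zero_of_im_pos (h.z_im_pos.trans_le (h.im_le_upperSum hp hv hα hpα hy))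
  have hd : ∀ y ∈ uIcc 0 x, HasDerivAt (fun y => lowerSum p (1 - α) z w y / v)
      (-(upperSum p (1 - α) v z w y)⁻¹) y := fun y hy => by
    refine ((h.hasDerivAt_lowerSum hp (hmem y hy)).div_const (v : ℂ)).congr_deriv ?_
    have h3 := h.lowerSum_ne_zero hp (hmem y hy)
    have h4 := h.ne_zero
    have h5 : (p : ℂ) ≠ 0 := ofReal_ne_zero.2 hp.ne'
    have hT := slitPlane_ne_zero
      (one_add_smul_mem_slitPlane h.mem (div_mem_Icc hp (hmem y hy)))
    simp only [upperSum]
    generalize lowerSum p (1 - α) z w y = F at h3 ⊢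
    generalize 1 + ((1 - α : ℝ) : ℂ) * ((y / p : ℝ) * w) = T at hT ⊢
    field_simp
  rw [intervalIntegral.integral_eq_sub_of_hasDerivAt hd, lowerSum_zero]
  · field_simp
    ring
  · exact (((h.continuousOn_upperSum hp).inv₀ hne).neg.mono hmem).intervalIntegrable

theorem IsParam.im_le_lowerSum (h : IsParam p (1 - α) v z w) (hp : 0 < p) (hv : 0 < v)
    (hα : 0 ≤ α) (hpα : p + α * p ≤ 1) {x : ℝ} (hx : x ∈ Icc 0 p) :
    z.im ≤ (lowerSum p (1 - α) z w x).im := by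
  have hne : ∀ y ∈ Icc 0 p, upperSum p (1 - α) v z w y ≠ 0 := fun y hy =>
    ne_zero_of_im_pos (h.z_im_pos.trans_le (h.im_le_upperSum hp hv hα hpα hy))
  rw [h.lowerSum_eq hp hv hα hpα hx, add_im, im_ofReal_mul]
  have hi : IntervalIntegrable (fun y => -(upperSum p (1 - α) v z w y)⁻¹) volume 0 x :=
    (((h.continuousOn_upperSum hp).inv₀ hne).neg.mono fun y hy => by
      rw [uIcc_of_le hx.1] at hy
      exact ⟨hy.1, hy.2.trans hx.2⟩).intervalIntegrable
  have h1 := intervalIntegral.intervalIntegral_im hi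
  simp only [RCLike.im_to_complex] at h1
  have h2 : 0 ≤ ∫ y in (0 : ℝ)..x, (-(upperSum p (1 - α) v z w y)⁻¹).im :=
    intervalIntegral.integral_nonneg hx.1 fun y hy =>
      (neg_inv_im_pos (h.z_im_pos.trans_le
        (h.im_le_upperSum hp hv hα hpα ⟨hy.1, hy.2.trans hx.2⟩))).le
  rw [← h1]
  linarith [mul_nonneg hv.le h2]

end Param

end VarianceProfile

namespace VarianceProfile

open ComplexConjugate Complex LambertTsallis

/-! ### Verification of the functional equation for the trapezoid -/

section Trapezoid

variable {p α v : ℝ} {z w : ℂ}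

theorem trapezoid_nonneg (hv : 0 < v) (x y : ℝ) : 0 ≤ trapezoid p α v x y := by
  unfold trapezoid
  split_ifs
  · exact hv.le
  · exact le_rfl

theorem trapezoid_le (hv : 0 < v) (x y : ℝ) : trapezoid p α v x y ≤ v := by
  unfold trapezoid
  split_ifs
  · exact le_rfl
  · exact hv.le

theorem measurable_trapezoid (x : ℝ) : Measurable (trapezoid p α v x) := by
  unfold trapezoid
  refine Measurable.ite ?_ measurable_const measurable_const
  refine MeasurableSet.union ?_ ?_
  · exact (MeasurableSet.const _).inter (measurableSet_le measurable_const measurable_id)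
  · refine (MeasurableSet.const _).inter ((measurableSet_le measurable_const measurable_id).inter
      ((measurableSet_le measurable_id measurable_const).inter
      (measurableSet_le ((measurable_id.const_mul α).const_add p) measurable_const)))

theorem trapezoid_of_lt {x y : ℝ} (hx : x < p) :
    trapezoid p α v x y = if p + α * x ≤ y then v else 0 := by
  simp [trapezoid, hx, not_le.2 hx]

theorem trapezoid_of_ge (hα : 0 ≤ α) {x y : ℝ} (hx : p ≤ x) (hy : 0 ≤ y) :
    trapezoid p α v x y = if y ≤ cutoff p α x then v else 0 := by
  have : (y ≤ p ∧ p + α * y ≤ x) ↔ y ≤ cutoff p α x := by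
    unfold cutoff
    split_ifs with h
    · simp [h, hx]
    · rw [le_min_iff, le_div_iff₀ (lt_of_le_of_ne hα (Ne.symm h))]
      constructor <;> rintro ⟨h1, h2⟩ <;> exact ⟨h1, by linarith⟩
  simp [trapezoid, hx, not_lt.2 hx, hy, this]

theorem IsParam.paramSolution_im_pos (h : IsParam p (1 - α) v z w) (hp : 0 < p)
    (hv : 0 < v) (hα : 0 ≤ α) (hpα : p + α * p ≤ 1) {x : ℝ} (hx : 0 ≤ x) :
    0 < (paramSolution p α v z w x).im := by
  unfold paramSolution
  split_ifs with hxp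
  · exact neg_inv_im_pos (h.z_im_pos.trans_le (h.im_le_upperSum hp hv hα hpα ⟨hx, hxp.le⟩))
  · exact neg_inv_im_pos (h.lowerSum_im_pos hp (cutoff_mem_Icc hp hα (not_lt.1 hxp)))

theorem IsParam.integrableOn_paramSolution (h : IsParam p (1 - α) v z w) (hp : 0 < p)
    (hp1 : p < 1) (hv : 0 < v) (hα : 0 ≤ α) (hpα : p + α * p ≤ 1) :
    IntegrableOn (paramSolution p α v z w) (Icc 0 1) := by
  rw [← Ico_union_Icc_eq_Icc hp.le hp1.le]
  refine IntegrableOn.union ?_ ?_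
  · have hne : ∀ y ∈ Icc 0 p, upperSum p (1 - α) v z w y ≠ 0 := fun y hy =>
      ne_zero_of_im_pos (h.z_im_pos.trans_le (h.im_le_upperSum hp hv hα hpα hy))
    have h1 : IntegrableOn (fun y => -(upperSum p (1 - α) v z w y)⁻¹) (Ico 0 p) :=
      ((((h.continuousOn_upperSum hp).inv₀ hne).neg).integrableOn_Icc).mono_set Ico_subset_Icc_self
    refine h1.congr_fun (fun y hy => ?_) measurableSet_Ico
    simp [paramSolution, hy.2]
  · have h1 : IntegrableOn (fun y => -(lowerSum p (1 - α) z w (cutoff p α y))⁻¹) (Icc p 1) :=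
      ((h.continuousOn_upper_branch hp hα).mono fun y hy => hy.1).integrableOn_Icc
    refine h1.congr_fun (fun y hy => ?_) measurableSet_Icc
    simp [paramSolution, not_lt.2 hy.1]

theorem IsParam.kernelIntegral_of_lt (h : IsParam p (1 - α) v z w) (hp : 0 < p)
    (hv : 0 < v) (hα : 0 ≤ α) (hpα : p + α * p ≤ 1) {x : ℝ} (hx : 0 ≤ x) (hxp : x < p) :
    z + ∫ y in Icc (0 : ℝ) 1, (trapezoid p α v x y : ℂ) * paramSolution p α v z w y =
      upperSum p (1 - α) v z w x := by
  rw [h.upperSum_eq hp hv hα hpα ⟨hx, hxp.le⟩]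
  congr 1
  have hx' : p ≤ p + α * x := by linarith [mul_nonneg hα hx]
  have hx1 : p + α * x ≤ 1 := by linarith [mul_le_mul_of_nonneg_left hxp.le hα]
  have h1 : ∀ y, (trapezoid p α v x y : ℂ) * paramSolution p α v z w y =
      (Ici (p + α * x)).indicator
        (fun y => v * -(lowerSum p (1 - α) z w (cutoff p α y))⁻¹) y := fun y => by
    rw [trapezoid_of_lt hxp]
    by_cases hy : p + α * x ≤ y
    · rw [if_pos hy, indicator_of_mem (mem_Ici.2 hy), paramSolution,
        if_neg (not_lt.2 (hx'.trans hy))]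
    · rw [if_neg hy, indicator_of_notMem (by simpa using hy)]
      simp
  simp_rw [h1]
  have hset : Icc (0 : ℝ) 1 ∩ Ici (p + α * x) = Icc (p + α * x) 1 := by
    ext y
    simp only [mem_inter_iff, mem_Icc, mem_Ici]
    constructor
    · rintro ⟨⟨_, h2⟩, h3⟩
      exact ⟨h3, h2⟩
    · rintro ⟨h2, h3⟩
      exact ⟨⟨by linarith, h3⟩, h2⟩
  rw [setIntegral_indicator measurableSet_Ici, hset, integral_Icc_eq_integral_Ioc,
    ← intervalIntegral.integral_of_le hx1, intervalIntegral.integral_const_mul]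

theorem IsParam.kernelIntegral_of_ge (h : IsParam p (1 - α) v z w) (hp : 0 < p) (hp1 : p < 1)
    (hv : 0 < v) (hα : 0 ≤ α) (hpα : p + α * p ≤ 1) {x : ℝ} (hxp : p ≤ x) :
    z + ∫ y in Icc (0 : ℝ) 1, (trapezoid p α v x y : ℂ) * paramSolution p α v z w y =
      lowerSum p (1 - α) z w (cutoff p α x) := by
  have hc := cutoff_mem_Icc hp hα hxp
  rw [h.lowerSum_eq hp hv hα hpα hc]
  congr 1
  have h1 : ∫ y in Icc (0 : ℝ) 1, (trapezoid p α v x y : ℂ) * paramSolution p α v z w y =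
      ∫ y in Icc (0 : ℝ) 1, (Iic (cutoff p α x)).indicator
        (fun y => v * -(upperSum p (1 - α) v z w y)⁻¹) y := by
    refine setIntegral_congr_ae measurableSet_Icc ?_
    -- at `y = p` the section of the profile may be `v` although `η(p)` is given by `lowerSum`
    have hae : ∀ᵐ y : ℝ, y ≠ p := by simp [ae_iff]
    filter_upwards [hae] with y hyp hy
    rw [trapezoid_of_ge hα hxp hy.1]
    by_cases hyc : y ≤ cutoff p α x
    · rw [if_pos hyc, indicator_of_mem (mem_Iic.2 hyc), paramSolution,
        if_pos (lt_of_le_of_ne (hyc.trans hc.2) hyp)]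
    · rw [if_neg hyc, indicator_of_notMem (by simpa using hyc)]
      simp
  have hset : Icc (0 : ℝ) 1 ∩ Iic (cutoff p α x) = Icc 0 (cutoff p α x) := by
    ext y
    simp only [mem_inter_iff, mem_Icc, mem_Iic]
    have := hc.2
    constructor
    · rintro ⟨⟨h2, _⟩, h3⟩
      exact ⟨h2, h3⟩
    · rintro ⟨h2, h3⟩
      exact ⟨⟨h2, by linarith⟩, h3⟩
  rw [h1, setIntegral_indicator measurableSet_Iic, hset, integral_Icc_eq_integral_Ioc,
    ← intervalIntegral.integral_of_le hc.1, intervalIntegral.integral_const_mul]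

theorem IsParam.isSolution (h : IsParam p (1 - α) v z w) (hp : 0 < p) (hp1 : p < 1)
    (hv : 0 < v) (hα : 0 ≤ α) (hpα : p + α * p ≤ 1) :
    IsSolution (trapezoid p α v) z (paramSolution p α v z w) where
  im_pos x hx := h.paramSolution_im_pos hp hv hα hpα hx.1
  integrable := h.integrableOn_paramSolution hp hp1 hv hα hpα
  eqn := by
    refine (ae_restrict_iff' measurableSet_Icc).2 (ae_of_all _ fun x hx => ?_)
    by_cases hxp : x < p
    · rw [h.kernelIntegral_of_lt hp hv hα hpα hx.1 hxp, paramSolution, if_pos hxp]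
    · rw [h.kernelIntegral_of_ge hp hp1 hv hα hpα (not_lt.1 hxp), paramSolution, if_neg hxp]

/-- The sections of the profile at `x = 0` and `x = 1` add up to the constant `v`, so that the
two corresponding cases of the functional equation determine `∫ η`. -/
theorem IsParam.integral_paramSolution (h : IsParam p (1 - α) v z w) (hp : 0 < p) (hp1 : p < 1)
    (hv : 0 < v) (hα : 0 ≤ α) (hpα : p + α * p ≤ 1) :
    ∫ x in Icc (0 : ℝ) 1, paramSolution p α v z w x =
      -(2 * (p : ℂ)) / (z * w) + (1 - 2 * (p : ℂ)) / z - 2 * z / v := by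
  have h0 := h.kernelIntegral_of_lt hp hv hα hpα le_rfl hp
  have h1 := h.kernelIntegral_of_ge hp hp1 hv hα hpα hp1.le
  have hcut : cutoff p α 1 = p := by
    unfold cutoff
    split_ifs with h0
    · rfl
    · exact min_eq_left ((le_div_iff₀ (lt_of_le_of_ne hα (Ne.symm h0))).2 (by linarith))
  rw [upperSum_zero] at h0
  rw [hcut, lowerSum_self hp] at h1
  have hi := h.integrableOn_paramSolution hp hp1 hv hα hpα
  have hk : ∀ x, IntegrableOn
      (fun y => (trapezoid p α v x y : ℂ) * paramSolution p α v z w y) (Icc 0 1) := fun x =>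
    integrableOn_kernel_mul (𝕜 := ℂ) (trapezoid_nonneg hv) (trapezoid_le hv)
      measurable_trapezoid hi x
  have hadd : (∫ y in Icc (0 : ℝ) 1, (trapezoid p α v 0 y : ℂ) * paramSolution p α v z w y) +
      (∫ y in Icc (0 : ℝ) 1, (trapezoid p α v 1 y : ℂ) * paramSolution p α v z w y) =
      v * ∫ x in Icc (0 : ℝ) 1, paramSolution p α v z w x := by
    rw [← integral_const_mul, ← integral_add (hk 0) (hk 1)]
    refine setIntegral_congr_ae measurableSet_Icc ?_
    have hae : ∀ᵐ y : ℝ, y ≠ p := by simp [ae_iff]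
    filter_upwards [hae] with y hyp hy
    rw [← add_mul, trapezoid_of_lt hp, trapezoid_of_ge hα hp1.le hy.1, hcut, mul_zero, add_zero]
    rcases hyp.lt_or_gt with hlt | hlt
    · rw [if_neg (not_le.2 hlt), if_pos hlt.le]
      simp
    · rw [if_pos hlt.le, if_neg (not_le.2 hlt)]
      simp
  have hz := ne_zero_of_im_pos h.z_im_pos
  have hw := h.ne_zero
  have hvC : (v : ℂ) ≠ 0 := ofReal_ne_zero.2 hv.ne'
  have heqn := h.eqn
  have e1 : v * ∫ x in Icc (0 : ℝ) 1, paramSolution p α v z w x =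
      -(v * p) / w / z + z * exp (logTsallis (1 - α) w) - 2 * z := by
    rw [← hadd]
    linear_combination h0 + h1
  have e2 : z * exp (logTsallis (1 - α) w) = -v * (p + (2 * p - 1) * w) / (z * w) := by
    field_simp
    linear_combination heqn
  rw [e2] at e1
  refine mul_left_cancel₀ hvC (e1.trans ?_)
  field_simp
  ring

/-- `w` is determined by `∫ η`, and `η` by `z`. -/
theorem IsParam.unique {w' : ℂ} (h : IsParam p (1 - α) v z w) (h' : IsParam p (1 - α) v z w')
    (hp : 0 < p) (hp1 : p < 1) (hv : 0 < v) (hα : 0 ≤ α) (hpα : p + α * p ≤ 1) : w = w' := by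
  have hae := (h.isSolution hp hp1 hv hα hpα).ae_eq (trapezoid_nonneg hv) (trapezoid_le hv)
    measurable_trapezoid h.z_im_pos (h'.isSolution hp hp1 hv hα hpα)
  have hint := integral_congr_ae hae
  rw [h.integral_paramSolution hp hp1 hv hα hpα, h'.integral_paramSolution hp hp1 hv hα hpα] at hint
  have hz := ne_zero_of_im_pos h.z_im_pos
  have hw := h.ne_zero
  have hw' := h'.ne_zero
  have hpC : (p : ℂ) ≠ 0 := ofReal_ne_zero.2 hp.ne'
  have h2 : -(2 * (p : ℂ)) / (z * w') = -(2 * (p : ℂ)) / (z * w) := by linear_combination hint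
  field_simp at h2
  exact neg_injective h2

end Trapezoid

end VarianceProfile

namespace VarianceProfile

open ComplexConjugate Complex LambertTsallis

/-! ### Existence of the parameter -/

section Bounds

variable {p α v : ℝ} {z w : ℂ}

theorem norm_neg_inv_le {c : ℂ} {y : ℝ} (hy : 0 < y) (h : y ≤ c.im) : ‖-c⁻¹‖ ≤ 1 / y := by
  rw [norm_neg, norm_inv, ← one_div]
  exact one_div_le_one_div_of_le hy (h.trans ((le_abs_self _).trans (Complex.abs_im_le_norm c)))

theorem IsParam.norm_lowerSum_le (h : IsParam p (1 - α) v z w) (hp : 0 < p) (hp1 : p < 1)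
    (hv : 0 < v) (hα : 0 ≤ α) (hpα : p + α * p ≤ 1) {x : ℝ} (hx : x ∈ Icc 0 p) :
    ‖lowerSum p (1 - α) z w x‖ ≤ ‖z‖ + v / z.im := by
  rw [h.lowerSum_eq hp hv hα hpα hx]
  refine (norm_add_le _ _).trans ?_
  have hz := h.z_im_pos
  have h1 : ‖∫ y in (0 : ℝ)..x, -(upperSum p (1 - α) v z w y)⁻¹‖ ≤ 1 / z.im * |x - 0| := by
    refine intervalIntegral.norm_integral_le_of_norm_le_const fun y hy => ?_
    rw [uIoc_of_le hx.1] at hy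
    exact norm_neg_inv_le hz (h.im_le_upperSum hp hv hα hpα ⟨hy.1.le, hy.2.trans hx.2⟩)
  rw [sub_zero, abs_of_nonneg hx.1] at h1
  have h2 : 1 / z.im * x ≤ 1 / z.im := mul_le_of_le_one_right (by positivity) (hx.2.trans hp1.le)
  rw [norm_mul, Complex.norm_real, Real.norm_of_nonneg hv.le, div_eq_mul_one_div v]
  gcongr
  exact h1.trans h2

theorem IsParam.norm_upperSum_le (h : IsParam p (1 - α) v z w) (hp : 0 < p)
    (hv : 0 < v) (hα : 0 ≤ α) (hpα : p + α * p ≤ 1) {x : ℝ} (hx : x ∈ Icc 0 p) :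
    ‖upperSum p (1 - α) v z w x‖ ≤ ‖z‖ + v / z.im := by
  rw [h.upperSum_eq hp hv hα hpα hx]
  refine (norm_add_le _ _).trans ?_
  have hz := h.z_im_pos
  have hx' : p ≤ p + α * x := by linarith [mul_nonneg hα hx.1]
  have hx1 : p + α * x ≤ 1 := by linarith [mul_le_mul_of_nonneg_left hx.2 hα]
  have h1 : ‖∫ y in (p + α * x)..1, -(lowerSum p (1 - α) z w (cutoff p α y))⁻¹‖ ≤
      1 / z.im * |1 - (p + α * x)| := by
    refine intervalIntegral.norm_integral_le_of_norm_le_const fun y hy => ?_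
    rw [uIoc_of_le hx1] at hy
    exact norm_neg_inv_le hz
      (h.im_le_lowerSum hp hv hα hpα (cutoff_mem_Icc hp hα (hx'.trans hy.1.le)))
  rw [abs_of_nonneg (by linarith)] at h1
  have h2 : 1 / z.im * (1 - (p + α * x)) ≤ 1 / z.im :=
    mul_le_of_le_one_right (by positivity) (by linarith)
  rw [norm_mul, Complex.norm_real, Real.norm_of_nonneg hv.le, div_eq_mul_one_div v]
  gcongr
  exact h1.trans h2

theorem exp_logTsallis_ofReal {a x : ℝ} (hx : 0 < 1 + a * x) :
    ∃ E : ℝ, 0 < E ∧ exp (logTsallis a x) = E := by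
  unfold logTsallis
  split_ifs
  · exact ⟨Real.exp x, Real.exp_pos _, (ofReal_exp x).symm⟩
  · refine ⟨Real.exp (Real.log (1 + a * x) / a), Real.exp_pos _, ?_⟩
    rw [ofReal_exp, ofReal_div, ofReal_log hx.le]
    push_cast
    rfl

/-- A real parameter belongs to a point of the imaginary axis and is positive. -/
theorem IsParam.pos_of_real {x : ℝ} (h : IsParam p (1 - α) v z x) (hp : 0 < p)
    (hv : 0 < v) (hα : 0 ≤ α) (hpα : p + α * p ≤ 1) :
    0 < x ∧ 0 < p + (2 * p - 1) * x ∧ 0 < 1 + (1 - α) * x := by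
  have hz := h.z_im_pos
  have hm : 0 < 1 + (1 - α) * x := by
    have h1 := h.mem
    have h2 : (1 : ℂ) + ((1 - α : ℝ) : ℂ) * x = ((1 + (1 - α) * x : ℝ) : ℂ) := by push_cast; ring
    rw [h2, ofReal_mem_slitPlane] at h1
    exact h1
  obtain ⟨E, hE, hE'⟩ := exp_logTsallis_ofReal hm
  have heqn := h.eqn
  rw [hE'] at heqn
  have him := congrArg im heqn
  have hre := congrArg re heqn
  have e1 : z ^ 2 * E * x = z ^ 2 * ((E * x : ℝ) : ℂ) := by push_cast; ring
  have e2 : -(v : ℂ) * (p + (2 * p - 1) * x) = ((-v * (p + (2 * p - 1) * x) : ℝ) : ℂ) := by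
    push_cast; ring
  rw [e1, e2] at him hre
  rw [mul_comm, im_ofReal_mul, ofReal_im] at him
  rw [mul_comm, re_ofReal_mul, ofReal_re] at hre
  have hx0 : x ≠ 0 := fun h0 => h.ne_zero (by simp [h0])
  simp only [sq, mul_re, mul_im] at him hre
  have hzre : z.re = 0 := by
    have : z.re * z.im + z.im * z.re = 0 :=
      (mul_eq_zero.1 him).resolve_left (mul_ne_zero hE.ne' hx0)
    have h3 : z.re * z.im = 0 := by linarith
    exact (mul_eq_zero.1 h3).resolve_right hz.ne'
  rw [hzre] at hre
  have hG := hz.trans_le (h.im_le_upperSum hp hv hα hpα (left_mem_Icc.2 hp.le))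
  rw [upperSum_zero] at hG
  have hzI : z = z.im * I := by apply Complex.ext <;> simp [hzre]
  have e3 : -(v * p : ℂ) / x / z = ((v * p / x / z.im : ℝ) : ℂ) * I := by
    have hzC : (z.im : ℂ) ≠ 0 := ofReal_ne_zero.2 hz.ne'
    have hxC : (x : ℂ) ≠ 0 := ofReal_ne_zero.2 hx0
    conv_lhs => rw [hzI]
    push_cast
    field_simp
    rw [I_sq]
    ring
  rw [e3, im_ofReal_mul, I_im, mul_one] at hG
  have hx : 0 < x := by
    by_contra hneg
    have : v * p / x ≤ 0 := div_nonpos_of_nonneg_of_nonpos (by positivity) (not_lt.1 hneg)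
    exact absurd hG (not_lt.2 (div_nonpos_of_nonpos_of_nonneg this hz.le))
  refine ⟨hx, ?_, hm⟩
  have h5 : 0 < E * x * (z.im * z.im) := by positivity
  by_contra h6
  nlinarith [mul_nonneg hv.le (sub_nonneg.2 (not_lt.1 h6))]

/-- Up to the factor `p`, the numerator of `f'/f` is `1 + a w + w (1 + γ w)`, whose roots are real,
while it is positive at the real parameters. -/
theorem IsParam.numerator_ne_zero (h : IsParam p (1 - α) v z w) (hp : 0 < p)
    (hv : 0 < v) (hα : 0 ≤ α) (hpα : p + α * p ≤ 1) :
    p * (1 + ((1 - α : ℝ) : ℂ) * w) + w * (p + (2 * p - 1) * w) ≠ 0 := by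
  intro h0
  by_cases hw : w.im = 0
  · have hwr : w = (w.re : ℂ) := by apply Complex.ext <;> simp [hw]
    rw [hwr] at h h0
    obtain ⟨h1, h2, h3⟩ := h.pos_of_real hp hv hα hpα
    have h4 : p * (1 + (1 - α) * w.re) + w.re * (p + (2 * p - 1) * w.re) = 0 := by exact_mod_cast h0
    have := mul_pos hp h3
    have := mul_pos h1 h2
    linarith
  · have him := congrArg im h0
    have hre := congrArg re h0
    simp only [add_im, mul_im, add_re, mul_re, ofReal_re, ofReal_im, one_re, one_im, sub_re, sub_im,
      re_ofNat, im_ofNat, zero_re, zero_im] at him hre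
    ring_nf at him hre
    set x := w.re
    set y := w.im
    have e1 : 2 * (2 * p - 1) * x = -(p * (2 - α)) := by
      refine mul_left_cancel₀ hw ?_
      linear_combination him
    have e2 : (2 * p - 1) * (x ^ 2 + y ^ 2) = p := by
      linear_combination -hre + x * e1
    have hy2 : 0 < y ^ 2 := by positivity
    have hxy : 0 < x ^ 2 + y ^ 2 := by positivity
    have hγ : 0 < 2 * p - 1 := by
      by_contra hneg
      have := mul_nonneg (neg_nonneg.2 (not_lt.1 hneg)) hxy.le
      linarith
    have e3 : (p * (2 - α)) ^ 2 = 4 * (2 * p - 1) * p - 4 * (2 * p - 1) ^ 2 * y ^ 2 := by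
      have : (p * (2 - α)) ^ 2 = (2 * (2 * p - 1) * x) ^ 2 := by rw [e1]; ring
      rw [this]
      linear_combination 4 * (2 * p - 1) * e2
    have e4 : 0 < (2 * p - 1) ^ 2 * y ^ 2 := by positivity
    have e5 : (2 * p - 1) * p ≤ p * (1 - α) * p := by
      apply mul_le_mul_of_nonneg_right _ hp.le
      linarith
    nlinarith [sq_nonneg (p * α)]

end Bounds

/-- A holomorphic function with nonzero derivative at `w₀` has a local holomorphic inverse. -/
theorem exists_local_inverse {f : ℂ → ℂ} {w₀ : ℂ} (hf : AnalyticAt ℂ f w₀)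
    (hd : deriv f w₀ ≠ 0) : ∃ g : ℂ → ℂ, DifferentiableAt ℂ g (f w₀) ∧ g (f w₀) = w₀ ∧
      (∀ᶠ u in 𝓝 (f w₀), f (g u) = u) ∧ (∀ᶠ w in 𝓝 w₀, g (f w) = w) ∧
      ∀ᶠ u in 𝓝 (f w₀), ContinuousAt g u := by
  have hs := hf.hasStrictDerivAt
  refine ⟨hs.localInverse f _ w₀ hd, (hs.to_localInverse hd).hasDerivAt.differentiableAt,
    ?_, ?_, ?_, ?_⟩
  · exact (hs.hasStrictFDerivAt_equiv hd).localInverse_apply_image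
  · exact (hs.hasStrictFDerivAt_equiv hd).eventually_right_inverse
  · exact (hs.hasStrictFDerivAt_equiv hd).eventually_left_inverse
  · have hd' := hs.hasStrictFDerivAt_equiv hd
    filter_upwards [(hd'.toOpenPartialHomeomorph f).open_target.mem_nhds
      hd'.image_mem_toOpenPartialHomeomorph_target] with u hu
    exact (hd'.toOpenPartialHomeomorph f).continuousAt_symm hu

section Existence

variable {p a α v : ℝ} {z w : ℂ}

/-- The parameter extends holomorphically to a neighbourhood, by inverting `w ↦ f_{κ,γ}(w) / p`. -/
theorem IsParam.exists_nhds (h : IsParam p (1 - α) v z w) (hp : 0 < p)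
    (hv : 0 < v) (hα : 0 ≤ α) (hpα : p + α * p ≤ 1) :
    ∃ g : ℂ → ℂ, DifferentiableAt ℂ g z ∧ ∀ᶠ z' in 𝓝 z, IsParam p (1 - α) v z' (g z') := by
  set a : ℝ := 1 - α with ha
  have hz := ne_zero_of_im_pos h.z_im_pos
  have hw := h.ne_zero
  have hvC : (v : ℂ) ≠ 0 := ofReal_ne_zero.2 hv.ne'
  have hden : (p : ℂ) + (2 * p - 1) * w ≠ 0 := fun h0 => by
    have h1 := h.eqn
    rw [h0, mul_zero] at h1
    exact mul_ne_zero (mul_ne_zero (pow_ne_zero 2 hz) (exp_ne_zero _)) hw h1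
  set Φ : ℂ → ℂ := fun w => w * exp (logTsallis a w) / (p + (2 * p - 1) * w) with hΦ
  have hopen1 : IsOpen {w : ℂ | 1 + a * w ∈ slitPlane} :=
    isOpen_slitPlane.preimage (by fun_prop)
  have hopen2 : IsOpen {w : ℂ | (p : ℂ) + (2 * p - 1) * w ≠ 0} :=
    isOpen_compl_singleton.preimage (by fun_prop : Continuous fun w : ℂ => (p : ℂ) + (2 * p - 1) * w)
  have hder : ∀ w : ℂ, 1 + a * w ∈ slitPlane → (p : ℂ) + (2 * p - 1) * w ≠ 0 →
      HasDerivAt Φ (exp (logTsallis a w) * (p * (1 + a * w) + w * (p + (2 * p - 1) * w)) /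
        ((1 + a * w) * (p + (2 * p - 1) * w) ^ 2)) w := fun w hw1 hw2 => by
    have h1 := ((hasDerivAt_id w).mul (hasDerivAt_logTsallis hw1).cexp).div
      (((hasDerivAt_id w).const_mul (2 * p - 1 : ℂ)).const_add (p : ℂ)) hw2
    refine h1.congr_deriv ?_
    have h3 := slitPlane_ne_zero hw1
    have h4 := mul_inv_cancel₀ h3
    simp only [Pi.mul_apply, id_eq, one_div]
    rw [div_eq_div_iff (pow_ne_zero 2 hw2) (mul_ne_zero h3 (pow_ne_zero 2 hw2))]
    linear_combination
      exp (logTsallis a w) * (p + (2 * p - 1) * w) ^ 3 * w * h4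
  have han : AnalyticAt ℂ Φ w := by
    have hd : DifferentiableOn ℂ Φ ({w | 1 + a * w ∈ slitPlane} ∩
        {w | (p : ℂ) + (2 * p - 1) * w ≠ 0}) := fun w hw =>
      (hder w hw.1 hw.2).differentiableAt.differentiableWithinAt
    exact hd.analyticAt ((hopen1.inter hopen2).mem_nhds ⟨h.mem, hden⟩)
  have hΦw : Φ w = -v / z ^ 2 := by
    simp only [hΦ]
    rw [div_eq_div_iff hden (pow_ne_zero 2 hz)]
    linear_combination h.eqn
  obtain ⟨g, hg1, hg2, hg3, -⟩ := exists_local_inverse han (by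
    rw [(hder w h.mem hden).deriv]
    exact div_ne_zero (mul_ne_zero (exp_ne_zero _) (h.numerator_ne_zero hp hv hα hpα))
      (mul_ne_zero (slitPlane_ne_zero h.mem) (pow_ne_zero 2 hden)))
  have hdz : DifferentiableAt ℂ (fun z : ℂ => -(v : ℂ) / z ^ 2) z :=
    (differentiableAt_const _).div (by fun_prop) (pow_ne_zero 2 hz)
  have hg0 : g (-v / z ^ 2) = w := by rw [← hΦw, hg2]
  have hdg : DifferentiableAt ℂ (fun z => g (-(v : ℂ) / z ^ 2)) z :=
    DifferentiableAt.comp (f := fun z : ℂ => -(v : ℂ) / z ^ 2) z (by rw [← hΦw]; exact hg1) hdz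
  refine ⟨fun z => g (-v / z ^ 2), hdg, ?_⟩
  have hcg : Tendsto (fun z => g (-(v : ℂ) / z ^ 2)) (𝓝 z) (𝓝 w) := by
    have := hdg.continuousAt.tendsto
    rwa [hg0] at this
  have ht : Tendsto (fun z : ℂ => -(v : ℂ) / z ^ 2) (𝓝 z) (𝓝 (Φ w)) := by
    rw [hΦw]
    exact hdz.continuousAt.tendsto
  have hpos : ∀ᶠ q : ℂ × ℂ in 𝓝 (z, w), ∀ s ∈ Icc (0 : ℝ) 1,
      0 < (q.1 * exp (logTsallis a (s * q.2))).im := by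
    refine isCompact_Icc.eventually_forall_of_forall_eventually fun s hs => ?_
    have hmem := one_add_smul_mem_slitPlane h.mem hs
    have hc : ContinuousAt (fun q : (ℂ × ℂ) × ℝ => (q.1.1 * exp (logTsallis a (q.2 * q.1.2))).im)
        ((z, w), s) := by
      have h1 : ContinuousAt (fun q : (ℂ × ℂ) × ℝ => logTsallis a (q.2 * q.1.2)) ((z, w), s) :=
        ContinuousAt.comp (f := fun q : (ℂ × ℂ) × ℝ => (q.2 : ℂ) * q.1.2) (x := ((z, w), s))
          (hasDerivAt_logTsallis hmem).continuousAt (by fun_prop)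
      exact continuous_im.continuousAt.comp
        (ContinuousAt.mul (by fun_prop) (continuous_exp.continuousAt.comp h1))
    exact hc.eventually (lt_mem_nhds (h.im_pos s hs))
  have hpair : Tendsto (fun z => (z, g (-(v : ℂ) / z ^ 2))) (𝓝 z) (𝓝 (z, w)) :=
    tendsto_id.prodMk_nhds hcg
  filter_upwards [hcg.eventually (isOpen_compl_singleton.mem_nhds hw),
    hcg.eventually (hopen1.mem_nhds h.mem), hcg.eventually (hopen2.mem_nhds hden),
    ht.eventually hg3, hpair.eventually hpos, isOpen_compl_singleton.mem_nhds hz]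
    with z' c1 c2 c3 c4 c5 c6
  refine ⟨c1, c2, ?_, c5⟩
  simp only [hΦ] at c4
  have c6' : z' ^ 2 ≠ 0 := pow_ne_zero 2 c6
  have c3' : (p : ℂ) + (2 * p - 1) * g (-v / z' ^ 2) ≠ 0 := c3
  rw [div_eq_iff c3'] at c4
  linear_combination z' ^ 2 * c4 +
    (p + (2 * p - 1) * g (-v / z' ^ 2)) * (div_mul_cancel₀ (-(v : ℂ)) c6')

/-- Small positive numbers are parameters of points of the imaginary axis. -/
theorem exists_isParam_of_pos {x : ℝ} (hv : 0 < v) (hx : 0 < x) (hx1 : 0 < 1 + a * x)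
    (hx2 : 0 < p + (2 * p - 1) * x) : ∃ z : ℂ, IsParam p a v z x := by
  obtain ⟨E, hE, hE'⟩ := exp_logTsallis_ofReal hx1
  set t := √(v * (p + (2 * p - 1) * x) / (E * x)) with ht
  have ht0 : 0 < t := Real.sqrt_pos.2 (by positivity)
  have ht2 : t ^ 2 = v * (p + (2 * p - 1) * x) / (E * x) := Real.sq_sqrt (by positivity)
  have hmem : (1 : ℂ) + a * x ∈ slitPlane := by
    have h2 : (1 : ℂ) + a * x = ((1 + a * x : ℝ) : ℂ) := by push_cast; ring
    rw [h2, ofReal_mem_slitPlane]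
    exact hx1
  refine ⟨t * I, ofReal_ne_zero.2 hx.ne', hmem, ?_, fun s hs => ?_⟩
  · rw [hE', mul_pow, I_sq, ← ofReal_pow, ht2]
    have h1 : (E : ℂ) ≠ 0 := ofReal_ne_zero.2 hE.ne'
    have h2 : (x : ℂ) ≠ 0 := ofReal_ne_zero.2 hx.ne'
    push_cast
    field_simp
  · have h1 : 0 < 1 + a * (s * x) := by
      have := one_add_smul_mem_slitPlane hmem hs
      have h2 : (1 : ℂ) + a * (s * x) = ((1 + a * (s * x) : ℝ) : ℂ) := by push_cast; ring
      rw [h2, ofReal_mem_slitPlane] at this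
      exact this
    obtain ⟨E', hE1, hE2⟩ := exp_logTsallis_ofReal h1
    rw [← ofReal_mul, hE2, mul_assoc, im_ofReal_mul, im_mul_ofReal, I_im, one_mul]
    positivity

/-- A segment `1 + s c`, `0 ≤ s ≤ 1`, that ends on `(-∞, 0]` passes through `0`. -/
theorem mem_slitPlane_of_forall_ne {c : ℂ} (h : ∀ s ∈ Icc (0 : ℝ) 1, 1 + s * c ≠ 0) :
    1 + c ∈ slitPlane := by
  by_contra hn
  rw [mem_slitPlane_iff_not_le_zero, not_not, Complex.le_def] at hn
  simp only [add_re, one_re, zero_re, add_im, one_im, zero_add, zero_im] at hn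
  have hc : c = (c.re : ℂ) := by apply Complex.ext <;> simp [hn.2]
  have hle : c.re ≤ -1 := by linarith [hn.1]
  have hne : c.re ≠ 0 := by linarith
  refine h (-1 / c.re) ⟨div_nonneg_of_nonpos (by norm_num) (by linarith), ?_⟩ ?_
  · rw [div_le_one_of_neg (by linarith)]
    exact hle
  · rw [hc, ofReal_re, ← ofReal_mul, div_mul_cancel₀ _ hne]
    simp

/-- The estimates on the solution keep the parameters away from the boundary of the domain of the
Tsallis logarithm, so that limits of parameters are parameters. -/
theorem exists_isParam_of_mem_closure (hp : 0 < p) (hp1 : p < 1)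
    (hv : 0 < v) (hα : 0 ≤ α) (hpα : p + α * p ≤ 1) (hz : 0 < z.im)
    (hcl : z ∈ closure {z : ℂ | ∃ w, IsParam p (1 - α) v z w}) :
    ∃ w, IsParam p (1 - α) v z w := by
  set δ := z.im / 2 with hδ
  set R := ‖z‖ + 1 with hR
  have hδ0 : 0 < δ := by positivity
  have hR0 : 0 < R := by positivity
  -- a neighbourhood of `z` on which the bounds for the solution are uniform
  set V : Set ℂ := {z' | δ < z'.im} ∩ {z' | ‖z'‖ < R} with hV
  have hVo : IsOpen V := (isOpen_im_gt δ).inter (isOpen_lt continuous_norm continuous_const)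
  have hzV : z ∈ V := ⟨by simp only [mem_ofPred_eq]; linarith, by simp only [mem_ofPred_eq]; linarith⟩
  have hcl' := hVo.inter_closure ⟨hzV, hcl⟩
  obtain ⟨Z, hZ, hZz⟩ := mem_closure_iff_seq_limit.1 hcl'
  choose hZV w hw using hZ
  set B := R + v / δ with hB
  have hB0 : 0 < B := by positivity
  have hzB : ∀ n, ‖Z n‖ + v / (Z n).im ≤ B := fun n => by
    have h1 : v / (Z n).im ≤ v / δ := div_le_div_of_nonneg_left hv.le hδ0 (hZV n).1.le
    have h2 := (hZV n).2
    simp only [mem_ofPred_eq] at h2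
    linarith
  have hzn : ∀ n, δ ≤ ‖Z n‖ := fun n =>
    (hZV n).1.le.trans ((le_abs_self _).trans (Complex.abs_im_le_norm _))
  -- `w = -v p / (z G(0))`, which bounds `w` from above and below
  have hmul : ∀ n, ‖w n‖ * ‖Z n‖ * ‖upperSum p (1 - α) v (Z n) (w n) 0‖ = v * p := fun n => by
    have h1 := (hw n).ne_zero
    have h2 := ne_zero_of_im_pos (hw n).z_im_pos
    rw [← norm_mul, ← norm_mul, upperSum_zero]
    have : w n * Z n * (-(v * p) / w n / Z n) = -((v * p : ℝ) : ℂ) := by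
      push_cast
      field_simp
    rw [this, norm_neg, Complex.norm_real, Real.norm_of_nonneg (by positivity)]
  have hG1 : ∀ n, δ ≤ ‖upperSum p (1 - α) v (Z n) (w n) 0‖ := fun n =>
    (hZV n).1.le.trans (((hw n).im_le_upperSum hp hv hα hpα (left_mem_Icc.2 hp.le)).trans
      ((le_abs_self _).trans (Complex.abs_im_le_norm _)))
  have hG2 : ∀ n, ‖upperSum p (1 - α) v (Z n) (w n) 0‖ ≤ B := fun n =>
    ((hw n).norm_upperSum_le hp hv hα hpα (left_mem_Icc.2 hp.le)).trans (hzB n)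
  have hw1 : ∀ n, ‖w n‖ ≤ v * p / (δ * δ) := fun n => by
    rw [le_div_iff₀ (by positivity), ← hmul n, mul_assoc]
    exact mul_le_mul_of_nonneg_left (mul_le_mul (hzn n) (hG1 n) hδ0.le (norm_nonneg _))
      (norm_nonneg _)
  have hw2 : ∀ n, v * p / (R * B) ≤ ‖w n‖ := fun n => by
    rw [div_le_iff₀ (by positivity), ← hmul n, mul_assoc]
    exact mul_le_mul_of_nonneg_left (mul_le_mul (hZV n).2.le (hG2 n) (norm_nonneg _) hR0.le)
      (norm_nonneg _)
  obtain ⟨w₀, -, φ, hφ, hlim⟩ := (isCompact_closedBall (0 : ℂ) (v * p / (δ * δ))).tendsto_subseq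
    (fun n => by simpa using hw1 n)
  have hZlim : Tendsto (fun n => Z (φ n)) atTop (𝓝 z) := hZz.comp hφ.tendsto_atTop
  have hwlim : Tendsto (fun n => w (φ n)) atTop (𝓝 w₀) := hlim
  have hw0 : w₀ ≠ 0 := by
    have h1 : v * p / (R * B) ≤ ‖w₀‖ := ge_of_tendsto' hwlim.norm fun n => hw2 (φ n)
    have h2 : 0 < v * p / (R * B) := by positivity
    exact norm_pos_iff.1 (h2.trans_le h1)
  -- the sums `z exp_κ(s w)` of the approximating solutions, at `x = p s`
  have hls : ∀ n, ∀ s : ℝ, lowerSum p (1 - α) (Z n) (w n) (p * s) =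
      Z n * exp (logTsallis (1 - α) (s * w n)) := fun n s => by
    rw [lowerSum, mul_div_cancel_left₀ _ hp.ne']
  have hsmem : ∀ s ∈ Icc (0 : ℝ) 1, p * s ∈ Icc 0 p := fun s hs =>
    ⟨mul_nonneg hp.le hs.1, mul_le_of_le_one_right hp.le hs.2⟩
  have hF0 : ∀ n, ∀ s ∈ Icc (0 : ℝ) 1,
      (Z n).im ≤ (Z n * exp (logTsallis (1 - α) (s * w n))).im := fun n s hs => by
    rw [← hls]
    exact (hw n).im_le_lowerSum hp hv hα hpα (hsmem s hs)
  have hF1 : ∀ n, ∀ s ∈ Icc (0 : ℝ) 1, δ / R ≤ ‖exp (logTsallis (1 - α) (s * w n))‖ :=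
    fun n s hs => by
    have h1 := (hZV n).1.le.trans ((hF0 n s hs).trans
      ((le_abs_self _).trans (Complex.abs_im_le_norm _)))
    rw [norm_mul] at h1
    rw [div_le_iff₀ hR0, mul_comm]
    exact h1.trans (mul_le_mul_of_nonneg_right (hZV n).2.le (norm_nonneg _))
  have hF2 : ∀ n, ∀ s ∈ Icc (0 : ℝ) 1, ‖exp (logTsallis (1 - α) (s * w n))‖ ≤ B / δ :=
    fun n s hs => by
    have h1 := ((hw n).norm_lowerSum_le hp hp1 hv hα hpα (hsmem s hs)).trans (hzB n)
    rw [hls, norm_mul] at h1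
    rw [le_div_iff₀ hδ0, mul_comm]
    exact (mul_le_mul_of_nonneg_right (hzn n) (norm_nonneg _)).trans h1
  -- `|1 + a s w| = |exp_κ(s w)| ^ a` stays away from `0`, also in the limit
  obtain ⟨c, hc0, hc⟩ : ∃ c : ℝ, 0 < c ∧ ∀ n, ∀ s ∈ Icc (0 : ℝ) 1,
      c ≤ ‖1 + ((1 - α : ℝ) : ℂ) * (s * w n)‖ := by
    have hne : ∀ n, ∀ s ∈ Icc (0 : ℝ) 1, 1 + ((1 - α : ℝ) : ℂ) * (s * w n) ≠ 0 := fun n s hs =>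
      slitPlane_ne_zero (one_add_smul_mem_slitPlane (hw n).mem hs)
    rcases le_total 0 (1 - α) with ha | ha
    · refine ⟨(δ / R) ^ (1 - α), by positivity, fun n s hs => ?_⟩
      rw [norm_one_add_mul (hne n s hs)]
      exact Real.rpow_le_rpow (by positivity) (hF1 n s hs) ha
    · refine ⟨(B / δ) ^ (1 - α), by positivity, fun n s hs => ?_⟩
      rw [norm_one_add_mul (hne n s hs)]
      exact Real.rpow_le_rpow_of_nonpos (norm_pos_iff.2 (exp_ne_zero _)) (hF2 n s hs) ha
  have hmem : 1 + ((1 - α : ℝ) : ℂ) * w₀ ∈ slitPlane := by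
    refine mem_slitPlane_of_forall_ne fun s hs h0 => ?_
    have h1 : Tendsto (fun n => ‖1 + ((1 - α : ℝ) : ℂ) * (s * w (φ n))‖) atTop
        (𝓝 ‖1 + ((1 - α : ℝ) : ℂ) * (s * w₀)‖) :=
      (((hwlim.const_mul (s : ℂ)).const_mul ((1 - α : ℝ) : ℂ)).const_add 1).norm
    have h2 := ge_of_tendsto' h1 fun n => hc (φ n) s hs
    rw [mul_left_comm, h0, norm_zero] at h2
    linarith
  have hFlim : ∀ s ∈ Icc (0 : ℝ) 1, Tendsto
      (fun n => exp (logTsallis (1 - α) (s * w (φ n)))) atTop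
      (𝓝 (exp (logTsallis (1 - α) (s * w₀)))) := fun s hs =>
    (continuous_exp.tendsto _).comp
      ((hasDerivAt_logTsallis (one_add_smul_mem_slitPlane hmem hs)).continuousAt.tendsto.comp
        (hwlim.const_mul (s : ℂ)))
  refine ⟨w₀, hw0, hmem, ?_, fun s hs => ?_⟩
  · have h1 := ((hZlim.pow 2).mul (hFlim 1 (by simp))).mul hwlim
    have h2 := ((hwlim.const_mul (2 * p - 1 : ℂ)).const_add (p : ℂ)).const_mul (-(v : ℂ))
    simp only [ofReal_one, one_mul] at h1
    refine tendsto_nhds_unique h1 (h2.congr fun n => ?_)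
    exact (hw (φ n)).eqn.symm
  · have h1 := (continuous_im.tendsto _).comp (hZlim.mul (hFlim s hs))
    have h2 := le_of_tendsto_of_tendsto' ((continuous_im.tendsto _).comp hZlim) h1
      fun n => hF0 (φ n) s hs
    exact hz.trans_le h2

/-- The points with a parameter form a nonempty subset of the upper half-plane that is open and
relatively closed. -/
theorem exists_isParam (hp : 0 < p) (hp1 : p < 1)
    (hv : 0 < v) (hα : 0 ≤ α) (hpα : p + α * p ≤ 1) (hz : 0 < z.im) :
    ∃ w, IsParam p (1 - α) v z w := by
  have hopen : IsOpen {z : ℂ | ∃ w, IsParam p (1 - α) v z w} := by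
    rw [isOpen_iff_mem_nhds]
    rintro z ⟨w, hw⟩
    obtain ⟨g, -, hg⟩ := hw.exists_nhds hp hv hα hpα
    exact hg.mono fun z' h => ⟨_, h⟩
  have hne : ({z : ℂ | 0 < z.im} ∩ {z : ℂ | ∃ w, IsParam p (1 - α) v z w}).Nonempty := by
    set x := p / (2 * (1 + |1 - α|)) with hx
    have h1 : 0 ≤ |1 - α| := abs_nonneg _
    have hx0 : 0 < x := by positivity
    have hx1 : |1 - α| * x < 1 := by
      rw [hx, mul_div_assoc', div_lt_one (by positivity)]
      nlinarith
    have hx2 : x ≤ p / 2 := by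
      rw [hx]
      gcongr
      linarith
    obtain ⟨z, hz⟩ := exists_isParam_of_pos (p := p) (a := 1 - α) hv hx0
      (by nlinarith [neg_abs_le (1 - α)]) (by nlinarith)
    exact ⟨z, hz.z_im_pos, _, hz⟩
  exact (convex_halfSpace_im_gt 0).isPreconnected.subset_of_closure_inter_subset hopen hne
    (fun z hz => exists_isParam_of_mem_closure hp hp1 hv hα hpα hz.2 hz.1) hz

end Existence

end VarianceProfile

namespace VarianceProfile

open ComplexConjugate Complex LambertTsallis

/-! ### The generalized Tsallis function on its complex domain -/

section Tsallis

variable {p α : ℝ} {w : ℂ}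

theorem mem_expDomain_iff :
    w ∈ expDomain (angleParam α) ↔ α = 0 ∨ 1 + ((1 - α : ℝ) : ℂ) * w ∈ slitPlane := by
  unfold angleParam
  split_ifs with h
  · subst h
    simp [expDomain]
  · have h1 : 1 - α ≠ 0 := sub_ne_zero.2 (Ne.symm h)
    have h2 : w / ((1 / (1 - α) : ℝ) : ℂ) = ((1 - α : ℝ) : ℂ) * w := by
      have : ((1 - α : ℝ) : ℂ) ≠ 0 := ofReal_ne_zero.2 h1
      rw [ofReal_div]
      field_simp
      simp
    have h3 : 1 / (1 - α) = 1 ↔ α = 0 := by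
      rw [div_eq_one_iff_eq h1]
      constructor <;> intro <;> linarith
    simp only [expDomain, mem_ofPred_eq, h2, h3]

theorem tsallisExp_eq_exp (h : 1 + ((1 - α : ℝ) : ℂ) * w ≠ 0) :
    tsallisExp (angleParam α) w = exp (logTsallis (1 - α) w) := by
  unfold angleParam
  split_ifs with h1
  · subst h1
    simp [tsallisExp, logTsallis]
  · have h2 : 1 - α ≠ 0 := sub_ne_zero.2 (Ne.symm h1)
    have h3 : ((1 - α : ℝ) : ℂ) ≠ 0 := ofReal_ne_zero.2 h2
    have h4 : w / ((1 / (1 - α) : ℝ) : ℂ) = ((1 - α : ℝ) : ℂ) * w := by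
      rw [ofReal_div]
      field_simp
      simp
    simp only [tsallisExp]
    rw [h4, cpow_def_of_ne_zero h, logTsallis, if_neg h2, ofReal_div, ofReal_one, mul_one_div]

theorem tsallisExp_of_eq_zero (hα : α = 0) : tsallisExp (angleParam α) w = 1 + w := by
  subst hα
  simp [angleParam, tsallisExp]

/-- The factor `T` is `exp_κ(w) / (1 + a w)`. For `κ = 1` it is `1`, without any branch of the power. -/
theorem hasDerivAt_genTsallis (hw : w ∈ expDomain (angleParam α))
    (hp : 1 + (shapeParam p : ℂ) * w ≠ 0) :
    ∃ T : ℂ, HasDerivAt (genTsallis (angleParam α) (shapeParam p))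
      (T * (1 + ((1 - α : ℝ) : ℂ) * w + w * (1 + shapeParam p * w)) /
        (1 + shapeParam p * w) ^ 2) w ∧
      ((α = 0 ∧ T = 1) ∨ (1 + ((1 - α : ℝ) : ℂ) * w ∈ slitPlane ∧
        T = exp (logTsallis (1 - α) w) / (1 + ((1 - α : ℝ) : ℂ) * w))) := by
  have h1 : HasDerivAt (fun w : ℂ => w / (1 + (shapeParam p : ℂ) * w))
      (1 / (1 + (shapeParam p : ℂ) * w) ^ 2) w := by
    refine ((hasDerivAt_id' w).div
      (((hasDerivAt_id' w).const_mul (shapeParam p : ℂ)).const_add 1) hp).congr_deriv ?_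
    congr 1
    ring
  rcases mem_expDomain_iff.1 hw with hα | hm
  · refine ⟨1, ?_, Or.inl ⟨hα, rfl⟩⟩
    have h2 : genTsallis (angleParam α) (shapeParam p) =
        fun w => w / (1 + (shapeParam p : ℂ) * w) * (1 + w) := by
      funext w
      simp only [genTsallis, tsallisExp_of_eq_zero hα]
    rw [h2]
    refine (h1.mul ((hasDerivAt_id' w).const_add 1)).congr_deriv ?_
    subst hα
    simp only [sub_zero, ofReal_one]
    field_simp
  · refine ⟨_, ?_, Or.inr ⟨hm, rfl⟩⟩
    have hopen : IsOpen {w : ℂ | 1 + ((1 - α : ℝ) : ℂ) * w ∈ slitPlane} :=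
      isOpen_slitPlane.preimage (by fun_prop)
    have h2 : genTsallis (angleParam α) (shapeParam p) =ᶠ[𝓝 w]
        fun w => w / (1 + (shapeParam p : ℂ) * w) * exp (logTsallis (1 - α) w) := by
      filter_upwards [hopen.mem_nhds hm] with w' hw'
      simp only [genTsallis, tsallisExp_eq_exp (slitPlane_ne_zero hw')]
    refine HasDerivAt.congr_of_eventuallyEq ?_ h2
    refine (h1.mul (hasDerivAt_logTsallis hm).cexp).congr_deriv ?_
    have h3 := slitPlane_ne_zero hm
    generalize (1 : ℂ) + ((1 - α : ℝ) : ℂ) * w = A at h3 ⊢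
    generalize exp (logTsallis (1 - α) w) = E
    field_simp

theorem isOpen_regular : IsOpen {w : ℂ | w ∈ expDomain (angleParam α) ∧
    1 + (shapeParam p : ℂ) * w ≠ 0} := by
  refine IsOpen.inter ?_ (isOpen_compl_singleton.preimage (by fun_prop :
    Continuous fun w : ℂ => 1 + (shapeParam p : ℂ) * w))
  have : expDomain (angleParam α) = {w | α = 0 ∨ 1 + ((1 - α : ℝ) : ℂ) * w ∈ slitPlane} :=
    Set.ext fun w => mem_expDomain_iff
  change IsOpen (expDomain (angleParam α))
  rw [this]
  exact isOpen_const.union (isOpen_slitPlane.preimage (by fun_prop))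

theorem differentiableOn_genTsallis :
    DifferentiableOn ℂ (genTsallis (angleParam α) (shapeParam p))
      {w : ℂ | w ∈ expDomain (angleParam α) ∧ 1 + (shapeParam p : ℂ) * w ≠ 0} :=
  fun _ hw => (hasDerivAt_genTsallis hw.1 hw.2).choose_spec.1.differentiableAt.differentiableWithinAt

theorem genTsallis_conj (hw : w ∈ expDomain (angleParam α)) :
    genTsallis (angleParam α) (shapeParam p) (conj w) =
      conj (genTsallis (angleParam α) (shapeParam p) w) := by
  have h : tsallisExp (angleParam α) (conj w) = conj (tsallisExp (angleParam α) w) := by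
    rcases mem_expDomain_iff.1 hw with hα | hm
    · simp [tsallisExp_of_eq_zero hα]
    · have h1 : 1 + ((1 - α : ℝ) : ℂ) * conj w = conj (1 + ((1 - α : ℝ) : ℂ) * w) := by simp
      rw [tsallisExp_eq_exp (slitPlane_ne_zero hm), tsallisExp_eq_exp, logTsallis_conj hm,
        ← exp_conj]
      rw [h1]
      exact (map_ne_zero _).2 (slitPlane_ne_zero hm)
  simp [genTsallis, h]

end Tsallis

/-! ### The branch on the slit plane -/

section Slit

variable {p a α v : ℝ} {z w u : ℂ}

/-- The point `z` of the upper half-plane with `-v p / z² = u`, for `u` in the slit plane. -/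
noncomputable def rootPoint (p v : ℝ) (u : ℂ) : ℂ := √(v * p) * (I * exp (-log u / 2))

theorem rootPoint_sq (hp : 0 < p) (hv : 0 < v) (hu : u ≠ 0) :
    rootPoint p v u ^ 2 = -(v * p) / u := by
  have h1 : ((√(v * p) : ℝ) : ℂ) ^ 2 = v * p := by
    rw [← ofReal_pow, Real.sq_sqrt (by positivity), ofReal_mul]
  rw [rootPoint, mul_pow, mul_pow, I_sq, h1, ← exp_nat_mul]
  have h2 : ((2 : ℕ) : ℂ) * (-log u / 2) = -log u := by push_cast; ring
  rw [h2, exp_neg, exp_log hu]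
  ring

theorem rootPoint_mul_exp_im (c : ℂ) : (rootPoint p v u * exp c).im =
    √(v * p) * (Real.exp (c.re - (log u).re / 2) * Real.cos (c.im - arg u / 2)) := by
  have : rootPoint p v u * exp c = √(v * p) * (I * exp (c - log u / 2)) := by
    rw [rootPoint, sub_eq_add_neg, exp_add]
    ring_nf
  rw [this, im_ofReal_mul, I_mul_im, exp_re]
  have h1 : log u / 2 = log u / (2 : ℝ) := by simp
  rw [h1, sub_re, sub_im, div_ofReal_re, div_ofReal_im, log_im]

theorem rootPoint_im_pos (hp : 0 < p) (hv : 0 < v) (hu : u ∈ slitPlane) :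
    0 < (rootPoint p v u).im := by
  have h := rootPoint_mul_exp_im (p := p) (v := v) (u := u) 0
  rw [exp_zero, mul_one] at h
  rw [h]
  have h1 := neg_pi_lt_arg u
  have h2 := lt_of_le_of_ne (arg_le_pi u) (slitPlane_arg_ne_pi hu)
  have : 0 < Real.cos ((0 : ℂ).im - arg u / 2) := by
    rw [zero_im]
    exact Real.cos_pos_of_mem_Ioo ⟨by linarith, by linarith⟩
  have : 0 < √(v * p) := Real.sqrt_pos.2 (by positivity)
  positivity

theorem eq_of_sq_eq_of_im_pos {z z' : ℂ} (h : z ^ 2 = z' ^ 2) (hz : 0 < z.im) (hz' : 0 < z'.im) :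
    z = z' := by
  rcases sq_eq_sq_iff_eq_or_eq_neg.1 h with h1 | h1
  · exact h1
  · rw [h1, neg_im] at hz
    linarith

theorem neg_div_sq_mem_slitPlane (hp : 0 < p) (hv : 0 < v) (hz : 0 < z.im) :
    -((v : ℂ) * p) / z ^ 2 ∈ slitPlane := by
  have hn : 0 < normSq (z ^ 2) := normSq_pos.2 (pow_ne_zero 2 (ne_zero_of_im_pos hz))
  have h1 : -((v : ℂ) * p) / z ^ 2 = ((v * p / normSq (z ^ 2) : ℝ) : ℂ) * -conj (z ^ 2) := by
    rw [div_eq_mul_inv, inv_def]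
    push_cast
    ring
  have h2 : 0 < v * p / normSq (z ^ 2) := by positivity
  generalize normSq (z ^ 2) = N at h1 h2
  rw [h1, mem_slitPlane_iff, re_ofReal_mul, im_ofReal_mul]
  simp only [neg_re, conj_re, neg_im, conj_im, sq, mul_re, mul_im]
  by_cases hx : z.re = 0
  · left
    rw [hx]
    have : 0 < z.im * z.im := by positivity
    exact mul_pos h2 (by linarith)
  · right
    refine mul_ne_zero h2.ne' ?_
    have : z.re * z.im ≠ 0 := mul_ne_zero hx hz.ne'
    intro h0
    apply this
    linarith

theorem rootPoint_neg_div_sq (hp : 0 < p) (hv : 0 < v) (hz : 0 < z.im) :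
    rootPoint p v (-((v : ℂ) * p) / z ^ 2) = z := by
  have hu := neg_div_sq_mem_slitPlane hp hv hz
  refine eq_of_sq_eq_of_im_pos ?_ (rootPoint_im_pos hp hv hu) hz
  rw [rootPoint_sq hp hv (slitPlane_ne_zero hu)]
  have hz2 := pow_ne_zero 2 (ne_zero_of_im_pos hz)
  have hvp : (v : ℂ) * p ≠ 0 := mul_ne_zero (ofReal_ne_zero.2 hv.ne') (ofReal_ne_zero.2 hp.ne')
  field_simp
  exact mul_div_cancel_left₀ _ hvp

theorem rootPoint_conj (hu : u ∈ slitPlane) :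
    rootPoint p v (conj u) = -conj (rootPoint p v u) := by
  simp only [rootPoint, log_conj _ (slitPlane_arg_ne_pi hu), map_mul, conj_ofReal, conj_I, ← exp_conj,
    map_div₀, map_neg, map_ofNat]
  ring

theorem differentiableAt_rootPoint (hu : u ∈ slitPlane) :
    DifferentiableAt ℂ (rootPoint p v) u :=
  (((((differentiableAt_id.clog hu).neg).div_const 2).cexp).const_mul I).const_mul _

/-- The symmetry of the problem under reflection in the imaginary axis. -/
theorem IsParam.conj_neg (h : IsParam p a v z w) : IsParam p a v (-conj z) (conj w) where
  ne_zero := (map_ne_zero _).2 h.ne_zero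
  mem := by
    have h1 := h.mem
    rw [mem_slitPlane_iff] at h1 ⊢
    simpa using h1
  eqn := by
    rw [logTsallis_conj h.mem, exp_conj, neg_sq, ← map_pow, ← map_mul, ← map_mul, h.eqn]
    simp [map_ofNat]
  im_pos s hs := by
    have h1 : (s : ℂ) * conj w = conj (s * w) := by simp
    rw [h1, logTsallis_conj (one_add_smul_mem_slitPlane h.mem hs), exp_conj, neg_mul, ← map_mul,
      neg_im, conj_im, neg_neg]
    exact h.im_pos s hs

open Classical in
/-- The Lambert–Tsallis function on the slit plane: the parameter of the point `z` with
`-v p / z² = u`. It exists and is unique there; elsewhere the value is of no importance. -/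
noncomputable def slitBranch (p α v : ℝ) (u : ℂ) : ℂ :=
  if h : ∃ w, IsParam p (1 - α) v (rootPoint p v u) w then h.choose else 0

theorem IsParam.slitBranch_eq (h : IsParam p (1 - α) v (rootPoint p v u) w) (hp : 0 < p)
    (hp1 : p < 1) (hv : 0 < v) (hα : 0 ≤ α) (hpα : p + α * p ≤ 1) : slitBranch p α v u = w := by
  have he : ∃ w, IsParam p (1 - α) v (rootPoint p v u) w := ⟨w, h⟩
  rw [slitBranch, dif_pos he]
  exact he.choose_spec.unique h hp hp1 hv hα hpα

theorem isParam_slitBranch (hp : 0 < p) (hp1 : p < 1) (hv : 0 < v) (hα : 0 ≤ α)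
    (hpα : p + α * p ≤ 1) (hu : u ∈ slitPlane) :
    IsParam p (1 - α) v (rootPoint p v u) (slitBranch p α v u) := by
  have he := exists_isParam hp hp1 hv hα hpα (rootPoint_im_pos hp hv hu)
  rw [slitBranch, dif_pos he]
  exact he.choose_spec

theorem differentiableAt_slitBranch (hp : 0 < p) (hp1 : p < 1) (hv : 0 < v) (hα : 0 ≤ α)
    (hpα : p + α * p ≤ 1) (hu : u ∈ slitPlane) :
    DifferentiableAt ℂ (slitBranch p α v) u := by
  obtain ⟨g, hg, hg'⟩ := (isParam_slitBranch hp hp1 hv hα hpα hu).exists_nhds hp hv hα hpα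
  have hr := differentiableAt_rootPoint (p := p) (v := v) hu
  refine (hg.comp u hr).congr_of_eventuallyEq ?_
  filter_upwards [hr.continuousAt.eventually hg'] with u' hu'
  exact hu'.slitBranch_eq hp hp1 hv hα hpα

theorem slitBranch_conj (hp : 0 < p) (hp1 : p < 1) (hv : 0 < v) (hα : 0 ≤ α)
    (hpα : p + α * p ≤ 1) (hu : u ∈ slitPlane) :
    slitBranch p α v (conj u) = conj (slitBranch p α v u) := by
  have h := (isParam_slitBranch hp hp1 hv hα hpα hu).conj_neg
  rw [← rootPoint_conj hu] at h
  exact h.slitBranch_eq hp hp1 hv hα hpα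

theorem one_add_mul_mem_slitPlane_of_im_ne_zero (a : ℝ) (hw : w.im ≠ 0) :
    1 + a * w ∈ slitPlane := by
  by_cases ha : a = 0
  · simp [ha]
  · rw [mem_slitPlane_iff]
    right
    simp [ha, hw]

/-- `Im log exp_κ(s w)` increases with `s` for `w` in the upper half-plane. -/
theorem monotone_im_logTsallis (a : ℝ) (hw : 0 < w.im) :
    Monotone fun s : ℝ => (logTsallis a (s * w)).im := by
  have hd : ∀ s : ℝ, HasDerivAt (fun s : ℝ => (logTsallis a (s * w)).im)
      (1 / (1 + a * (s * w)) * w).im s := fun s => by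
    have hm : 1 + a * ((s : ℂ) * w) ∈ slitPlane := by
      rw [← mul_assoc, ← ofReal_mul]
      exact one_add_mul_mem_slitPlane_of_im_ne_zero _ hw.ne'
    have h1 : HasDerivAt (fun s : ℝ => (s : ℂ) * w) w s := by
      simpa using (hasDerivAt_id s).ofReal_comp.mul_const w
    exact (imCLM.hasFDerivAt.comp_hasDerivAt s ((hasDerivAt_logTsallis hm).comp s h1))
  refine monotone_of_deriv_nonneg (fun s => (hd s).differentiableAt) fun s => ?_
  rw [(hd s).deriv]
  have : (1 / (1 + a * ((s : ℂ) * w)) * w).im = w.im / normSq (1 + a * (s * w)) := by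
    rw [one_div, mul_im, inv_re, inv_im]
    simp
    ring
  rw [this]
  exact div_nonneg hw.le (normSq_nonneg _)

/-- A solution `w` of `f(w) = u` in the upper half-plane, with `u` there too, is the parameter of
the corresponding `z` as soon as `Im log exp_κ(w) < π`. -/
theorem isParam_of_genTsallis_eq (hp : 0 < p) (hv : 0 < v) (hw : 0 < w.im) (hu : 0 < u.im)
    (hlog : (logTsallis (1 - α) w).im < Real.pi)
    (h : genTsallis (angleParam α) (shapeParam p) w = u) :
    IsParam p (1 - α) v (rootPoint p v u) w := by
  have hmem := one_add_mul_mem_slitPlane_of_im_ne_zero (1 - α) hw.ne'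
  have hu0 := ne_zero_of_im_pos hu
  have hw0 := ne_zero_of_im_pos hw
  have hpC : (p : ℂ) ≠ 0 := ofReal_ne_zero.2 hp.ne'
  have hsq := rootPoint_sq hp hv hu0
  have hγ : 1 + (shapeParam p : ℂ) * w ≠ 0 := fun h0 => by
    rw [genTsallis, h0, div_zero, zero_mul] at h
    exact hu0 h.symm
  have hγp : (p : ℂ) * (1 + (shapeParam p : ℂ) * w) = p + (2 * p - 1) * w := by
    simp only [shapeParam]
    push_cast
    field_simp
  rw [genTsallis, tsallisExp_eq_exp (slitPlane_ne_zero hmem)] at h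
  have heqn : rootPoint p v u ^ 2 * exp (logTsallis (1 - α) w) * w =
      -v * (p + (2 * p - 1) * w) := by
    rw [hsq, ← hγp]
    rw [div_mul_eq_mul_div, div_eq_iff hγ] at h
    field_simp
    linear_combination (-v : ℂ) * h
  set L := (logTsallis (1 - α) w).im with hL
  have hmono := monotone_im_logTsallis (1 - α) hw
  have h0 : (logTsallis (1 - α) (((0 : ℝ) : ℂ) * w)).im = 0 := by simp
  have h1 : (logTsallis (1 - α) (((1 : ℝ) : ℂ) * w)).im = L := by simp [hL]
  have hL0 : 0 ≤ L := by
    have := hmono zero_le_one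
    simp only [h0, h1] at this
    exact this
  have harg0 : 0 < arg u := lt_of_le_of_ne (arg_nonneg_iff.2 hu.le)
    fun h0 => hu.ne' (arg_eq_zero_iff.1 h0.symm).2
  have hargπ : arg u < Real.pi := arg_lt_pi_iff.2 (Or.inr hu.ne')
  -- the imaginary part of `z² exp_κ(w) = -v p / w - v (2 p - 1)` is positive
  have hlt : L < arg u := by
    by_contra hge
    have hge := not_lt.1 hge
    have e1 : rootPoint p v u ^ 2 * exp (logTsallis (1 - α) w) =
        ((-(v * p) : ℝ) : ℂ) * exp (logTsallis (1 - α) w - log u) := by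
      rw [hsq, exp_sub, exp_log hu0]
      push_cast
      ring
    have e2 : rootPoint p v u ^ 2 * exp (logTsallis (1 - α) w) =
        ((-(v * p) : ℝ) : ℂ) * w⁻¹ - ((v * (2 * p - 1) : ℝ) : ℂ) := by
      have e3 := mul_right_cancel₀ hw0 (heqn.trans (by
        push_cast
        field_simp
        ring : -v * (p + (2 * p - 1) * w) =
          (((-(v * p) : ℝ) : ℂ) * w⁻¹ - ((v * (2 * p - 1) : ℝ) : ℂ)) * w))
      exact e3
    have e4 := congrArg im (e1.symm.trans e2)
    rw [im_ofReal_mul, exp_im, sub_im, log_im, ← hL, sub_im, im_ofReal_mul, inv_im, ofReal_im] at e4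
    have e5 : 0 ≤ Real.sin (L - arg u) :=
      Real.sin_nonneg_of_nonneg_of_le_pi (by linarith) (by linarith)
    have e6 : 0 < normSq w := normSq_pos.2 hw0
    have e7 : 0 < v * p * (w.im / normSq w) := by positivity
    have e8 : 0 ≤ v * p * (Real.exp (logTsallis (1 - α) w - log u).re * Real.sin (L - arg u)) := by
      have := Real.exp_pos (logTsallis (1 - α) w - log u).re
      positivity
    rw [neg_div] at e4
    linarith
  refine ⟨hw0, hmem, heqn, fun s hs => ?_⟩
  have hs0 := hmono hs.1
  have hs1 := hmono hs.2
  simp only [h0, h1] at hs0 hs1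
  rw [rootPoint_mul_exp_im]
  have hcos : 0 < Real.cos ((logTsallis (1 - α) (s * w)).im - arg u / 2) :=
    Real.cos_pos_of_mem_Ioo ⟨by linarith, by linarith⟩
  have : 0 < √(v * p) := Real.sqrt_pos.2 (by positivity)
  have := Real.exp_pos ((logTsallis (1 - α) (s * w)).re - (log u).re / 2)
  positivity

end Slit

end VarianceProfile

namespace VarianceProfile

open ComplexConjugate Complex LambertTsallis

/-! ### Continuation across the real line -/

/-- A function which is real on the real line and whose derivative has positive real part maps
points above the real line to points above the real line. -/
theorem im_pos_of_deriv_re_pos {f : ℂ → ℂ} {x r : ℝ}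
    (hd : ∀ w ∈ Metric.ball (x : ℂ) r, DifferentiableAt ℂ f w ∧ 0 < (deriv f w).re)
    (hreal : ∀ t : ℝ, (t : ℂ) ∈ Metric.ball (x : ℂ) r → (f t).im = 0) {w : ℂ}
    (hw : w ∈ Metric.ball (x : ℂ) r) (him : 0 < w.im) : 0 < (f w).im := by
  have hmem : ∀ y ∈ Icc 0 w.im, (w.re + y * I : ℂ) ∈ Metric.ball (x : ℂ) r := fun y hy => by
    rw [Metric.mem_ball, dist_eq_norm] at hw ⊢
    refine lt_of_le_of_lt ?_ hw
    rw [Complex.norm_def, Complex.norm_def]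
    refine Real.sqrt_le_sqrt ?_
    simp only [normSq_apply, sub_re, add_re, ofReal_re, mul_re, I_re, mul_zero, ofReal_im, I_im,
      mul_one, sub_self, add_zero, sub_im, add_im, mul_im, zero_add, sub_zero]
    nlinarith [hy.1, hy.2]
  have hder : ∀ y ∈ Icc 0 w.im, HasDerivAt (fun y : ℝ => (f (w.re + y * I)).im)
      (deriv f (w.re + y * I)).re y := fun y hy => by
    have h1 : HasDerivAt (fun y : ℝ => (w.re + y * I : ℂ)) I y := by
      simpa using ((hasDerivAt_id y).ofReal_comp.mul_const I).const_add (w.re : ℂ)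
    have h2 := imCLM.hasFDerivAt.comp_hasDerivAt y ((hd _ (hmem y hy)).1.hasDerivAt.comp y h1)
    refine h2.congr_deriv ?_
    simp
  have hmono : StrictMonoOn (fun y : ℝ => (f (w.re + y * I)).im) (Icc 0 w.im) := by
    refine strictMonoOn_of_deriv_pos (convex_Icc _ _)
      (fun y hy => (hder y hy).continuousAt.continuousWithinAt) fun y hy => ?_
    rw [interior_Icc] at hy
    rw [(hder y (Ioo_subset_Icc_self hy)).deriv]
    exact (hd _ (hmem y (Ioo_subset_Icc_self hy))).2
  have h := hmono (left_mem_Icc.2 him.le) (right_mem_Icc.2 him.le) him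
  have h0 := hmem 0 (left_mem_Icc.2 him.le)
  simp only [ofReal_zero, zero_mul, add_zero] at h h0
  rw [hreal _ h0, re_add_im] at h
  exact h

section Glue

variable {p α v : ℝ} {x : ℝ}

theorem genTsallis_ofReal_im (hx : (x : ℂ) ∈ expDomain (angleParam α)) :
    (genTsallis (angleParam α) (shapeParam p) x).im = 0 := by
  have h := genTsallis_conj (p := p) hx
  rw [conj_ofReal] at h
  exact conj_eq_iff_im.1 h.symm

theorem one_add_mul_ofReal (a x : ℝ) : (1 : ℂ) + (a : ℂ) * x = ((1 + a * x : ℝ) : ℂ) := by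
  push_cast; ring

theorem one_add_mul_ofReal_mem {a x : ℝ} : (1 : ℂ) + (a : ℂ) * x ∈ slitPlane ↔ 0 < 1 + a * x := by
  rw [one_add_mul_ofReal, ofReal_mem_slitPlane]

/-- The sign of `f'` at a real point is that of `1 + a x + x (1 + γ x)`. -/
theorem deriv_genTsallis_ofReal (hx : (x : ℂ) ∈ expDomain (angleParam α))
    (hx1 : 1 + shapeParam p * x ≠ 0)
    (hQ : 0 < 1 + (1 - α) * x + x * (1 + shapeParam p * x)) :
    ∃ d : ℝ, 0 < d ∧ deriv (genTsallis (angleParam α) (shapeParam p)) x = d := by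
  have hx1' : (1 : ℂ) + (shapeParam p : ℂ) * x ≠ 0 := by
    rw [one_add_mul_ofReal]
    exact ofReal_ne_zero.2 hx1
  obtain ⟨T, hT, hT'⟩ := hasDerivAt_genTsallis hx hx1'
  obtain ⟨τ, hτ, rfl⟩ : ∃ τ : ℝ, 0 < τ ∧ T = τ := by
    rcases hT' with ⟨-, rfl⟩ | ⟨hm, rfl⟩
    · exact ⟨1, one_pos, by simp⟩
    · have hm' := one_add_mul_ofReal_mem.1 hm
      obtain ⟨E, hE, hE'⟩ := exp_logTsallis_ofReal hm'
      refine ⟨E / (1 + (1 - α) * x), by positivity, ?_⟩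
      rw [hE', one_add_mul_ofReal, ofReal_div]
  refine ⟨τ * (1 + (1 - α) * x + x * (1 + shapeParam p * x)) / (1 + shapeParam p * x) ^ 2,
    by positivity, ?_⟩
  rw [hT.deriv]
  push_cast
  rfl

/-- For `κ = 1` the real points of the domain include those with `1 + x ≤ 0`, where
`Im log exp_κ(w)` tends to `π` but does not reach it. -/
theorem eventually_im_logTsallis_lt_pi (hx : (x : ℂ) ∈ expDomain (angleParam α)) :
    ∀ᶠ w in 𝓝 (x : ℂ), 0 < w.im → (logTsallis (1 - α) w).im < Real.pi := by
  rcases mem_expDomain_iff.1 hx with hα | hm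
  · subst hα
    refine Eventually.of_forall fun w hw => ?_
    simp only [logTsallis, sub_zero, one_ne_zero, if_false, ofReal_one, one_mul, div_one, log_im]
    exact arg_lt_pi_iff.2 (Or.inr (by simpa using hw.ne'))
  · have h1 : (logTsallis (1 - α) x).im = 0 := by
      have h := logTsallis_conj hm
      rw [conj_ofReal] at h
      exact conj_eq_iff_im.1 h.symm
    have hc : ContinuousAt (fun w => (logTsallis (1 - α) w).im) (x : ℂ) :=
      continuous_im.continuousAt.comp (hasDerivAt_logTsallis hm).continuousAt
    have h2 : ∀ᶠ w in 𝓝 (x : ℂ), (logTsallis (1 - α) w).im < Real.pi :=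
      hc.eventually (gt_mem_nhds (by simp only [h1]; exact Real.pi_pos))
    exact h2.mono fun w hw _ => hw

/-- Near the value of `f` at a real point with `f' > 0`, the local inverse of `f` agrees with the
branch on the slit plane away from the real line. -/
theorem exists_local_inverse_eq_slitBranch (hp : 0 < p) (hp1 : p < 1) (hv : 0 < v) (hα : 0 ≤ α)
    (hpα : p + α * p ≤ 1) (hx : (x : ℂ) ∈ expDomain (angleParam α))
    (hx1 : 1 + shapeParam p * x ≠ 0)
    (hQ : 0 < 1 + (1 - α) * x + x * (1 + shapeParam p * x)) {u₀ : ℂ}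
    (hu₀ : genTsallis (angleParam α) (shapeParam p) x = u₀) :
    ∃ g : ℂ → ℂ, DifferentiableAt ℂ g u₀ ∧ g u₀ = x ∧
      (∀ᶠ u in 𝓝 u₀, genTsallis (angleParam α) (shapeParam p) (g u) = u) ∧
      (∀ᶠ u in 𝓝 u₀, ContinuousAt g u) ∧
      ∀ᶠ u in 𝓝 u₀, u.im ≠ 0 → slitBranch p α v u = g u := by
  subst hu₀
  set f := genTsallis (angleParam α) (shapeParam p) with hf
  set U := {w : ℂ | w ∈ expDomain (angleParam α) ∧ 1 + (shapeParam p : ℂ) * w ≠ 0} with hU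
  have hUo : IsOpen U := isOpen_regular
  have hxU : (x : ℂ) ∈ U := ⟨hx, by rw [one_add_mul_ofReal]; exact ofReal_ne_zero.2 hx1⟩
  have hdiff : DifferentiableOn ℂ f U := differentiableOn_genTsallis
  have han := hdiff.analyticAt (hUo.mem_nhds hxU)
  obtain ⟨d, hd0, hd⟩ := deriv_genTsallis_ofReal hx hx1 hQ
  obtain ⟨g, hg1, hg2, hg3, hg4, hg5⟩ := exists_local_inverse han
    (by rw [hd]; exact ofReal_ne_zero.2 hd0.ne')
  refine ⟨g, hg1, hg2, hg3, hg5, ?_⟩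
  have hre : ∀ᶠ w in 𝓝 (x : ℂ), w ∈ U ∧ 0 < (deriv f w).re := by
    have hc : ContinuousAt (fun w => (deriv f w).re) (x : ℂ) :=
      continuous_re.continuousAt.comp han.deriv.continuousAt
    exact Eventually.and (hUo.mem_nhds hxU)
      (hc.eventually (lt_mem_nhds (by simp only [hf, hd]; exact hd0)))
  obtain ⟨r, hr, hball⟩ := Metric.eventually_nhds_iff_ball.1 hre
  have hup : ∀ w ∈ Metric.ball (x : ℂ) r, 0 < w.im → 0 < (f w).im := fun w hw him =>
    im_pos_of_deriv_re_pos (fun w hw => ⟨hdiff.differentiableAt (hUo.mem_nhds (hball w hw).1),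
      (hball w hw).2⟩) (fun t ht => genTsallis_ofReal_im (hball _ ht).1.1) hw him
  have hsign : ∀ w ∈ Metric.ball (x : ℂ) r, 0 < (f w).im → 0 < w.im := fun w hw him => by
    by_contra hneg
    rcases (not_lt.1 hneg).lt_or_eq with h1 | h1
    · have hcw : conj w ∈ Metric.ball (x : ℂ) r := by
        rw [Metric.mem_ball, dist_eq_norm] at hw ⊢
        rwa [← conj_ofReal x, ← map_sub, Complex.norm_conj]
      have h2 := hup (conj w) hcw (by rw [conj_im]; linarith)
      rw [hf, genTsallis_conj (hball w hw).1.1, conj_im, ← hf] at h2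
      linarith
    · have hwr : w = (w.re : ℂ) := by apply Complex.ext <;> simp [h1]
      have h2 := (hball w hw).1.1
      rw [hwr] at h2 him
      rw [hf, genTsallis_ofReal_im h2] at him
      exact lt_irrefl _ him
  have hN : ∀ᶠ w in 𝓝 (x : ℂ), w ∈ Metric.ball (x : ℂ) r ∧ g (f w) = w ∧
      (0 < w.im → (logTsallis (1 - α) w).im < Real.pi) :=
    Eventually.and (Metric.ball_mem_nhds _ hr) (hg4.and (eventually_im_logTsallis_lt_pi hx))
  have hgt : Tendsto g (𝓝 (f x)) (𝓝 (x : ℂ)) := by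
    have := hg1.continuousAt.tendsto
    rwa [hg2] at this
  have hconj : Tendsto (conj : ℂ → ℂ) (𝓝 (f x)) (𝓝 (f x)) := by
    have h1 := (continuous_conj.tendsto (f x))
    rwa [conj_eq_iff_im.2 (genTsallis_ofReal_im hx)] at h1
  have hconjx : Tendsto (conj : ℂ → ℂ) (𝓝 (x : ℂ)) (𝓝 (x : ℂ)) := by
    have h1 := (continuous_conj.tendsto (x : ℂ))
    rwa [conj_ofReal] at h1
  -- above the real line `g u` satisfies the defining conditions of the parameter; below it, the
  -- claim follows by conjugation
  have hplus : ∀ᶠ u in 𝓝 (f x), 0 < u.im → slitBranch p α v u = g u := by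
    filter_upwards [hgt.eventually hN, hg3] with u hu1 hu2 hu3
    have h1 := hsign (g u) hu1.1 (by rw [hu2]; exact hu3)
    exact (isParam_of_genTsallis_eq hp hv h1 hu3 (hu1.2.2 h1) hu2).slitBranch_eq hp hp1 hv hα hpα
  filter_upwards [hplus, hconj.eventually hplus, (hgt.comp hconj).eventually hN,
    (hconjx.comp (hgt.comp hconj)).eventually hN, hconj.eventually hg3] with u h1 h2 h3 h4 h5 h6
  simp only [Function.comp] at h3 h4
  rcases h6.lt_or_gt with h7 | h7
  · have h8 := h2 (by rw [conj_im]; linarith)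
    have h9 : conj u ∈ slitPlane := mem_slitPlane_iff.2 (Or.inr (by simpa using h6))
    have h10 := slitBranch_conj hp hp1 hv hα hpα h9
    rw [conj_conj, h8] at h10
    have h11 : f (conj (g (conj u))) = u := by
      rw [hf, genTsallis_conj (hball _ h3.1).1.1, ← hf, h5, conj_conj]
    have h12 := h4.2.1
    rw [h11] at h12
    rw [h10, h12]
  · exact h1 h7

/-- The Lambert–Tsallis function on the main domain: the branch on the slit plane, continued to
the negative real axis by limits from the upper half-plane. Where no such limit exists the value is
arbitrary; this does not happen on the main domain. -/
noncomputable def mainBranch (p α v : ℝ) (u : ℂ) : ℂ :=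
  open Classical in
  if u ∈ slitPlane then slitBranch p α v u
  else limUnder (𝓝[>] (0 : ℝ)) fun ε => slitBranch p α v (u + ε * I)

/-- Near the value of `f` at a real point with `f' > 0`, `mainBranch` is the local inverse of `f`. -/
theorem mainBranch_eventuallyEq (hp : 0 < p) (hp1 : p < 1) (hv : 0 < v) (hα : 0 ≤ α)
    (hpα : p + α * p ≤ 1) (hx : (x : ℂ) ∈ expDomain (angleParam α))
    (hx1 : 1 + shapeParam p * x ≠ 0)
    (hQ : 0 < 1 + (1 - α) * x + x * (1 + shapeParam p * x)) {u₀ : ℂ}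
    (hu₀ : genTsallis (angleParam α) (shapeParam p) x = u₀) :
    DifferentiableAt ℂ (mainBranch p α v) u₀ ∧ mainBranch p α v u₀ = x ∧
      ∀ᶠ u in 𝓝 u₀, genTsallis (angleParam α) (shapeParam p) (mainBranch p α v u) = u := by
  obtain ⟨g, hg1, hg2, hg3, hg4, hg5⟩ :=
    exists_local_inverse_eq_slitBranch hp hp1 hv hα hpα hx hx1 hQ hu₀
  have heq : mainBranch p α v =ᶠ[𝓝 u₀] g := by
    filter_upwards [hg4, hg5.eventually_nhds] with u hc he
    by_cases him : u.im = 0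
    · have ht : Tendsto (fun ε : ℝ => u + ε * I) (𝓝[>] (0 : ℝ)) (𝓝 u) := by
        have : Continuous fun ε : ℝ => u + ε * I := by fun_prop
        have h1 := this.tendsto 0
        simp only [ofReal_zero, zero_mul, add_zero] at h1
        exact h1.mono_left nhdsWithin_le_nhds
      have hs : Tendsto (fun ε : ℝ => slitBranch p α v (u + ε * I)) (𝓝[>] (0 : ℝ)) (𝓝 (g u)) := by
        refine (hc.tendsto.comp ht).congr' ?_
        filter_upwards [ht.eventually he, self_mem_nhdsWithin] with ε h1 h2
        refine (h1 ?_).symm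
        simpa [him] using (ne_of_gt h2 : ε ≠ 0)
      by_cases hu : u ∈ slitPlane
      · rw [mainBranch, if_pos hu]
        exact tendsto_nhds_unique ((differentiableAt_slitBranch hp hp1 hv hα hpα
          hu).continuousAt.tendsto.comp ht) hs
      · rw [mainBranch, if_neg hu]
        exact hs.limUnder_eq
    · rw [mainBranch, if_pos (mem_slitPlane_iff.2 (Or.inr him))]
      exact he.self_of_nhds him
  refine ⟨hg1.congr_of_eventuallyEq heq, heq.self_of_nhds.trans hg2, ?_⟩
  filter_upwards [heq, hg3] with u h1 h2
  rw [h1, h2]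

end Glue

end VarianceProfile

namespace LambertTsallis

/-! ### The generalized Tsallis function on the real line -/

/-- The real Tsallis exponential with `κ = 1/a`, for `1 + a x > 0`; `a = 0` stands for `κ = ∞`. -/
noncomputable def realTsallisExp (a x : ℝ) : ℝ :=
  Real.exp (if a = 0 then x else Real.log (1 + a * x) / a)

/-- The real function `f_{κ,γ}` with `κ = 1/a`. -/
noncomputable def realGenTsallis (a γ x : ℝ) : ℝ := x / (1 + γ * x) * realTsallisExp a x

variable {a γ x : ℝ}

theorem realTsallisExp_pos (a x : ℝ) : 0 < realTsallisExp a x := Real.exp_pos _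

theorem hasDerivAt_realTsallisExp (hx : 0 < 1 + a * x) :
    HasDerivAt (realTsallisExp a) (realTsallisExp a x / (1 + a * x)) x := by
  by_cases ha : a = 0
  · subst ha
    have : realTsallisExp 0 = Real.exp := by
      funext x
      simp [realTsallisExp]
    rw [this]
    simpa using Real.hasDerivAt_exp x
  · have : realTsallisExp a = fun x => Real.exp (Real.log (1 + a * x) / a) := by
      funext x
      simp [realTsallisExp, ha]
    rw [this]
    refine (((((hasDerivAt_id' x).const_mul a).const_add 1).log hx.ne').div_const a).exp.congr_deriv ?_
    field_simp

theorem hasDerivAt_realGenTsallis (hx : 0 < 1 + a * x) (hx1 : 1 + γ * x ≠ 0) :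
    HasDerivAt (realGenTsallis a γ) (realTsallisExp a x / ((1 + a * x) * (1 + γ * x) ^ 2) *
      (1 + a * x + x * (1 + γ * x))) x := by
  have h1 : HasDerivAt (fun x => x / (1 + γ * x)) (1 / (1 + γ * x) ^ 2) x := by
    refine ((hasDerivAt_id' x).div
      (((hasDerivAt_id' x).const_mul γ).const_add 1) hx1).congr_deriv ?_
    congr 1
    ring
  refine (h1.mul (hasDerivAt_realTsallisExp hx)).congr_deriv ?_
  have := hx.ne'
  generalize realTsallisExp a x = E
  generalize 1 + a * x = A at this ⊢
  field_simp

theorem one_le_realTsallisExp (ha : 0 < 1 + a * x) (hx : 0 ≤ x) : 1 ≤ realTsallisExp a x := by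
  rw [realTsallisExp, Real.one_le_exp_iff]
  split_ifs with h
  · exact hx
  · rcases lt_or_gt_of_ne h with h1 | h1
    · exact div_nonneg_of_nonpos
        (Real.log_nonpos ha.le (by linarith [mul_nonpos_of_nonpos_of_nonneg h1.le hx])) h1.le
    · exact div_nonneg (Real.log_nonneg (by linarith [mul_nonneg h1.le hx])) h1.le

theorem one_add_le_realTsallisExp (ha0 : 0 ≤ a) (ha1 : a ≤ 1) (hx : 0 ≤ x) :
    1 + x ≤ realTsallisExp a x := by
  rw [realTsallisExp]
  split_ifs with h
  · linarith [Real.add_one_le_exp x]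
  · have ha : 0 < a := lt_of_le_of_ne ha0 (Ne.symm h)
    have h1 := one_add_mul_self_le_rpow_one_add (s := a * x)
      (by linarith [mul_nonneg ha0 hx]) (p := 1 / a) (by rwa [le_div_iff₀ ha, one_mul])
    rw [Real.rpow_def_of_pos (by linarith [mul_nonneg ha0 hx])] at h1
    have h2 : 1 / a * (a * x) = x := by field_simp
    rwa [h2, mul_one_div] at h1

theorem strictMono_realTsallisExp {y : ℝ} (hx : 0 < 1 + a * x) (hy : 0 < 1 + a * y) (hxy : x < y) :
    realTsallisExp a x < realTsallisExp a y := by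
  rw [realTsallisExp, realTsallisExp, Real.exp_lt_exp]
  split_ifs with h
  · exact hxy
  · rcases lt_or_gt_of_ne h with h1 | h1
    · rw [div_lt_div_right_of_neg h1]
      exact Real.log_lt_log hy (by linarith [mul_lt_mul_of_neg_left hxy h1])
    · rw [div_lt_div_iff_of_pos_right h1]
      exact Real.log_lt_log hx (by linarith [mul_lt_mul_of_pos_left hxy h1])

theorem convex_affine_pos (b : ℝ) : Convex ℝ {x : ℝ | 0 < 1 + b * x} := by
  intro x hx y hy s t hs ht hst
  simp only [mem_ofPred_eq, smul_eq_mul] at hx hy ⊢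
  have : 1 + b * (s * x + t * y) = s * (1 + b * x) + t * (1 + b * y) := by
    linear_combination -hst
  rw [this]
  rcases hs.eq_or_lt with rfl | hs'
  · rw [zero_add] at hst
    subst hst
    linarith
  · have := mul_pos hs' hx
    have := mul_nonneg ht hy.le
    linarith

theorem convex_affine_neg (b : ℝ) : Convex ℝ {x : ℝ | 1 + b * x < 0} := by
  intro x hx y hy s t hs ht hst
  simp only [mem_ofPred_eq, smul_eq_mul] at hx hy ⊢
  have : 1 + b * (s * x + t * y) = s * (1 + b * x) + t * (1 + b * y) := by
    linear_combination -hst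
  rw [this]
  rcases hs.eq_or_lt with rfl | hs'
  · rw [zero_add] at hst
    subst hst
    linarith
  · have := mul_neg_of_pos_of_neg hs' hx
    have := mul_nonpos_of_nonneg_of_nonpos ht hy.le
    linarith

/-- On a convex part of the domain, `f` has the monotonicity given by the sign of
`1 + a x + x (1 + γ x)`. -/
theorem monotoneOn_realGenTsallis {D : Set ℝ} (hD : Convex ℝ D)
    (h1 : ∀ x ∈ D, 0 < 1 + a * x) (h2 : ∀ x ∈ D, 1 + γ * x ≠ 0)
    (h3 : ∀ x ∈ D, 0 ≤ 1 + a * x + x * (1 + γ * x)) : MonotoneOn (realGenTsallis a γ) D := by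
  have hd := fun x hx => hasDerivAt_realGenTsallis (h1 x hx) (h2 x hx)
  refine monotoneOn_of_deriv_nonneg hD
    (fun x hx => (hd x hx).continuousAt.continuousWithinAt)
    (fun x hx => (hd x (interior_subset hx)).differentiableAt.differentiableWithinAt) fun x hx => ?_
  have hx' := interior_subset hx
  rw [(hd x hx').deriv]
  have := h1 x hx'
  have := (realTsallisExp_pos a x).le
  exact mul_nonneg (by positivity) (h3 x hx')

theorem antitoneOn_realGenTsallis {D : Set ℝ} (hD : Convex ℝ D)
    (h1 : ∀ x ∈ D, 0 < 1 + a * x) (h2 : ∀ x ∈ D, 1 + γ * x ≠ 0)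
    (h3 : ∀ x ∈ D, 1 + a * x + x * (1 + γ * x) ≤ 0) : AntitoneOn (realGenTsallis a γ) D := by
  have hd := fun x hx => hasDerivAt_realGenTsallis (h1 x hx) (h2 x hx)
  refine antitoneOn_of_deriv_nonpos hD
    (fun x hx => (hd x hx).continuousAt.continuousWithinAt)
    (fun x hx => (hd x (interior_subset hx)).differentiableAt.differentiableWithinAt) fun x hx => ?_
  have hx' := interior_subset hx
  rw [(hd x hx').deriv]
  have := h1 x hx'
  have := (realTsallisExp_pos a x).le
  exact mul_nonpos_of_nonneg_of_nonpos (by positivity) (h3 x hx')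

theorem continuousOn_realGenTsallis {D : Set ℝ} (h1 : ∀ x ∈ D, 0 < 1 + a * x)
    (h2 : ∀ x ∈ D, 1 + γ * x ≠ 0) : ContinuousOn (realGenTsallis a γ) D := fun x hx =>
  (hasDerivAt_realGenTsallis (h1 x hx) (h2 x hx)).continuousAt.continuousWithinAt

/-- Nonnegative numbers are values of `f` between `0` and the pole (or `∞`). For `γ < 0` one has
`f(x) ≥ x / (1 + γ x)`, for `γ ≥ 0` one has `f(x) ≥ x`. -/
theorem exists_realGenTsallis_eq_of_nonneg (ha1 : a ≤ 1) (hγa : γ ≤ a) (hγ1 : γ < 1) {u : ℝ}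
    (hu : 0 ≤ u) :
    ∃ x, 0 < 1 + a * x ∧ 1 + γ * x ≠ 0 ∧ realGenTsallis a γ x = u := by
  obtain ⟨y, hy0, hyγ, hyu⟩ : ∃ y, 0 ≤ y ∧ 0 < 1 + γ * y ∧ u ≤ realGenTsallis a γ y := by
    rcases le_or_gt 0 γ with hγ | hγ
    · refine ⟨u, hu, by linarith [mul_nonneg hγ hu], ?_⟩
      have h1 : 0 < 1 + γ * u := by linarith [mul_nonneg hγ hu]
      have h2 := one_add_le_realTsallisExp (hγ.trans hγa) ha1 hu
      rw [realGenTsallis, div_mul_eq_mul_div, le_div_iff₀ h1]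
      refine mul_le_mul_of_nonneg_left (le_trans ?_ h2) hu
      linarith [mul_le_mul_of_nonneg_right hγ1.le hu]
    · have h0 : 0 < 1 - γ * u := by linarith [mul_nonpos_of_nonpos_of_nonneg hγ.le hu]
      have h1 : 1 + γ * (u / (1 - γ * u)) = 1 / (1 - γ * u) := by
        field_simp
        ring
      have h2 : 0 ≤ u / (1 - γ * u) := div_nonneg hu h0.le
      have h3 : 0 < 1 + γ * (u / (1 - γ * u)) := by rw [h1]; positivity
      refine ⟨u / (1 - γ * u), h2, h3, ?_⟩
      have h4 : 0 < 1 + a * (u / (1 - γ * u)) := by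
        linarith [mul_le_mul_of_nonneg_right hγa h2]
      have h5 : u / (1 - γ * u) / (1 + γ * (u / (1 - γ * u))) = u := by
        rw [h1, one_div, div_inv_eq_mul, div_mul_cancel₀ _ h0.ne']
      rw [realGenTsallis, h5]
      exact le_mul_of_one_le_right hu (one_le_realTsallisExp h4 h2)
  have hγ : ∀ x ∈ Icc 0 y, 0 < 1 + γ * x := fun x hx =>
    (convex_affine_pos γ).ordConnected.out (by simp) hyγ hx
  have ha : ∀ x ∈ Icc 0 y, 0 < 1 + a * x := fun x hx => by
    linarith [hγ x hx, mul_le_mul_of_nonneg_right hγa hx.1]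
  have h0 : realGenTsallis a γ 0 = 0 := by simp [realGenTsallis]
  obtain ⟨x, hx, hxu⟩ := intermediate_value_Icc hy0
    (continuousOn_realGenTsallis ha fun x hx => (hγ x hx).ne') ⟨by rw [h0]; exact hu, hyu⟩
  exact ⟨x, ha x hx, (hγ x hx).ne', hxu⟩

section Critical

variable {s t : ℝ}

/-- The critical points of `f` are `-1/s` and `1/t`, where `s` and `-t` are the roots of
`X² - (1 + a) X + γ`. -/
theorem numerator_eq (hst : s - t = 1 + a) (hst' : s * t = -γ) (x : ℝ) :
    1 + a * x + x * (1 + γ * x) = (1 + s * x) * (1 - t * x) := by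
  linear_combination -x * hst + x ^ 2 * hst'

/-- On the component of the real domain that contains `0`, only `-1/s` is a critical point. -/
theorem one_sub_mul_pos (hst : s - t = 1 + a) (hst' : s * t = -γ) (hs : 1 ≤ s)
    (ha : 0 < 1 + a * x) (hγ : 0 < 1 + γ * x) : 0 < 1 - t * x := by
  rcases le_or_gt t 0 with ht | ht
  · rcases le_or_gt 0 x with hx | hx
    · linarith [mul_nonpos_of_nonpos_of_nonneg ht hx]
    · have : -a ≤ t := by linarith
      nlinarith
  · rcases le_or_gt 0 x with hx | hx
    · have h1 : t * x ≤ s * (t * x) := le_mul_of_one_le_left (mul_nonneg ht.le hx) hs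
      have h2 : γ = -(s * t) := by linarith
      rw [h2] at hγ
      linarith
    · linarith [mul_neg_of_pos_of_neg ht hx]

/-- The minimum of `f` on the component of its real domain that contains `0`. -/
theorem critical_le (hst : s - t = 1 + a) (hst' : s * t = -γ) (hs : 1 ≤ s) (ht : 0 < 1 + t)
    (ha : 0 < 1 + a * x) (hγ : 0 < 1 + γ * x) :
    realGenTsallis a γ (-1 / s) ≤ realGenTsallis a γ x := by
  have hs0 : 0 < s := by linarith
  have e1 : 1 + a * (-1 / s) = (1 + t) / s := by field_simp; linarith
  have e2 : 1 + γ * (-1 / s) = 1 + t := by field_simp; linarith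
  have h1 : 0 < 1 + a * (-1 / s) := by rw [e1]; positivity
  have h2 : 0 < 1 + γ * (-1 / s) := by rw [e2]; exact ht
  have hsx : ∀ y, -1 / s ≤ y ↔ 0 ≤ 1 + s * y := fun y => by
    rw [div_le_iff₀ hs0]
    constructor <;> intro h <;> linarith
  have hsx' : ∀ y, y ≤ -1 / s ↔ 1 + s * y ≤ 0 := fun y => by
    rw [le_div_iff₀ hs0]
    constructor <;> intro h <;> linarith
  rcases le_total (-1 / s) x with hx | hx
  · refine monotoneOn_realGenTsallis
      (((convex_affine_pos a).inter (convex_affine_pos γ)).inter (convex_Ici (-1 / s)))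
      (fun y hy => hy.1.1) (fun y hy => hy.1.2.ne') (fun y hy => ?_) ⟨⟨h1, h2⟩, self_mem_Ici⟩
      ⟨⟨ha, hγ⟩, hx⟩ hx
    rw [numerator_eq hst hst']
    exact mul_nonneg ((hsx y).1 hy.2) (one_sub_mul_pos hst hst' hs hy.1.1 hy.1.2).le
  · refine antitoneOn_realGenTsallis
      (((convex_affine_pos a).inter (convex_affine_pos γ)).inter (convex_Iic (-1 / s)))
      (fun y hy => hy.1.1) (fun y hy => hy.1.2.ne') (fun y hy => ?_) ⟨⟨ha, hγ⟩, hx⟩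
      ⟨⟨h1, h2⟩, self_mem_Iic⟩ hx
    rw [numerator_eq hst hst']
    exact mul_nonpos_of_nonpos_of_nonneg ((hsx' y).1 hy.2)
      (one_sub_mul_pos hst hst' hs hy.1.1 hy.1.2).le

/-- The real domain has a component on the far side of the pole only if the pole `-1/γ` is
positive. -/
theorem pos_of_one_add_mul_neg (hγa : γ ≤ a) (ha : 0 < 1 + a * x) (hγ : 1 + γ * x < 0) :
    0 < x ∧ γ < 0 := by
  have hx : 0 < x := by
    by_contra hneg
    linarith [mul_le_mul_of_nonpos_right hγa (not_lt.1 hneg)]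
  refine ⟨hx, ?_⟩
  by_contra hneg
  linarith [mul_nonneg (not_lt.1 hneg) hx.le]

/-- The maximum of `f` on the component of its real domain beyond the pole. -/
theorem le_critical (hγa : γ ≤ a) (hst : s - t = 1 + a) (hst' : s * t = -γ) (hs : 1 < s)
    (ht : 0 < t) (hta : 0 < t + a) (ha : 0 < 1 + a * x) (hγ : 1 + γ * x < 0) :
    realGenTsallis a γ x ≤ realGenTsallis a γ (1 / t) := by
  have hs0 : 0 < s := by linarith
  have e1 : 1 + a * (1 / t) = (t + a) / t := by field_simp
  have e2 : 1 + γ * (1 / t) = 1 - s := by field_simp; linarith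
  have h1 : 0 < 1 + a * (1 / t) := by rw [e1]; positivity
  have h2 : 1 + γ * (1 / t) < 0 := by rw [e2]; linarith
  have hpos : ∀ y, 0 < 1 + a * y → 1 + γ * y < 0 → 0 < 1 + s * y := fun y hy1 hy2 => by
    have := mul_pos hs0 (pos_of_one_add_mul_neg hγa hy1 hy2).1
    linarith
  rcases le_total x (1 / t) with hx | hx
  · refine monotoneOn_realGenTsallis
      (((convex_affine_pos a).inter (convex_affine_neg γ)).inter (convex_Iic (1 / t)))
      (fun y hy => hy.1.1) (fun y hy => hy.1.2.ne) (fun y hy => ?_) ⟨⟨ha, hγ⟩, hx⟩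
      ⟨⟨h1, h2⟩, self_mem_Iic⟩ hx
    rw [numerator_eq hst hst']
    have h3 := (le_div_iff₀ ht).1 hy.2
    exact mul_nonneg (hpos y hy.1.1 hy.1.2).le (by linarith)
  · refine antitoneOn_realGenTsallis
      (((convex_affine_pos a).inter (convex_affine_neg γ)).inter (convex_Ici (1 / t)))
      (fun y hy => hy.1.1) (fun y hy => hy.1.2.ne) (fun y hy => ?_) ⟨⟨h1, h2⟩, self_mem_Ici⟩
      ⟨⟨ha, hγ⟩, hx⟩ hx
    rw [numerator_eq hst hst']
    have h3 := (div_le_iff₀ ht).1 hy.2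
    exact mul_nonpos_of_nonneg_of_nonpos (hpos y hy.1.1 hy.1.2).le (by linarith)

/-- Between the maximum of `f` beyond the pole and its minimum on the component of `0` there is a gap,
which `f` omits. -/
theorem critical_lt_critical (hst : s - t = 1 + a) (hst' : s * t = -γ) (hs : 1 < s)
    (ht : 0 < t) (hta : 0 < t + a) :
    realGenTsallis a γ (1 / t) < realGenTsallis a γ (-1 / s) := by
  have hs0 : 0 < s := by linarith
  have e0 : 1 + a * (-1 / s) = (1 + t) / s := by field_simp; linarith
  have e1 : 1 + a * (1 / t) = (t + a) / t := by field_simp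
  have e2 : 1 + γ * (1 / t) = 1 - s := by field_simp; linarith
  have e3 : 1 + γ * (-1 / s) = 1 + t := by field_simp; linarith
  have hlt : -1 / s < 1 / t :=
    (div_neg_of_neg_of_pos (by norm_num) hs0).trans (by positivity)
  have hE := strictMono_realTsallisExp (a := a) (by rw [e0]; positivity) (by rw [e1]; positivity) hlt
  have hE0 := realTsallisExp_pos a (-1 / s)
  have hs1 : 0 < s - 1 := by linarith
  have f1 : realGenTsallis a γ (1 / t) = -(realTsallisExp a (1 / t) / (t * (s - 1))) := by
    rw [realGenTsallis, e2]
    have : 1 - s = -(s - 1) := by ring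
    rw [this]
    field_simp
  have f2 : realGenTsallis a γ (-1 / s) = -(realTsallisExp a (-1 / s) / (s * (1 + t))) := by
    rw [realGenTsallis, e3]
    field_simp
  rw [f1, f2, neg_lt_neg_iff]
  refine div_lt_div₀ hE ?_ (realTsallisExp_pos _ _).le (by positivity)
  nlinarith

end Critical

end LambertTsallis

namespace LambertTsallis

/-! ### Real values off the closure of the omitted set -/

section Regular

variable {a γ u : ℝ}

/-- Every value `u` below the maximum of `f` beyond the pole is taken between the pole and the
maximum point `1 / t`. -/
theorem exists_realGenTsallis_eq_of_lt {s t : ℝ} (hγa : γ < a) (hst : s * t = -γ)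
    (hs : 1 < s) (ht : 0 < t) (hta : 0 < t + a) (hu : u < 0) (h : u < realGenTsallis a γ (1 / t)) :
    ∃ x, 0 < 1 + a * x ∧ 1 + γ * x < 0 ∧ x < 1 / t ∧ realGenTsallis a γ x = u := by
  have hγ : γ < 0 := by linarith [mul_pos (by linarith : 0 < s) ht]
  have e1 : 1 + a * (1 / t) = (t + a) / t := by field_simp
  have e2 : 1 + γ * (1 / t) = 1 - s := by field_simp; linarith
  have ht1 : 0 < 1 + a * (1 / t) := by rw [e1]; positivity
  have hpole : 0 < 1 + a * (-1 / γ) := by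
    have : 1 + a * (-1 / γ) = (γ - a) / γ := by
      rw [sub_div, div_self hγ.ne]
      ring
    rw [this]
    exact div_pos_of_neg_of_neg (by linarith) hγ
  set E := realTsallisExp a (-1 / γ) with hE
  have hE0 : 0 < E := realTsallisExp_pos _ _
  have hγu : 0 < γ * u := mul_pos_of_neg_of_neg hγ hu
  -- the point where `1 + γ x = -δ`, at which `f` is at most `E / (γ δ) ≤ u`
  set δ := min (E / (γ * u)) (s - 1) with hδ
  have hδ0 : 0 < δ := lt_min (by positivity) (by linarith)
  have hδ1 : δ * (γ * u) ≤ E := (le_div_iff₀ hγu).1 (min_le_left _ _)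
  have hδ2 : δ ≤ s - 1 := min_le_right _ _
  set y := -(1 + δ) / γ with hy
  have hγy : 1 + γ * y = -δ := by
    rw [hy, mul_div_cancel₀ _ hγ.ne]
    ring
  have hle : y ≤ 1 / t := by
    have : γ * (1 / t) ≤ γ * y := by linarith
    exact (mul_le_mul_left_of_neg hγ).1 this
  have hlt : -1 / γ < y := by
    have h1 : γ * (-1 / γ) = -1 := mul_div_cancel₀ _ hγ.ne
    exact (mul_lt_mul_left_of_neg hγ).1 (by linarith : γ * y < γ * (-1 / γ))
  have ha : ∀ x ∈ Icc y (1 / t), 0 < 1 + a * x := fun x hx =>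
    (convex_affine_pos a).ordConnected.out hpole ht1 ⟨hlt.le.trans hx.1, hx.2⟩
  have hg : ∀ x ∈ Icc y (1 / t), 1 + γ * x < 0 := fun x hx => by
    linarith [mul_le_mul_of_nonpos_left hx.1 hγ.le]
  have hyu : realGenTsallis a γ y ≤ u := by
    have h1 := strictMono_realTsallisExp hpole (ha y (left_mem_Icc.2 hle)) hlt
    rw [realGenTsallis, hγy, div_neg, neg_mul, div_mul_eq_mul_div, neg_le, le_div_iff₀ hδ0]
    have h2 : -1 / γ * E ≤ y * realTsallisExp a y :=
      mul_le_mul hlt.le h1.le hE0.le ((div_pos_of_neg_of_neg (by norm_num) hγ).trans hlt).le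
    refine le_trans ?_ h2
    rw [div_mul_eq_mul_div, le_div_iff_of_neg hγ]
    linarith
  obtain ⟨x, hx, hxu⟩ := intermediate_value_Icc hle
    (continuousOn_realGenTsallis ha fun x hx => (hg x hx).ne) ⟨hyu, h.le⟩
  refine ⟨x, ha x hx, hg x hx, lt_of_le_of_ne hx.2 fun h0 => ?_, hxu⟩
  rw [← hxu, h0] at h
  exact lt_irrefl _ h

/-- A negative number off the closure of the omitted set is a value of `f` at a point where `f` is
strictly increasing: otherwise it lies at or between the extreme values of `f` on the two sides of
the pole, where no value is taken. -/
theorem exists_regular_realGenTsallis_eq (ha1 : a < 1) (hγa : γ ≤ a) (hu : u < 0)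
    (h : u ∉ closure {u | ¬ ∃ x, 0 < 1 + a * x ∧ 1 + γ * x ≠ 0 ∧ realGenTsallis a γ x = u}) :
    ∃ x, 0 < 1 + a * x ∧ 1 + γ * x ≠ 0 ∧ 0 < 1 + a * x + x * (1 + γ * x) ∧
      realGenTsallis a γ x = u := by
  set r := √((1 + a) ^ 2 - 4 * γ) with hr
  have hr1 : 1 - a ≤ r := Real.le_sqrt_of_sq_le (by linarith [sq_nonneg a])
  have hr2 : r ^ 2 = (1 + a) ^ 2 - 4 * γ :=
    Real.sq_sqrt (by linarith [sq_nonneg (1 - a)])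
  obtain ⟨s, hs⟩ : ∃ s, s = (r + 1 + a) / 2 := ⟨_, rfl⟩
  obtain ⟨t, ht⟩ : ∃ t, t = (r - 1 - a) / 2 := ⟨_, rfl⟩
  have hst : s - t = 1 + a := by rw [hs, ht]; ring
  have hst' : s * t = -γ := by rw [hs, ht]; linear_combination hr2 / 4
  have hs1 : 1 ≤ s := by rw [hs]; linarith
  have ht1 : 0 < 1 + t := by rw [ht]; linarith
  have hs0 : 0 < s := by linarith
  have e1 : 1 + a * (-1 / s) = (1 + t) / s := by field_simp; linarith
  have e2 : 1 + γ * (-1 / s) = 1 + t := by field_simp; linarith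
  have ha0 : 0 < 1 + a * (-1 / s) := by rw [e1]; positivity
  have hγ0 : 0 < 1 + γ * (-1 / s) := by rw [e2]; exact ht1
  by_cases hA : realGenTsallis a γ (-1 / s) < u
  · have ha : ∀ x ∈ Icc (-1 / s) 0, 0 < 1 + a * x := fun x hx =>
      (convex_affine_pos a).ordConnected.out ha0 (by simp) hx
    have hg : ∀ x ∈ Icc (-1 / s) 0, 0 < 1 + γ * x := fun x hx =>
      (convex_affine_pos γ).ordConnected.out hγ0 (by simp) hx
    have hle : -1 / s ≤ 0 := div_nonpos_of_nonpos_of_nonneg (by norm_num) hs0.le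
    obtain ⟨x, hx, hxu⟩ := intermediate_value_Icc hle
      (continuousOn_realGenTsallis ha fun x hx => (hg x hx).ne')
      ⟨hA.le, by simpa [realGenTsallis] using hu.le⟩
    refine ⟨x, ha x hx, (hg x hx).ne', ?_, hxu⟩
    have hlt : -1 / s < x := lt_of_le_of_ne hx.1 fun h0 => by
      rw [← hxu, ← h0] at hA
      exact lt_irrefl _ hA
    rw [div_lt_iff₀ hs0] at hlt
    rw [numerator_eq hst hst']
    exact mul_pos (by linarith) (one_sub_mul_pos hst hst' hs1 (ha x hx) (hg x hx))
  have hA := not_lt.1 hA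
  by_cases hex : ∃ y, 0 < 1 + a * y ∧ 1 + γ * y < 0
  · obtain ⟨y, hya, hyγ⟩ := hex
    have hγ := (pos_of_one_add_mul_neg hγa hya hyγ).2
    have hlt : γ < a := lt_of_le_of_ne hγa fun h0 => by
      rw [h0] at hyγ
      linarith
    have hr3 : 1 - a < r := Real.lt_sqrt_of_sq_lt (by linarith [sq_nonneg a])
    have hs2 : 1 < s := by rw [hs]; linarith
    have ht0 : 0 < t := pos_of_mul_pos_right (by linarith : 0 < s * t) hs0.le
    have hta : 0 < t + a := by rw [ht]; linarith
    by_cases hB : u < realGenTsallis a γ (1 / t)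
    · obtain ⟨x, hxa, hxγ, hxt, hxu⟩ :=
        exists_realGenTsallis_eq_of_lt hlt hst' hs2 ht0 hta hu hB
      refine ⟨x, hxa, hxγ.ne, ?_, hxu⟩
      rw [lt_div_iff₀ ht0] at hxt
      rw [numerator_eq hst hst']
      have := mul_pos hs0 (pos_of_one_add_mul_neg hγa hxa hxγ).1
      exact mul_pos (by linarith) (by linarith)
    · have hcc := critical_lt_critical hst hst' hs2 ht0 hta
      refine absurd (closure_mono ?_ (?_ : u ∈ closure
        (Ioo (realGenTsallis a γ (1 / t)) (realGenTsallis a γ (-1 / s))))) h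
      · rintro c hc ⟨x, hxa, hxγ, rfl⟩
        rcases hxγ.lt_or_gt with h1 | h1
        · exact (le_critical hγa hst hst' hs2 ht0 hta hxa h1).not_gt hc.1
        · exact (critical_le hst hst' hs1 ht1 hxa h1).not_gt hc.2
      · rw [closure_Ioo hcc.ne]
        exact ⟨not_lt.1 hB, hA⟩
  · refine absurd (closure_mono ?_ (?_ : u ∈ closure (Iio (realGenTsallis a γ (-1 / s))))) h
    · rintro c hc ⟨x, hxa, hxγ, rfl⟩
      rcases hxγ.lt_or_gt with h1 | h1
      · exact hex ⟨x, hxa, h1⟩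
      · exact (critical_le hst hst' hs1 ht1 hxa h1).not_gt hc
    · rw [closure_Iio]
      exact hA

/-- The case `κ = 1`, where `f(x) = x (1 + x) / (1 + γ x)` and `f(x) = u` is a quadratic equation
with discriminant `(1 - γ u)² + 4 u`. -/
theorem exists_regular_of_quadratic (hγ1 : γ < 1)
    (h : u ∉ closure {u | ¬ ∃ x : ℝ, 1 + γ * x ≠ 0 ∧ x / (1 + γ * x) * (1 + x) = u}) :
    ∃ x : ℝ, 1 + γ * x ≠ 0 ∧ 0 < 1 + x + x * (1 + γ * x) ∧ x / (1 + γ * x) * (1 + x) = u := by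
  have hdisc : ∀ᶠ c in 𝓝 u, 0 ≤ (1 - γ * c) ^ 2 + 4 * c := by
    filter_upwards [isClosed_closure.isOpen_compl.mem_nhds h] with c hc
    obtain ⟨x, hx, rfl⟩ := not_not.1 fun h0 => hc (subset_closure h0)
    have : (1 - γ * (x / (1 + γ * x) * (1 + x))) ^ 2 + 4 * (x / (1 + γ * x) * (1 + x)) =
        ((1 + 2 * x + γ * x ^ 2) / (1 + γ * x)) ^ 2 := by
      field_simp
      ring
    rw [this]
    positivity
  -- a zero of the discriminant at `u` would be a local minimum, hence a double zero; this needs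
  -- `γ = 1`
  have hpos : 0 < (1 - γ * u) ^ 2 + 4 * u := by
    refine lt_of_le_of_ne hdisc.self_of_nhds fun h0 => ?_
    have hmin : IsLocalMin (fun c => (1 - γ * c) ^ 2 + 4 * c) u := by
      filter_upwards [hdisc] with c hc
      rwa [← h0]
    have hd : HasDerivAt (fun c => (1 - γ * c) ^ 2 + 4 * c) (2 * (1 - γ * u) * -γ + 4) u := by
      refine (((((hasDerivAt_id' u).const_mul γ).const_sub 1).pow 2).add
        ((hasDerivAt_id' u).const_mul 4)).congr_deriv ?_
      simp
    have h1 := hmin.hasDerivAt_eq_zero hd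
    have h2 : γ * (1 - γ * u) = 2 := by linarith
    have h3 : γ = 1 := by
      linear_combination -(γ ^ 2 / 4) * h0 - (γ * (1 - γ * u) + 2) / 4 * h2 + h2
    exact hγ1.ne h3
  obtain ⟨d, hd0, hd⟩ : ∃ d : ℝ, 0 < d ∧ d ^ 2 = (1 - γ * u) ^ 2 + 4 * u :=
    ⟨√((1 - γ * u) ^ 2 + 4 * u), Real.sqrt_pos.2 hpos, Real.sq_sqrt hpos.le⟩
  have key : ∀ e : ℝ, e ^ 2 = (1 - γ * u) ^ 2 + 4 * u →
      0 < (1 + γ * ((e - (1 - γ * u)) / 2)) * e → ∃ x : ℝ, 1 + γ * x ≠ 0 ∧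
        0 < 1 + x + x * (1 + γ * x) ∧ x / (1 + γ * x) * (1 + x) = u := fun e he hpos => by
    have h1 := left_ne_zero_of_mul hpos.ne'
    refine ⟨(e - (1 - γ * u)) / 2, h1, ?_, ?_⟩
    · have : 1 + (e - (1 - γ * u)) / 2 + (e - (1 - γ * u)) / 2 *
          (1 + γ * ((e - (1 - γ * u)) / 2)) = (1 + γ * ((e - (1 - γ * u)) / 2)) * e := by
        linear_combination -γ / 4 * he
      rwa [this]
    · rw [div_mul_eq_mul_div, div_eq_iff h1]
      linear_combination he / 4
  -- the two roots `x₊`, `x₋` satisfy `(1 + γ x₊) (1 + γ x₋) = 1 - γ > 0`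
  have hprod : (1 + γ * ((d - (1 - γ * u)) / 2)) * (1 + γ * ((-d - (1 - γ * u)) / 2)) = 1 - γ := by
    linear_combination -γ ^ 2 / 4 * hd
  rcases lt_or_ge 0 (1 + γ * ((d - (1 - γ * u)) / 2)) with h1 | h1
  · exact key d hd (mul_pos h1 hd0)
  · refine key (-d) (by rw [neg_sq, hd]) (mul_pos_of_neg_of_neg ?_ (neg_neg_of_pos hd0))
    by_contra h2
    linarith [mul_nonpos_of_nonpos_of_nonneg h1 (not_lt.1 h2)]

end Regular

end LambertTsallis

namespace VarianceProfile

open Complex LambertTsallis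

variable {p α u x : ℝ}

theorem tsallisExp_ofReal (hx : 0 < 1 + (1 - α) * x) :
    tsallisExp (angleParam α) x = (realTsallisExp (1 - α) x : ℂ) := by
  have hm := one_add_mul_ofReal_mem.2 hx
  rw [tsallisExp_eq_exp (slitPlane_ne_zero hm), logTsallis, realTsallisExp, ofReal_exp]
  split_ifs with h
  · rfl
  · rw [one_add_mul_ofReal, ofReal_div, ofReal_log hx.le]

theorem genTsallis_ofReal (hx : 0 < 1 + (1 - α) * x) :
    genTsallis (angleParam α) (shapeParam p) x = (realGenTsallis (1 - α) (shapeParam p) x : ℂ) := by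
  rw [genTsallis, tsallisExp_ofReal hx, realGenTsallis]
  push_cast
  rfl

theorem mem_expDomain_of_pos (hx : 0 < 1 + (1 - α) * x) : (x : ℂ) ∈ expDomain (angleParam α) :=
  mem_expDomain_iff.2 (Or.inr (one_add_mul_ofReal_mem.2 hx))

theorem shapeParam_lt_one (hp : 0 < p) (hp1 : p < 1) : shapeParam p < 1 := by
  rw [shapeParam, div_lt_one hp]
  linarith

theorem shapeParam_le (hp : 0 < p) (hpα : p + α * p ≤ 1) : shapeParam p ≤ 1 - α := by
  rw [shapeParam, div_le_iff₀ hp]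
  linarith

/-- All numbers from `f(-1/2) < 0` on are values of `f`. -/
theorem closure_omittedReals_subset (hp : 0 < p) (hp1 : p < 1) (hα : 0 ≤ α)
    (hpα : p + α * p ≤ 1) : closure (omittedReals (angleParam α) (shapeParam p)) ⊆ Iio 0 := by
  have hγ1 := shapeParam_lt_one hp hp1
  have ha : 0 < 1 + (1 - α) * (-1 / 2) := by linarith
  have hγ : 0 < 1 + shapeParam p * (-1 / 2) := by linarith
  have hc : realGenTsallis (1 - α) (shapeParam p) (-1 / 2) < 0 :=
    mul_neg_of_neg_of_pos (div_neg_of_neg_of_pos (by norm_num) hγ) (realTsallisExp_pos _ _)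
  refine (closure_minimal (fun u hu => ?_) isClosed_Iic).trans (Iic_subset_Iio.2 hc)
  by_contra h
  obtain ⟨x, hx, hx1, rfl⟩ : ∃ x, 0 < 1 + (1 - α) * x ∧ 1 + shapeParam p * x ≠ 0 ∧
      realGenTsallis (1 - α) (shapeParam p) x = u := by
    rcases le_or_gt 0 u with h0 | h0
    · exact exists_realGenTsallis_eq_of_nonneg (by linarith) (shapeParam_le hp hpα) hγ1 h0
    · have ha' : ∀ x ∈ Icc (-1 / 2) 0, 0 < 1 + (1 - α) * x := fun x hx =>
        (convex_affine_pos _).ordConnected.out ha (by simp) hx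
      have hγ' : ∀ x ∈ Icc (-1 / 2) 0, 0 < 1 + shapeParam p * x := fun x hx =>
        (convex_affine_pos _).ordConnected.out hγ (by simp) hx
      obtain ⟨x, hx, hxu⟩ := intermediate_value_Icc (by norm_num : (-1 / 2 : ℝ) ≤ 0)
        (continuousOn_realGenTsallis ha' fun x hx => (hγ' x hx).ne')
        ⟨(not_le.1 h).le, by simpa [realGenTsallis] using h0.le⟩
      exact ⟨x, ha' x hx, (hγ' x hx).ne', hxu⟩
  exact hu ⟨x, mem_expDomain_of_pos hx, hx1, genTsallis_ofReal hx⟩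

theorem slitPlane_subset_mainDomain (hp : 0 < p) (hp1 : p < 1) (hα : 0 ≤ α)
    (hpα : p + α * p ≤ 1) : slitPlane ⊆ mainDomain (angleParam α) (shapeParam p) := by
  rintro _ hu ⟨c, hc, rfl⟩
  exact lt_asymm (closure_omittedReals_subset hp hp1 hα hpα hc) (ofReal_mem_slitPlane.1 hu)

/-- Negative numbers of the main domain are values of `f` at real points with `f' > 0`. -/
theorem exists_regular_genTsallis_eq (hp : 0 < p) (hp1 : p < 1) (hα : 0 ≤ α)
    (hpα : p + α * p ≤ 1) (hu : u < 0)
    (h : u ∉ closure (omittedReals (angleParam α) (shapeParam p))) :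
    ∃ x : ℝ, (x : ℂ) ∈ expDomain (angleParam α) ∧ 1 + shapeParam p * x ≠ 0 ∧
      0 < 1 + (1 - α) * x + x * (1 + shapeParam p * x) ∧
      genTsallis (angleParam α) (shapeParam p) x = u := by
  rcases hα.eq_or_lt with hα0 | hα0
  · have hα0 := hα0.symm
    have hdom : ∀ x : ℝ, (x : ℂ) ∈ expDomain (angleParam α) := fun x =>
      mem_expDomain_iff.2 (Or.inl hα0)
    have hval : ∀ x : ℝ, genTsallis (angleParam α) (shapeParam p) x =
        ((x / (1 + shapeParam p * x) * (1 + x) : ℝ) : ℂ) := fun x => by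
      rw [genTsallis, tsallisExp_of_eq_zero hα0]
      push_cast
      rfl
    have hset : omittedReals (angleParam α) (shapeParam p) =
        {u | ¬ ∃ x : ℝ, 1 + shapeParam p * x ≠ 0 ∧ x / (1 + shapeParam p * x) * (1 + x) = u} := by
      ext c
      simp only [omittedReals, mem_ofPred_eq, hdom, true_and, hval, ofReal_inj]
    rw [hset] at h
    obtain ⟨x, hx1, hx2, hx3⟩ := exists_regular_of_quadratic (shapeParam_lt_one hp hp1) h
    refine ⟨x, hdom x, hx1, ?_, by rw [hval, hx3]⟩
    rwa [hα0, sub_zero, one_mul]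
  · have hdom : ∀ x : ℝ, (x : ℂ) ∈ expDomain (angleParam α) ↔ 0 < 1 + (1 - α) * x := fun x => by
      rw [mem_expDomain_iff, or_iff_right hα0.ne', one_add_mul_ofReal_mem]
    have hset : omittedReals (angleParam α) (shapeParam p) = {u | ¬ ∃ x : ℝ,
        0 < 1 + (1 - α) * x ∧ 1 + shapeParam p * x ≠ 0 ∧
          realGenTsallis (1 - α) (shapeParam p) x = u} := by
      ext c
      refine not_congr (exists_congr fun x => ?_)
      rw [hdom]
      refine and_congr_right fun hx => ?_
      rw [genTsallis_ofReal hx, ofReal_inj]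
    rw [hset] at h
    obtain ⟨x, hx, hx1, hx2, hx3⟩ := exists_regular_realGenTsallis_eq (a := 1 - α) (by linarith)
      (shapeParam_le hp hpα) hu h
    exact ⟨x, (hdom x).2 hx, hx1, hx2, by rw [genTsallis_ofReal hx, hx3]⟩

end VarianceProfile

namespace VarianceProfile

open Complex LambertTsallis

/-! ### The Lambert–Tsallis function and the associated measure -/

section Resolvent

variable {σ : ℝ → ℝ → ℝ} {v : ℝ} {z : ℂ} {η : ℝ → ℂ}

theorem IsSolution.im_integral_nonneg (h : IsSolution σ z η) :
    0 ≤ (∫ x in Icc (0 : ℝ) 1, η x).im := by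
  have h1 := integral_im h.integrable
  simp only [RCLike.im_to_complex] at h1
  rw [← h1]
  exact setIntegral_nonneg measurableSet_Icc fun x hx => (h.im_pos x hx).le

/-- The behaviour `∫ η_z ∼ -1/z` at infinity. -/
theorem IsSolution.norm_mul_integral_add_one_le (hσ0 : ∀ x y, 0 ≤ σ x y) (hσv : ∀ x y, σ x y ≤ v)
    (hσm : ∀ x, Measurable (σ x)) (hz : 0 < z.im) (h : IsSolution σ z η) :
    ‖z * (∫ x in Icc (0 : ℝ) 1, η x) + 1‖ ≤ v / z.im ^ 2 := by
  have hv : 0 ≤ v := (hσ0 0 0).trans (hσv 0 0)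
  set b : ℝ → ℂ := fun x => ∫ y in Icc (0 : ℝ) 1, (σ x y : ℂ) * η y with hb
  have him : ∀ x, z.im ≤ (z + b x).im := fun x => by
    rw [add_im]
    linarith [kernelIntegral_im_nonneg hσ0 hσv hσm h x]
  have hbound : ∀ᵐ x ∂(volume.restrict (Icc (0 : ℝ) 1)), ‖η x‖ ≤ 1 / z.im := by
    filter_upwards [h.eqn] with x hx
    rw [hx]
    exact norm_neg_inv_le hz (him x)
  have hint : ∫ x in Icc (0 : ℝ) 1, ‖η x‖ ≤ 1 / z.im := by
    have h1 := integral_mono_ae h.integrable.norm (integrable_const (1 / z.im)) hbound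
    simpa using h1
  have hle : ∀ x, ‖b x‖ ≤ v * (1 / z.im) := fun x =>
    (norm_kernelIntegral_le hσ0 hσv h.integrable x).trans (mul_le_mul_of_nonneg_left hint hv)
  have heq : z * (∫ x in Icc (0 : ℝ) 1, η x) + 1 = ∫ x in Icc (0 : ℝ) 1, (z * η x + 1) := by
    rw [integral_add (h.integrable.const_mul z) (integrable_const 1), integral_const_mul]
    simp
  rw [heq]
  refine (norm_integral_le_of_norm_le_const (C := v / z.im ^ 2) ?_).trans (by simp)
  filter_upwards [h.eqn] with x hx
  have hne : z + b x ≠ 0 := ne_zero_of_im_pos (hz.trans_le (him x))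
  have h1 : z * η x + 1 = -(b x * -(z + b x)⁻¹) := by
    rw [hx]
    change z * -(z + b x)⁻¹ + 1 = _
    field_simp
    ring
  rw [h1, norm_neg, norm_mul]
  have h2 := mul_le_mul (hle x) (norm_neg_inv_le hz (him x)) (norm_nonneg _) (by positivity)
  refine h2.trans_eq ?_
  field_simp

end Resolvent

section Formula

variable {p α v : ℝ} {z u : ℂ}

theorem mainBranch_zero (hp : 0 < p) (hp1 : p < 1) (hv : 0 < v) (hα : 0 ≤ α)
    (hpα : p + α * p ≤ 1) : DifferentiableAt ℂ (mainBranch p α v) 0 ∧ mainBranch p α v 0 = 0 ∧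
      ∀ᶠ u in 𝓝 0, genTsallis (angleParam α) (shapeParam p) (mainBranch p α v u) = u := by
  have h := mainBranch_eventuallyEq (x := 0) (u₀ := 0) hp hp1 hv hα hpα
    (mem_expDomain_of_pos (by simp)) (by simp) (by simp) (by simp [genTsallis])
  simpa using h

theorem mainBranch_of_mem (hu : u ∈ slitPlane) : mainBranch p α v u = slitBranch p α v u := by
  rw [mainBranch, if_pos hu]

theorem isLambertTsallis_mainBranch (hp : 0 < p) (hp1 : p < 1) (hv : 0 < v) (hα : 0 ≤ α)
    (hpα : p + α * p ≤ 1) :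
    IsLambertTsallis (angleParam α) (shapeParam p) (mainBranch p α v) where
  holomorphic u hu := by
    refine DifferentiableAt.differentiableWithinAt ?_
    by_cases hs : u ∈ slitPlane
    · refine (differentiableAt_slitBranch hp hp1 hv hα hpα hs).congr_of_eventuallyEq ?_
      filter_upwards [isOpen_slitPlane.mem_nhds hs] with u' hu'
      exact mainBranch_of_mem hu'
    · rw [mem_slitPlane_iff, not_or, not_lt, not_not] at hs
      obtain ⟨c, rfl⟩ : ∃ c : ℝ, (c : ℂ) = u := ⟨u.re, by apply Complex.ext <;> simp [hs.2]⟩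
      rw [ofReal_re] at hs
      rcases hs.1.lt_or_eq with h0 | h0
      · obtain ⟨x, hx, hx1, hQ, hxu⟩ := exists_regular_genTsallis_eq hp hp1 hα hpα h0
          fun h => hu ⟨c, h, rfl⟩
        exact (mainBranch_eventuallyEq hp hp1 hv hα hpα hx hx1 hQ hxu).1
      · rw [h0, ofReal_zero]
        exact (mainBranch_zero hp hp1 hv hα hpα).1
  map_zero := (mainBranch_zero hp hp1 hv hα hpα).2.1
  local_inverse := (mainBranch_zero hp hp1 hv hα hpα).2.2

theorem zero_mem_mainDomain (hp : 0 < p) (hp1 : p < 1) (hα : 0 ≤ α) (hpα : p + α * p ≤ 1) :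
    (0 : ℂ) ∈ mainDomain (angleParam α) (shapeParam p) := by
  rintro ⟨c, hc, h⟩
  exact (closure_omittedReals_subset hp hp1 hα hpα hc).ne (ofReal_eq_zero.1 h)

theorem isOpen_mainDomain (κ : OnePoint ℝ) (γ : ℝ) : IsOpen (mainDomain κ γ) :=
  (isometry_ofReal.isClosedEmbedding.isClosedMap _ isClosed_closure).isOpen_compl

/-- Near `0`, both `W` and `mainBranch` are the local inverse of `f` with value `0` at `0`; the slit
plane is connected and meets every neighbourhood of `0`. -/
theorem eq_slitBranch_of_isLambertTsallis (hp : 0 < p) (hp1 : p < 1) (hv : 0 < v) (hα : 0 ≤ α)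
    (hpα : p + α * p ≤ 1) {W : ℂ → ℂ}
    (hW : IsLambertTsallis (angleParam α) (shapeParam p) W) (hu : u ∈ slitPlane) :
    W u = slitBranch p α v u := by
  have hreg : (0 : ℂ) ∈ {w : ℂ | w ∈ expDomain (angleParam α) ∧
      1 + (shapeParam p : ℂ) * w ≠ 0} :=
    ⟨by simpa using mem_expDomain_of_pos (α := α) (x := 0) (by simp), by simp⟩
  have han := (differentiableOn_genTsallis (p := p) (α := α)).analyticAt
    (isOpen_regular.mem_nhds hreg)
  obtain ⟨d, hd0, hd⟩ := deriv_genTsallis_ofReal (p := p) (α := α) (x := 0)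
    (mem_expDomain_of_pos (by simp)) (by simp) (by simp)
  rw [ofReal_zero] at hd
  obtain ⟨g, -, -, -, hg, -⟩ := exists_local_inverse han
    (by rw [hd]; exact ofReal_ne_zero.2 hd0.ne')
  have hlocal : ∀ {W' : ℂ → ℂ}, IsLambertTsallis (angleParam α) (shapeParam p) W' →
      W' =ᶠ[𝓝 0] g := fun {W'} hW' => by
    have hc := (hW'.holomorphic.differentiableAt ((isOpen_mainDomain _ _).mem_nhds
      (zero_mem_mainDomain hp hp1 hα hpα))).continuousAt.tendsto
    rw [hW'.map_zero] at hc
    filter_upwards [hc.eventually hg, hW'.local_inverse] with u h1 h2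
    rw [← h1, h2]
  have hM := isLambertTsallis_mainBranch hp hp1 hv hα hpα
  have heq : W =ᶠ[𝓝 0] mainBranch p α v := (hlocal hW).trans (hlocal hM).symm
  obtain ⟨e, he, he0⟩ : ∃ e : ℝ, W =ᶠ[𝓝 (e : ℂ)] mainBranch p α v ∧ 0 < e := by
    have ht : Tendsto (fun e : ℝ => (e : ℂ)) (𝓝[>] 0) (𝓝 0) := by
      have := continuous_ofReal.tendsto 0
      rw [ofReal_zero] at this
      exact this.mono_left nhdsWithin_le_nhds
    exact ((ht.eventually heq.eventually_nhds).and self_mem_nhdsWithin).exists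
  have hsub := slitPlane_subset_mainDomain hp hp1 hα hpα
  rw [← mainBranch_of_mem hu]
  exact ((hW.holomorphic.mono hsub).analyticOnNhd isOpen_slitPlane).eqOn_of_preconnected_of_eventuallyEq
    ((hM.holomorphic.mono hsub).analyticOnNhd isOpen_slitPlane)
    (starConvex_one_slitPlane.isPathConnected one_mem_slitPlane).isConnected.isPreconnected
    (ofReal_mem_slitPlane.2 he0) he hu

theorem isParam_of_im_pos (hp : 0 < p) (hp1 : p < 1) (hv : 0 < v) (hα : 0 ≤ α)
    (hpα : p + α * p ≤ 1) (hz : 0 < z.im) :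
    IsParam p (1 - α) v z (slitBranch p α v (-((v : ℂ) * p) / z ^ 2)) := by
  have h := isParam_slitBranch hp hp1 hv hα hpα (neg_div_sq_mem_slitPlane hp hv hz)
  rwa [rootPoint_neg_div_sq hp hv hz] at h

/-- The right-hand side of the formula for the Stieltjes transform. -/
noncomputable def explicitStieltjes (p α v : ℝ) (z : ℂ) : ℂ :=
  -(2 * (p : ℂ)) / (z * slitBranch p α v (-((v : ℂ) * p) / z ^ 2)) + (1 - 2 * (p : ℂ)) / z
    - 2 * z / (v : ℂ)

/-- For every `z` in the upper half-plane the functional equation has a solution with integral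
`explicitStieltjes p α v z`. -/
theorem exists_isSolution (hp : 0 < p) (hp1 : p < 1) (hv : 0 < v) (hα : 0 ≤ α)
    (hpα : p + α * p ≤ 1) (hz : 0 < z.im) : ∃ η, IsSolution (trapezoid p α v) z η ∧
      explicitStieltjes p α v z = ∫ x in Icc (0 : ℝ) 1, η x := by
  have h := isParam_of_im_pos hp hp1 hv hα hpα hz
  exact ⟨_, h.isSolution hp hp1 hv hα hpα, (h.integral_paramSolution hp hp1 hv hα hpα).symm⟩

theorem differentiableOn_explicitStieltjes (hp : 0 < p) (hp1 : p < 1) (hv : 0 < v) (hα : 0 ≤ α)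
    (hpα : p + α * p ≤ 1) :
    DifferentiableOn ℂ (explicitStieltjes p α v) {z | 0 < z.im} := fun z hz => by
  have hz0 := ne_zero_of_im_pos hz
  have h0 : DifferentiableAt ℂ (fun z : ℂ => -((v : ℂ) * p) / z ^ 2) z :=
    (differentiableAt_const _).div (differentiableAt_pow 2) (pow_ne_zero 2 hz0)
  have h1 : DifferentiableAt ℂ (fun z : ℂ => slitBranch p α v (-((v : ℂ) * p) / z ^ 2)) z :=
    DifferentiableAt.comp (g := slitBranch p α v) z
      (differentiableAt_slitBranch hp hp1 hv hα hpα (neg_div_sq_mem_slitPlane hp hv hz)) h0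
  have h2 := (isParam_of_im_pos hp hp1 hv hα hpα hz).ne_zero
  refine DifferentiableAt.differentiableWithinAt ?_
  refine DifferentiableAt.sub (DifferentiableAt.add ?_ ?_) ?_
  · exact (differentiableAt_const _).div (differentiableAt_id.mul h1) (mul_ne_zero hz0 h2)
  · exact (differentiableAt_const _).div differentiableAt_id hz0
  · exact (differentiableAt_id.const_mul 2).div_const _

theorem exists_isAssociatedMeasure (hp : 0 < p) (hp1 : p < 1) (hv : 0 < v) (hα : 0 ≤ α)
    (hpα : p + α * p ≤ 1) : ∃ μ, IsAssociatedMeasure (trapezoid p α v) μ := by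
  obtain ⟨μ, hμ, hS⟩ := exists_stieltjes_eq (K := v)
    (differentiableOn_explicitStieltjes hp hp1 hv hα hpα)
    (fun z hz => by
      obtain ⟨η, hη, hS⟩ := exists_isSolution hp hp1 hv hα hpα hz
      rw [hS]
      exact hη.im_integral_nonneg) hv.le
    fun z hz => by
      obtain ⟨η, hη, hS⟩ := exists_isSolution hp hp1 hv hα hpα hz
      rw [hS]
      exact hη.norm_mul_integral_add_one_le (trapezoid_nonneg hv) (trapezoid_le hv)
        measurable_trapezoid hz
  refine ⟨μ, hμ, fun z hz => ?_⟩
  have hz0 : 0 < z.im := one_pos.trans hz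
  obtain ⟨η, hη, hS'⟩ := exists_isSolution hp hp1 hv hα hpα hz0
  refine ⟨η, hη, fun η' hη' => ?_, (hS z hz0).trans hS'⟩
  exact hη.ae_eq (trapezoid_nonneg hv) (trapezoid_le hv) measurable_trapezoid hz0 hη'

/-- The equality for `Im z > 1`, which is part of the definition of the associated measure, extends to
the upper half-plane by the identity theorem. -/
theorem stieltjes_eq_explicitStieltjes (hp : 0 < p) (hp1 : p < 1) (hv : 0 < v) (hα : 0 ≤ α)
    (hpα : p + α * p ≤ 1) {μ : Measure ℝ} (hμ : IsAssociatedMeasure (trapezoid p α v) μ)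
    (hz : 0 < z.im) : stieltjes μ z = explicitStieltjes p α v z := by
  have := hμ.isProbability
  have hopen := isOpen_im_gt 0
  have heq : stieltjes μ =ᶠ[𝓝 (2 * I)] explicitStieltjes p α v := by
    filter_upwards [(isOpen_im_gt 1).mem_nhds (by simp : (1 : ℝ) < (2 * I).im)] with z hz
    obtain ⟨η, -, huniq, hS⟩ := hμ.stieltjes_eq z hz
    obtain ⟨η', hη', hS'⟩ := exists_isSolution hp hp1 hv hα hpα (one_pos.trans hz : 0 < z.im)
    rw [hS, hS']
    exact integral_congr_ae (huniq η' hη').symm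
  exact ((differentiableOn_stieltjes μ).analyticOnNhd hopen).eqOn_of_preconnected_of_eventuallyEq
    ((differentiableOn_explicitStieltjes hp hp1 hv hα hpα).analyticOnNhd hopen)
    (convex_halfSpace_im_gt 0).isPreconnected (by simp : (0 : ℝ) < (2 * I).im) heq hz

end Formula

end VarianceProfile

theorem theorem4p3 (p α v : ℝ) (hp0 : 0 < p) (hp1 : p < 1) (hα0 : 0 ≤ α)
    (hα1 : α ≤ (1 - p) / p) (hv : 0 < v) :
    (∃ W : ℂ → ℂ, LambertTsallis.IsLambertTsallis
      (VarianceProfile.angleParam α) (VarianceProfile.shapeParam p) W) ∧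
    (∃ μ : Measure ℝ, VarianceProfile.IsAssociatedMeasure
      (VarianceProfile.trapezoid p α v) μ) ∧
    ∀ (W : ℂ → ℂ) (μ : Measure ℝ),
      LambertTsallis.IsLambertTsallis
        (VarianceProfile.angleParam α) (VarianceProfile.shapeParam p) W →
      VarianceProfile.IsAssociatedMeasure (VarianceProfile.trapezoid p α v) μ →
      ∀ z : ℂ, 0 < z.im →
        -((v : ℂ) * p) / z ^ 2 ∈ LambertTsallis.mainDomain
          (VarianceProfile.angleParam α) (VarianceProfile.shapeParam p) ∧
        W (-((v : ℂ) * p) / z ^ 2) ≠ 0 ∧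
        VarianceProfile.stieltjes μ z =
          -(2 * (p : ℂ)) / (z * W (-((v : ℂ) * p) / z ^ 2)) + (1 - 2 * (p : ℂ)) / z
            - 2 * z / (v : ℂ) := by
  have hpα : p + α * p ≤ 1 := by linarith [(le_div_iff₀ hp0).1 hα1]
  refine ⟨⟨_, VarianceProfile.isLambertTsallis_mainBranch hp0 hp1 hv hα0 hpα⟩,
    VarianceProfile.exists_isAssociatedMeasure hp0 hp1 hv hα0 hpα, fun W μ hW hμ z hz => ?_⟩
  have hu := VarianceProfile.neg_div_sq_mem_slitPlane hp0 hv hz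
  refine ⟨VarianceProfile.slitPlane_subset_mainDomain hp0 hp1 hα0 hpα hu, ?_, ?_⟩
  · rw [VarianceProfile.eq_slitBranch_of_isLambertTsallis hp0 hp1 hv hα0 hpα hW hu]
    exact (VarianceProfile.isParam_of_im_pos hp0 hp1 hv hα0 hpα hz).ne_zero
  · rw [VarianceProfile.eq_slitBranch_of_isLambertTsallis hp0 hp1 hv hα0 hpα hW hu]
    exact VarianceProfile.stieltjes_eq_explicitStieltjes hp0 hp1 hv hα0 hpα hμ hz
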